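/- Let $d\ge 2$, let $U\subseteq\mathbb R^d$ be a bounded open set, and let $s\in[0,1)$. All functions are real valued. **Function spaces.** For $A\subseteq\mathbb R^d$ open put $\|f\|_{H^s(A)}=\|f\|_{L^2(A)}+[f]_{s,A}$, where $[f]_{0,A}=0$ and $[f]_{s,A}^2=\int_A\int_A\frac{|f(x)-f(y)|^2}{|x-y|^{d+2s}}\,dx\,dy$ for $0<s<1$. Let $H^s(U)$ be the completion of $\{\varphi|_U:\varphi\in C^\infty(\mathbb R^d),\ \|\varphi\|_{H^s(U)}<\infty\}$ in $\|\cdot\|_{H^s(U)}$, and $H^1(U)$ the completion of $\{\varphi|_U:\varphi\in C^\infty(\mathbb R^d),\ \|\varphi\|_{L^2(U)}+\|\nabla\varphi\|_{L^2(U)}<\infty\}$ in the norm $\|\varphi\|_{L^2(U)}+\|\nabla\varphi\|_{L^2(U)}$; let $H^s_0(U)$ be the completion of $C_c^\infty(U)$ in $\|\cdot\|_{H^s(\mathbb R^d)}$, and $H^1_0(U)$ that of $C_c^\infty(U)$ in $\|\varphi\|_{L^2}+\|\nabla\varphi\|_{L^2}$. All of them are regarded as subspaces of $L^2(U)$. A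 bounded symmetric form $\mathcal Z$ on $V\in\{H^s_0(U),H^s(U)\}$ is a symmetric bilinear map $V\times V\to\mathbb R$ with $|||\mathcal Z|||_V:=\sup\{|\mathcal Z(v,v)|:\|v\|_V=1\}<\infty$. $U$ is called a Lipschitz domain if for each $y\in\partial U$ there is an $r>0$ such that, in suitably rotated orthonormal coordinates, $U\cap B(y,r)$ is the set of points of $B(y,r)$ that lie strictly above the graph of a Lipschitz function of the first $d-1$ coordinates. **The forms.** Let $W\in C(\overline U)$. For a bounded symmetric form $\mathcal Z$ on $H^s_0(U)$ (resp. $H^s(U)$, with $U$ Lipschitz) let $\mathcal E^{\mathrm D}_{W,\mathcal Z}$ (resp. $\mathcal E^{\mathrm N}_{W,\mathcal Z}$) be the symmetric form on $L^2(U)$ with domain $e^WH^1_0(U)$ (resp. $e^WH^1(U)$) and $$\mathcal E_{W,\mathcal Z}(e^Wu^\flat,e^Wu^\flat)=\int_U e^{2W}|\nabla u^\flat|^2\,dx+\mathcal Z(u^\flat,u^\flat).$$ **Compact convergence.** A symmetric form $\mathcal Q$ with domain $\mathcal D(\mathcal Q)$ in a real Hilbert space $H$ is $M$-bounded from below if $\mathcal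 Q(u,u)+M\|u\|^2\ge0$ on $\mathcal D(\mathcal Q)$, and closed if $\mathcal D(\mathcal Q)$ is dense and is, for some $M>0$, a Hilbert space under $\mathcal Q+M\langle\cdot,\cdot\rangle$. Put $\mathcal Q(u,u)=\infty$ for $u\notin\mathcal D(\mathcal Q)$. A sequence $(\mathcal Q_n)$ converges compactly to $\mathcal Q$ if there is an $M>0$ such that all $\mathcal Q_n$ and $\mathcal Q$ are closed and $M$-bounded from below, and 1. ($\Gamma$-convergence) $u_n\to u$ in $H$ implies $\mathcal Q(u,u)\le\liminf_n\mathcal Q_n(u_n,u_n)$, and for each $u\in\mathcal D(\mathcal Q)$ there are $u_n\to u$ in $H$ with $\mathcal Q_n(u_n,u_n)\to\mathcal Q(u,u)$; 2. (compactness) every sequence $(u_n)$ in $H$ with $\sup_n\big(\mathcal Q_n(u_n,u_n)+(M+1)\|u_n\|^2\big)<\infty$ is precompact in $H$. **Theorem.** Let $W_n,W\in C(\overline U)$ with $W_n\to W$ uniformly on $\overline U$. * One has $H^1_0(U)\subseteq H^s_0(U)$, and if $\mathcal Z_n,\mathcal Z$ are bounded symmetric forms on $H^s_0(U)$ with $|||\mathcal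 Z_n-\mathcal Z|||_{H^s_0(U)}\to0$, then $\mathcal E^{\mathrm D}_{W_n,\mathcal Z_n}$ converges compactly to $\mathcal E^{\mathrm D}_{W,\mathcal Z}$ in $L^2(U)$. * If $U$ is a bounded Lipschitz domain, then $H^1(U)\subseteq H^s(U)$, and if $\mathcal Z_n,\mathcal Z$ are bounded symmetric forms on $H^s(U)$ with $|||\mathcal Z_n-\mathcal Z|||_{H^s(U)}\to0$, then $\mathcal E^{\mathrm N}_{W_n,\mathcal Z_n}$ converges compactly to $\mathcal E^{\mathrm N}_{W,\mathcal Z}$ in $L^2(U)$. -/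

import Mathlib

open MeasureTheory Filter Topology TopologicalSpace
open scoped ENNReal ContDiff

noncomputable section

namespace SymFormConv

/-! ### Symmetric forms on a real Hilbert space and their compact convergence -/

/-- A symmetric bilinear form on a linear subspace `domain` of `H`. Density of the domain is part
of `SymmForm.IsClosed` below. -/
structure SymmForm (H : Type*) [NormedAddCommGroup H] [InnerProductSpace ℝ H] where
  domain : Submodule ℝ H
  bilin : domain →ₗ[ℝ] domain →ₗ[ℝ] ℝ
  symm : ∀ u v, bilin u v = bilin v u

section Forms

variable {H : Type*} [NormedAddCommGroup H] [InnerProductSpace ℝ H]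

open Classical in
/-- The diagonal value `Q(u, u)`, with the convention `Q(u, u) = ∞` for `u ∉ D(Q)`. -/
def SymmForm.val (Q : SymmForm H) (u : H) : EReal :=
  if h : u ∈ Q.domain then ((Q.bilin ⟨u, h⟩ ⟨u, h⟩ : ℝ) : EReal) else ⊤

/-- The shifted form `Q(u, u) + M ‖u‖²` on `D(Q)`. -/
def SymmForm.shifted (Q : SymmForm H) (M : ℝ) (u : Q.domain) : ℝ :=
  Q.bilin u u + M * ‖(u : H)‖ ^ 2

/-- `Q` is `M`-bounded from below. -/
def SymmForm.BoundedBelow (Q : SymmForm H) (M : ℝ) : Prop :=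
  ∀ u : Q.domain, 0 ≤ Q.shifted M u

/-- `Q` is densely defined and, for some `M > 0`, the space `D(Q)` with the bilinear form
`Q + M⟨·,·⟩` is a Hilbert space: the form is positive definite and `D(Q)` is complete for the
norm that it induces. -/
def SymmForm.IsClosed (Q : SymmForm H) : Prop :=
  Dense (Q.domain : Set H) ∧
  ∃ M : ℝ, 0 < M ∧ (∀ u : Q.domain, u ≠ 0 → 0 < Q.shifted M u) ∧
    ∀ u : ℕ → Q.domain,
      (∀ ε : ℝ, 0 < ε → ∃ N : ℕ, ∀ m ≥ N, ∀ n ≥ N, Q.shifted M (u m - u n) < ε) →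
      ∃ v : Q.domain, Tendsto (fun n => Q.shifted M (u n - v)) atTop (𝓝 0)

/-- `Γ`-convergence of forms. -/
def GammaConverges (Qn : ℕ → SymmForm H) (Q : SymmForm H) : Prop :=
  (∀ (u : ℕ → H) (v : H), Tendsto u atTop (𝓝 v) →
    Q.val v ≤ liminf (fun n => (Qn n).val (u n)) atTop) ∧
  (∀ v ∈ Q.domain, ∃ u : ℕ → H, Tendsto u atTop (𝓝 v) ∧
    Tendsto (fun n => (Qn n).val (u n)) atTop (𝓝 (Q.val v)))

/-- Compactness of a sequence of forms that are `M`-bounded from below: if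
`sup_n Q_n(u_n, u_n) + (M + 1) ‖u_n‖² < ∞`, then `(u_n)` is precompact (so that each of its
subsequences has a convergent subsequence). -/
def CompactSequence (M : ℝ) (Qn : ℕ → SymmForm H) : Prop :=
  ∀ u : ℕ → H,
    (⨆ n, ((Qn n).val (u n) + (((M + 1) * ‖u n‖ ^ 2 : ℝ) : EReal))) < ⊤ →
    IsCompact (closure (Set.range u))

/-- Compact convergence of closed forms with a common lower bound `-M`. -/
def ConvergesCompactly (Qn : ℕ → SymmForm H) (Q : SymmForm H) : Prop :=
  ∃ M : ℝ, 0 < M ∧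
    (∀ n, (Qn n).IsClosed ∧ (Qn n).BoundedBelow M) ∧ Q.IsClosed ∧ Q.BoundedBelow M ∧
    GammaConverges Qn Q ∧ CompactSequence M Qn

end Forms

/-! ### Function spaces -/

abbrev E (d : ℕ) := EuclideanSpace ℝ (Fin d)

variable {d : ℕ}

abbrev L2 (U : Opens (E d)) := Lp ℝ 2 (volume.restrict (U : Set (E d)))

/-- Square integrable vector fields on `U`. -/
abbrev L2Vec (U : Opens (E d)) := Lp (E d) 2 (volume.restrict (U : Set (E d)))

/-- `C^∞(ℝ^d)`; the restrictions of its elements to the closure of `U` are `C^∞` up to the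
boundary. -/
def smoothFns (d : ℕ) : Set (E d → ℝ) := {φ | ContDiff ℝ ∞ φ}

/-- `C_c^∞(U)`, extended by zero to `ℝ^d`. -/
def testFns (U : Opens (E d)) : Set (E d → ℝ) :=
  {φ | ContDiff ℝ ∞ φ ∧ HasCompactSupport φ ∧ tsupport φ ⊆ (U : Set (E d))}

/-- A Lipschitz domain: near each boundary point `y`, after a rotation of the coordinate axes that
makes the unit vector `e` the last one, `U` is the set above the graph of a Lipschitz function
`γ` of the remaining coordinates `x - ⟨e, x⟩ e`. -/
def IsLipschitzDomain (U : Set (E d)) : Prop :=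
  ∀ y ∈ frontier U, ∃ r : ℝ, 0 < r ∧ ∃ e : E d, ‖e‖ = 1 ∧
    ∃ (K : NNReal) (γ : E d → ℝ), LipschitzWith K γ ∧
      U ∩ Metric.ball y r =
        {x | x ∈ Metric.ball y r ∧ γ (x - inner ℝ e x • e) < inner ℝ e x}

/-- The closure in `L²(U) × L²(U; ℝ^d)` of `{(φ, ∇φ) : φ ∈ T}`, i.e. the completion of (the
elements of finite norm of) `T` in the norm of `H¹(U)`. The set inside `span` is a linear subspace
already if `T` is one. -/
def H1Graph (T : Set (E d → ℝ)) (U : Opens (E d)) : Submodule ℝ (L2 U × L2Vec U) :=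
  (Submodule.span ℝ {p : L2 U × L2Vec U | ∃ φ ∈ T,
    p.1 =ᵐ[volume.restrict (U : Set (E d))] φ ∧
    p.2 =ᵐ[volume.restrict (U : Set (E d))] gradient φ}).topologicalClosure

/-- The gradient is closable, so `gradOp` is well defined. -/
lemma H1Graph_snd_eq_zero (T : Set (E d → ℝ)) (hT : T ⊆ smoothFns d) (U : Opens (E d)) :
    ∀ p ∈ H1Graph T U, p.1 = 0 → p.2 = 0 := by
  -- pairing with a test function
  have key : ∀ (ψ : E d → ℝ), ψ ∈ testFns U → ∀ v : E d, ∀ p ∈ H1Graph T U,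
      (∫ x in (U : Set (E d)), fderiv ℝ ψ x v * p.1 x)
        + (∫ x in (U : Set (E d)), ψ x * inner ℝ v (p.2 x)) = 0 := by
    intro ψ hψ v
    obtain ⟨hs, hcs, hsub⟩ := hψ
    have hdc : Continuous fun x => fderiv ℝ ψ x v :=
      (hs.continuous_fderiv (by simp)).clm_apply continuous_const
    have hdcs : HasCompactSupport fun x => fderiv ℝ ψ x v := hcs.fderiv_apply (𝕜 := ℝ) v
    have ha : MemLp (fun x => fderiv ℝ ψ x v) 2 (volume.restrict (U : Set (E d))) :=
      hdc.memLp_of_hasCompactSupport hdcs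
    have hvcs : HasCompactSupport fun x => ψ x • v := hcs.smul_right
    have hb : MemLp (fun x => ψ x • v) 2 (volume.restrict (U : Set (E d))) :=
      (hs.continuous.smul continuous_const).memLp_of_hasCompactSupport hvcs
    let L : L2 U × L2Vec U →L[ℝ] ℝ :=
      (innerSL ℝ (ha.toLp _)).comp (ContinuousLinearMap.fst ℝ _ _) +
      (innerSL ℝ (hb.toLp _)).comp (ContinuousLinearMap.snd ℝ _ _)
    have hL : ∀ p, L p = (∫ x in (U : Set (E d)), fderiv ℝ ψ x v * p.1 x)
        + (∫ x in (U : Set (E d)), ψ x * inner ℝ v (p.2 x)) := by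
      intro p
      simp only [L, _root_.add_apply, ContinuousLinearMap.comp_apply,
        ContinuousLinearMap.coe_fst', ContinuousLinearMap.coe_snd', innerSL_apply_apply,
        L2.inner_def]
      congr 1
      · apply integral_congr_ae
        filter_upwards [ha.coeFn_toLp] with x hx
        rw [hx]; simp [mul_comm]
      · apply integral_congr_ae
        filter_upwards [hb.coeFn_toLp] with x hx
        rw [hx, real_inner_smul_left]
    suffices h : H1Graph T U ≤ LinearMap.ker (L : L2 U × L2Vec U →ₗ[ℝ] ℝ) by
      intro p hp
      rw [← hL]
      exact h hp
    refine Submodule.topologicalClosure_minimal _ ?_ L.isClosed_ker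
    rw [Submodule.span_le]
    rintro p ⟨φ, hφT, h1, h2⟩
    have hφ : ContDiff ℝ ∞ φ := hT hφT
    change L p = 0
    rw [hL]
    have e1 : ∫ x in (U : Set (E d)), fderiv ℝ ψ x v * p.1 x = ∫ x, φ x * fderiv ℝ ψ x v := by
      symm
      rw [← setIntegral_eq_integral_of_forall_compl_eq_zero (s := (U : Set (E d)))]
      · apply integral_congr_ae
        filter_upwards [h1] with x hx
        rw [hx, mul_comm]
      · intro x hx
        have : fderiv ℝ ψ x = 0 := by
          by_contra hne
          exact hx (hsub (support_fderiv_subset ℝ hne))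
        simp [this]
    have e2 : ∫ x in (U : Set (E d)), ψ x * inner ℝ v (p.2 x) = ∫ x, fderiv ℝ φ x v * ψ x := by
      symm
      rw [← setIntegral_eq_integral_of_forall_compl_eq_zero (s := (U : Set (E d)))]
      · apply integral_congr_ae
        filter_upwards [h2] with x hx
        rw [hx, mul_comm, real_inner_comm, gradient, InnerProductSpace.toDual_symm_apply]
      · intro x hx
        have : ψ x = 0 := by
          by_contra hne
          exact hx (hsub (subset_tsupport _ hne))
        simp [this]
    have hφc : Continuous fun x => fderiv ℝ φ x v :=
      (hφ.continuous_fderiv (by simp)).clm_apply continuous_const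
    rw [e1, e2, integral_mul_fderiv_eq_neg_fderiv_mul_of_integrable, neg_add_cancel]
    · exact (hφc.mul hs.continuous).integrable_of_hasCompactSupport hcs.mul_left
    · exact (hφ.continuous.mul hdc).integrable_of_hasCompactSupport hdcs.mul_left
    · exact (hφ.continuous.mul hs.continuous).integrable_of_hasCompactSupport hcs.mul_left
    · exact fun x _ => hφ.differentiable (by simp) x
    · exact fun x _ => hs.differentiable (by simp) x
  intro p hp hp1
  have hloc : LocallyIntegrableOn p.2 (U : Set (E d)) volume := by
    rw [locallyIntegrableOn_iff U.isOpen.isLocallyClosed]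
    intro k hk hkc
    have h : MemLp p.2 2 (volume.restrict k) :=
      (Lp.memLp p.2).mono_measure (Measure.restrict_mono hk le_rfl)
    have : IsFiniteMeasure (volume.restrict k) :=
      ⟨by rw [Measure.restrict_apply_univ]; exact hkc.measure_lt_top⟩
    exact h.integrable (by norm_num)
  have hz : ∀ᵐ x ∂volume, x ∈ (U : Set (E d)) → p.2 x = 0 := by
    refine U.isOpen.ae_eq_zero_of_integral_contDiff_smul_eq_zero hloc ?_
    intro ψ h1 h2 h3
    have hint : Integrable (fun x => ψ x • p.2 x) (volume.restrict (U : Set (E d))) := by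
      have hψ : MemLp ψ 2 (volume.restrict (U : Set (E d))) :=
        h1.continuous.memLp_of_hasCompactSupport h2
      exact memLp_one_iff_integrable.1 ((Lp.memLp p.2).smul hψ)
    rw [← setIntegral_eq_integral_of_forall_compl_eq_zero (s := (U : Set (E d)))]
    · refine ext_inner_left ℝ fun v => ?_
      rw [inner_zero_right, ← integral_inner hint]
      have h := key ψ ⟨h1, h2, h3⟩ v p hp
      have h0 : ∫ x in (U : Set (E d)), fderiv ℝ ψ x v * p.1 x = 0 := by
        rw [hp1, integral_congr_ae (g := fun _ => (0 : ℝ)), integral_zero]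
        filter_upwards [Lp.coeFn_zero ℝ 2 (volume.restrict (U : Set (E d)))] with x hx
        rw [hx, Pi.zero_apply, mul_zero]
      rw [h0, zero_add] at h
      rw [← h]
      refine integral_congr_ae (Eventually.of_forall fun x => ?_)
      simp only [real_inner_smul_right]
    · intro x hx
      have : ψ x = 0 := by
        by_contra hne
        exact hx (h3 (subset_tsupport _ hne))
      simp [this]
  rw [Lp.eq_zero_iff_ae_eq_zero]
  exact (ae_restrict_iff' U.isOpen.measurableSet).2 hz

/-- The gradient as a linear operator on `L²(U)`: the closure of `φ ↦ ∇φ`, `φ ∈ T`. It is well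
defined by `H1Graph_snd_eq_zero`. -/
def gradOp (T : Set (E d → ℝ)) (U : Opens (E d)) : L2 U →ₗ.[ℝ] L2Vec U :=
  (H1Graph T U).toLinearPMap

/-- `H¹(U)`, the completion of `C^∞` up to the boundary, as a subspace of `L²(U)`. -/
def H1 (U : Opens (E d)) : Submodule ℝ (L2 U) := (gradOp (smoothFns d) U).domain

/-- `H¹₀(U)`, the completion of `C_c^∞(U)`, as a subspace of `L²(U)`. -/
def H10 (U : Opens (E d)) : Submodule ℝ (L2 U) := (gradOp (testFns U) U).domain

/-- The quotient `(f(x) - f(y)) / |x - y|^(d/2 + s)`, whose norm in `L²(A × A)` is the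
Slobodeckij seminorm `(∫_A ∫_A |f(x) - f(y)|² / |x - y|^(d + 2s) dx dy)^(1/2)` for `0 < s < 1`;
it is `0` by convention for `s = 0`. -/
def sloboQuot (s : ℝ) (f : E d → ℝ) (p : E d × E d) : ℝ :=
  if s = 0 then 0 else (f p.1 - f p.2) / ‖p.1 - p.2‖ ^ ((d : ℝ) / 2 + s)

/-- Lebesgue measure on `A × A`. -/
abbrev sqMeasure (A : Set (E d)) : Measure (E d × E d) :=
  (volume.restrict A).prod (volume.restrict A)

/-- The norm of `H^s(A)`, `0 ≤ s < 1`: the `L²(A)` norm plus the Slobodeckij seminorm. -/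
def sobNorm (s : ℝ) (A : Set (E d)) (f : E d → ℝ) : ℝ≥0∞ :=
  eLpNorm f 2 (volume.restrict A) + eLpNorm (sloboQuot s f) 2 (sqMeasure A)

/-- The closure in `L²(U) × L²(A × A)` of the pairs (`φ`, Slobodeckij quotient of `φ`), `φ ∈ T`:
the completion of (the elements of finite norm of) `T` in the norm of `H^s(A)`. -/
def HsGraph (s : ℝ) (T : Set (E d → ℝ)) (U : Opens (E d)) (A : Set (E d)) :
    Submodule ℝ (L2 U × Lp ℝ 2 (sqMeasure A)) :=
  (Submodule.span ℝ {p : L2 U × Lp ℝ 2 (sqMeasure A) | ∃ φ ∈ T,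
    p.1 =ᵐ[volume.restrict (U : Set (E d))] φ ∧
    p.2 =ᵐ[sqMeasure A] sloboQuot s φ}).topologicalClosure

/-- `H^s(U)`, `0 ≤ s < 1`, as a subspace of `L²(U)`. -/
def Hs (s : ℝ) (U : Opens (E d)) : Submodule ℝ (L2 U) :=
  (HsGraph s (smoothFns d) U (U : Set (E d))).map (LinearMap.fst ℝ _ _)

/-- The norm of `H^s(U)`. -/
def HsNorm (s : ℝ) (U : Opens (E d)) (f : L2 U) : ℝ≥0∞ := sobNorm s (U : Set (E d)) f

/-- `H^s₀(U)`, `0 ≤ s < 1`, the completion of `C_c^∞(U)` in the norm of `H^s(ℝ^d)`, as a subspace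
of `L²(U)`. -/
def Hs0 (s : ℝ) (U : Opens (E d)) : Submodule ℝ (L2 U) :=
  (HsGraph s (testFns U) U Set.univ).map (LinearMap.fst ℝ _ _)

/-- The norm of `H^s₀(U)`: the `H^s(ℝ^d)` norm of the extension by zero. -/
def Hs0Norm (s : ℝ) (U : Opens (E d)) (f : L2 U) : ℝ≥0∞ :=
  sobNorm s Set.univ ((U : Set (E d)).indicator f)

/-! ### Bounded symmetric forms on `H^s(U)` and `H^s₀(U)` -/

/-- The form norm `sup {|B(u, u)| : N(u) = 1}` for the norm `N`. -/
def formNorm {U : Opens (E d)} {V : Submodule ℝ (L2 U)} (N : L2 U → ℝ≥0∞)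
    (B : V →ₗ[ℝ] V →ₗ[ℝ] ℝ) : ℝ≥0∞ :=
  ⨆ (u : V) (_ : N u = 1), ‖B u u‖ₑ

/-- A bounded symmetric form on the space `V` with norm `N`. -/
structure BoundedSymmForm {U : Opens (E d)} (V : Submodule ℝ (L2 U)) (N : L2 U → ℝ≥0∞) where
  bilin : V →ₗ[ℝ] V →ₗ[ℝ] ℝ
  symm : ∀ u v, bilin u v = bilin v u
  bounded : formNorm N bilin < ⊤

/-! ### The forms `E_{W,Z}` -/

section MulExp

variable {U : Opens (E d)}

lemma exp_bound {W : E d → ℝ} (hW : MemLp W ∞ (volume.restrict (U : Set (E d)))) :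
    AEStronglyMeasurable (fun x => Real.exp (W x)) (volume.restrict (U : Set (E d))) ∧
    ∃ C : ℝ, ∀ᵐ x ∂(volume.restrict (U : Set (E d))), ‖Real.exp (W x)‖ ≤ C := by
  refine ⟨Real.continuous_exp.comp_aestronglyMeasurable hW.1, ?_⟩
  refine ⟨Real.exp (eLpNorm W ∞ (volume.restrict (U : Set (E d)))).toReal, ?_⟩
  have h := ae_le_eLpNormEssSup (f := W) (μ := volume.restrict (U : Set (E d)))
  filter_upwards [h] with x hx
  rw [Real.norm_eq_abs, abs_of_pos (Real.exp_pos _)]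
  apply Real.exp_le_exp.2
  have h2 : ‖W x‖ ≤ (eLpNorm W ∞ (volume.restrict (U : Set (E d)))).toReal := by
    rw [eLpNorm_exponent_top, ← toReal_enorm]
    refine ENNReal.toReal_mono ?_ hx
    have := hW.2.ne
    rwa [eLpNorm_exponent_top] at this
  exact (le_abs_self _).trans h2

lemma memLp_exp_mul {W : E d → ℝ} (hW : MemLp W ∞ (volume.restrict (U : Set (E d))))
    (u : L2 U) :
    MemLp (fun x => Real.exp (W x) * u x) 2 (volume.restrict (U : Set (E d))) := by
  obtain ⟨hm, C, hC⟩ := exp_bound hW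
  refine MemLp.of_le_mul (c := C) (Lp.memLp u) (hm.mul (Lp.aestronglyMeasurable u)) ?_
  filter_upwards [hC] with x hx
  rw [norm_mul]
  exact mul_le_mul_of_nonneg_right hx (norm_nonneg _)

/-- Multiplication by `e^W` on `L²(U)`. -/
def mulExp (W : E d → ℝ) (hW : MemLp W ∞ (volume.restrict (U : Set (E d)))) :
    L2 U →ₗ[ℝ] L2 U where
  toFun u := (memLp_exp_mul hW u).toLp _
  map_add' u v := by
    rw [← MemLp.toLp_add]
    apply MemLp.toLp_congr
    filter_upwards [Lp.coeFn_add u v] with x hx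
    simp only [hx, Pi.add_apply]
    ring
  map_smul' c u := by
    rw [RingHom.id_apply, ← MemLp.toLp_const_smul]
    apply MemLp.toLp_congr
    filter_upwards [Lp.coeFn_smul c u] with x hx
    simp only [hx, Pi.smul_apply, smul_eq_mul]
    ring

lemma integrable_energy {W : E d → ℝ} (hW : MemLp W ∞ (volume.restrict (U : Set (E d))))
    (g h : L2Vec U) :
    Integrable (fun x => Real.exp (2 * W x) * inner ℝ (g x) (h x))
      (volume.restrict (U : Set (E d))) := by
  obtain ⟨hm, C, hC⟩ := exp_bound (W := fun x => 2 * W x) (hW.const_mul 2)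
  exact (L2.integrable_inner (𝕜 := ℝ) g h).bdd_mul hm hC

/-- `(g, h) ↦ ∫_U e^{2W} g · h`. -/
def energy (W : E d → ℝ) (hW : MemLp W ∞ (volume.restrict (U : Set (E d)))) :
    L2Vec U →ₗ[ℝ] L2Vec U →ₗ[ℝ] ℝ :=
  LinearMap.mk₂ ℝ
    (fun g h => ∫ x in (U : Set (E d)), Real.exp (2 * W x) * inner ℝ (g x) (h x))
    (fun g g' h => by
      rw [← integral_add (integrable_energy hW g h) (integrable_energy hW g' h)]
      apply integral_congr_ae
      filter_upwards [Lp.coeFn_add g g'] with x hx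
      simp only [hx, Pi.add_apply, inner_add_left]
      ring)
    (fun c g h => by
      rw [smul_eq_mul, ← integral_const_mul]
      apply integral_congr_ae
      filter_upwards [Lp.coeFn_smul c g] with x hx
      simp only [hx, Pi.smul_apply, real_inner_smul_left]
      ring)
    (fun g h h' => by
      rw [← integral_add (integrable_energy hW g h) (integrable_energy hW g h')]
      apply integral_congr_ae
      filter_upwards [Lp.coeFn_add h h'] with x hx
      simp only [hx, Pi.add_apply, inner_add_right]
      ring)
    (fun c g h => by
      rw [smul_eq_mul, ← integral_const_mul]
      apply integral_congr_ae
      filter_upwards [Lp.coeFn_smul c h] with x hx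
      simp only [hx, Pi.smul_apply, real_inner_smul_right]
      ring)

lemma energy_symm (W : E d → ℝ) (hW : MemLp W ∞ (volume.restrict (U : Set (E d))))
    (g h : L2Vec U) : energy W hW g h = energy W hW h g := by
  simp only [energy, LinearMap.mk₂_apply]
  refine integral_congr_ae (Eventually.of_forall fun x => ?_)
  simp only [real_inner_comm]

end MulExp

section ExpForm

variable {U : Opens (E d)} (T : Set (E d → ℝ)) (V : Submodule ℝ (L2 U)) (W : E d → ℝ)
  (hW : MemLp W ∞ (volume.restrict (U : Set (E d))))

/-- The set `e^W (H ∩ V)`, where `H` is the domain of the gradient: all `u` such that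
`u♭ = e^{-W} u` lies in `H ∩ V`. -/
def expDomain : Submodule ℝ (L2 U) :=
  ((gradOp T U).domain ⊓ V).comap (mulExp (-W) hW.neg)

/-- `u ↦ u♭ = e^{-W} u` as an element of `V`. -/
def flat : expDomain T V W hW →ₗ[ℝ] V :=
  ((mulExp (-W) hW.neg).domRestrict (expDomain T V W hW)).codRestrict V (fun u => u.2.2)

/-- `u ↦ ∇u♭`. -/
def flatGrad : expDomain T V W hW →ₗ[ℝ] L2Vec U :=
  (gradOp T U).toFun ∘ₗ
    ((mulExp (-W) hW.neg).domRestrict (expDomain T V W hW)).codRestrict (gradOp T U).domain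
      (fun u => u.2.1)

/-- `E_{W,Z}(u, v) = ∫_U e^{2W} ∇u♭ · ∇v♭ + Z(u♭, v♭)` with `u♭ = e^{-W} u`. -/
def expBilin {V : Submodule ℝ (L2 U)} (Z : V →ₗ[ℝ] V →ₗ[ℝ] ℝ) :
    expDomain T V W hW →ₗ[ℝ] expDomain T V W hW →ₗ[ℝ] ℝ :=
  (energy W hW).compl₁₂ (flatGrad T V W hW) (flatGrad T V W hW) +
    Z.compl₁₂ (flat T V W hW) (flat T V W hW)

lemma expBilin_apply {V : Submodule ℝ (L2 U)} (Z : V →ₗ[ℝ] V →ₗ[ℝ] ℝ)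
    (u v : expDomain T V W hW) :
    expBilin T W hW Z u v = energy W hW (flatGrad T V W hW u) (flatGrad T V W hW v) +
      Z (flat T V W hW u) (flat T V W hW v) := rfl

/-- The symmetric form `E_{W,Z}` on the set of all `u` such that `u♭ = e^{-W} u` lies in the
domain of the gradient and in the space `V` on which `Z` is defined. -/
def expForm {V : Submodule ℝ (L2 U)} {N : L2 U → ℝ≥0∞} (Z : BoundedSymmForm V N) :
    SymmForm (L2 U) where
  domain := expDomain T V W hW
  bilin := expBilin T W hW Z.bilin
  symm u v := by
    rw [expBilin_apply, expBilin_apply, energy_symm, Z.symm]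

end ExpForm

/-- `E^D_{W,Z}`, for a bounded symmetric form `Z` on `H^s₀(U)`. Its domain is
`e^W (H¹₀(U) ∩ H^s₀(U))`, which is `e^W H¹₀(U)` because `H¹₀(U) ⊆ H^s₀(U)`. -/
def dirichletForm {U : Opens (E d)} {s : ℝ} (W : E d → ℝ)
    (hW : MemLp W ∞ (volume.restrict (U : Set (E d))))
    (Z : BoundedSymmForm (Hs0 s U) (Hs0Norm s U)) : SymmForm (L2 U) :=
  expForm (testFns U) W hW Z

/-- `E^N_{W,Z}`, for a bounded symmetric form `Z` on `H^s(U)`. Its domain is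
`e^W (H¹(U) ∩ H^s(U))`, which is `e^W H¹(U)` as soon as `H¹(U) ⊆ H^s(U)`, in particular for
bounded Lipschitz domains. -/
def neumannForm {U : Opens (E d)} {s : ℝ} (W : E d → ℝ)
    (hW : MemLp W ∞ (volume.restrict (U : Set (E d))))
    (Z : BoundedSymmForm (Hs s U) (HsNorm s U)) : SymmForm (L2 U) :=
  expForm (smoothFns d) W hW Z

/-- A continuous function on the closure of a bounded open set is bounded on that set. -/
lemma memLp_top_of_continuousOn {U : Opens (E d)} (hU : Bornology.IsBounded (U : Set (E d)))
    {W : E d → ℝ} (hW : ContinuousOn W (closure (U : Set (E d)))) :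
    MemLp W ∞ (volume.restrict (U : Set (E d))) := by
  have hc : IsCompact (closure (U : Set (E d))) := hU.isCompact_closure
  obtain ⟨C, hC⟩ := hc.exists_bound_of_continuousOn hW
  refine memLp_top_of_bound
    ((hW.mono subset_closure).aestronglyMeasurable U.isOpen.measurableSet) C ?_
  filter_upwards [ae_restrict_mem U.isOpen.measurableSet] with x hx
  exact hC x (subset_closure hx)

end SymFormConv

end

/-!
All the forms `E_{W,Z}` are carried to the one Hilbert space `K = H¹(U)` (or `H¹₀(U)`) by
`T_W = e^W ι`, where `ι : K → L²(U)` is the inclusion: `E_{W,Z}` becomes the form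
`b(u, v) = ∫ e^{2W} ∇u · ∇v + Z(u, v)` on `K`. Since `‖u‖_{H^s}² ≤ ε ‖∇u‖² + C_ε ‖u‖²`, a bounded
form `Z` on `H^s` is an infinitesimal perturbation of the Dirichlet integral, so the forms on `K`
are coercive modulo `‖T_W u‖²`, with constants uniform along the sequence. Uniform convergence of
`W_n` and `Z_n → Z` say that `T_{W_n} → T_W` and `b_n → b` in norm. Boundedness in energy gives
weak limits in `K`, which compactness of `ι` turns into strong limits in `L²(U)`; weak lower
semicontinuity of the limit form is the liminf inequality, and `u_n = T_{W_n} u` are recovery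
sequences.

The bound for `‖u‖_{H^s}` and the compactness of `ι` both come from a translation estimate,
`∫ |φ(x + h) - φ(x)|² ≤ C |h|² ∫_U |∇φ|²` over the `x` with `x, x + h ∈ A`. For `H¹₀(U)` it is
integration along segments in `A = ℝ^d`. For a Lipschitz domain `A = U` the cone condition supplies
a detour `x → x + a → x + a + h → x + h` inside `U` with `|a| ≤ C |h|`, so no extension operator is
needed. Integrating against `|h|^{-d-2s}` controls the Slobodeckij seminorm; averaging over small
balls shows that finitely many linear functionals control `‖u‖` up to `ε ‖∇u‖`.
-/

noncomputable section

namespace SymFormConv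

/-! ### Compact convergence of forms that come from one Hilbert space -/

section Weak

variable {ι K : Type*} [NormedAddCommGroup K]

lemma exists_tendsto_dual_of_norm_le [InnerProductSpace ℝ K] [CompleteSpace K]
    (F : Ultrafilter ι) {g : ι → K} {R : ℝ} (hg : ∀ᶠ i in F, ‖g i‖ ≤ R) :
    ∃ g₀ : K, ∀ ℓ : StrongDual ℝ K, Tendsto (fun i => ℓ (g i)) F (𝓝 (ℓ g₀)) := by
  let G : ι → WeakDual ℝ K := fun i => StrongDual.toWeakDual (InnerProductSpace.toDual ℝ K (g i))
  have hmem : ∀ᶠ i in F, G i ∈ (WeakDual.toStrongDual ⁻¹'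
      Metric.closedBall (0 : StrongDual ℝ K) R : Set (WeakDual ℝ K)) := by
    filter_upwards [hg] with i hi
    rw [Set.mem_preimage, mem_closedBall_zero_iff]
    exact ((InnerProductSpace.toDual ℝ K).norm_map (g i)).trans_le hi
  obtain ⟨y, -, hy⟩ := (WeakDual.isCompact_closedBall (𝕜 := ℝ) (E := K) 0 R).ultrafilter_le_nhds'
    (F.map G) hmem
  refine ⟨(InnerProductSpace.toDual ℝ K).symm (WeakDual.toStrongDual y), fun ℓ => ?_⟩
  have hinner (x : K) : ℓ x = inner ℝ x ((InnerProductSpace.toDual ℝ K).symm ℓ) := by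
    rw [real_inner_comm, InnerProductSpace.toDual_symm_apply]
  simp only [hinner, InnerProductSpace.toDual_symm_apply]
  exact ((WeakDual.eval_continuous _).tendsto y).comp hy

variable [NormedSpace ℝ K] {q : LinearMap.BilinForm ℝ K} {C : ℝ}

lemma abs_bilin_le (hsymm : ∀ x y, q x y = q y x) (hnonneg : ∀ x, 0 ≤ q x x)
    (hbound : ∀ x, q x x ≤ C * ‖x‖ ^ 2) (x y : K) : |q x y| ≤ C * ‖x‖ * ‖y‖ := by
  by_cases hxy : ‖x‖ * ‖y‖ = 0
  · have hq : q x y = 0 := by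
      rcases mul_eq_zero.1 hxy with h | h <;> simp [norm_eq_zero.1 h]
    rw [hq, abs_zero, mul_assoc, hxy, mul_zero]
  have hC : 0 ≤ C := nonneg_of_mul_nonneg_left ((hnonneg x).trans (hbound x))
    (by have := left_ne_zero_of_mul hxy; positivity)
  refine abs_le_of_sq_le_sq ?_ (by positivity)
  calc q x y ^ 2 ≤ q x x * q y y :=
        LinearMap.BilinForm.apply_sq_le_of_symm q hnonneg ⟨hsymm⟩ x y
    _ ≤ C * ‖x‖ ^ 2 * (C * ‖y‖ ^ 2) :=
        mul_le_mul (hbound x) (hbound y) (hnonneg y) (by positivity)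
    _ = (C * ‖x‖ * ‖y‖) ^ 2 := by ring

/-- Nonnegativity of `q (g i - g₀) (g i - g₀)` bounds `q (g i) (g i)` from below by a function
that is affine in `g i`, hence weakly continuous. -/
lemma apply_self_le_of_tendsto_dual (hsymm : ∀ x y, q x y = q y x) (hnonneg : ∀ x, 0 ≤ q x x)
    (hbound : ∀ x, q x x ≤ C * ‖x‖ ^ 2) {l : Filter ι} [l.NeBot] {g : ι → K} {g₀ : K}
    (hg : ∀ ℓ : StrongDual ℝ K, Tendsto (fun i => ℓ (g i)) l (𝓝 (ℓ g₀)))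
    {a : ι → ℝ} {α : ℝ} (ha : Tendsto a l (𝓝 α)) (hle : ∀ᶠ i in l, q (g i) (g i) ≤ a i) :
    q g₀ g₀ ≤ α := by
  let ℓ : StrongDual ℝ K :=
    (q g₀).mkContinuous (C * ‖g₀‖) fun x => abs_bilin_le hsymm hnonneg hbound g₀ x
  have hlim : Tendsto (fun i => 2 * ℓ (g i) - q g₀ g₀) l (𝓝 (2 * ℓ g₀ - q g₀ g₀)) :=
    ((hg ℓ).const_mul 2).sub_const _
  have hlower : 2 * ℓ g₀ - q g₀ g₀ ≤ α := by
    refine le_of_tendsto_of_tendsto hlim ha ?_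
    filter_upwards [hle] with i hi
    have h := hnonneg (g i - g₀)
    simp only [map_sub, LinearMap.sub_apply, hsymm (g i) g₀] at h
    change 2 * q g₀ (g i) - q g₀ g₀ ≤ a i
    linarith
  change 2 * q g₀ g₀ - q g₀ g₀ ≤ α at hlower
  linarith

end Weak

section Pushforward

variable {H K : Type*} [NormedAddCommGroup H] [InnerProductSpace ℝ H]
  [NormedAddCommGroup K] [InnerProductSpace ℝ K]

/-- `Q` is the push-forward of the form `b` on `K` along `T : K → H`: its domain is the range of
`T`, and `Q(T p, T q) = b(p, q)`. Forms with varying domains in `H` become forms on the fixed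
space `K`. -/
structure SymmForm.IsPushforward (Q : SymmForm H) (T : K →L[ℝ] H) (b : LinearMap.BilinForm ℝ K) :
    Prop where
  mem_domain_iff (u : H) : u ∈ Q.domain ↔ ∃ p, T p = u
  bilin_apply {p q : K} (hp : T p ∈ Q.domain) (hq : T q ∈ Q.domain) :
    Q.bilin ⟨T p, hp⟩ ⟨T q, hq⟩ = b p q

namespace SymmForm.IsPushforward

variable {Q : SymmForm H} {T : K →L[ℝ] H} {b : LinearMap.BilinForm ℝ K} {c C M : ℝ}

lemma map_mem_domain (hQ : Q.IsPushforward T b) (p : K) : T p ∈ Q.domain :=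
  (hQ.mem_domain_iff _).2 ⟨p, rfl⟩

lemma comm (hQ : Q.IsPushforward T b) (p q : K) : b p q = b q p := by
  rw [← hQ.bilin_apply (hQ.map_mem_domain p) (hQ.map_mem_domain q), Q.symm,
    hQ.bilin_apply]

lemma val_map (hQ : Q.IsPushforward T b) (p : K) : Q.val (T p) = (b p p : ℝ) := by
  rw [SymmForm.val, dif_pos (hQ.map_mem_domain p), hQ.bilin_apply]

lemma exists_of_val_lt_top (hQ : Q.IsPushforward T b) {u : H} (hu : Q.val u < ⊤) :
    ∃ p, T p = u := by
  by_contra hne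
  rw [SymmForm.val, dif_neg (mt (hQ.mem_domain_iff u).1 hne)] at hu
  exact lt_irrefl _ hu

lemma shifted_map (hQ : Q.IsPushforward T b) (p : K) (hp : T p ∈ Q.domain) :
    Q.shifted M ⟨T p, hp⟩ = b p p + M * ‖T p‖ ^ 2 := by
  rw [SymmForm.shifted, hQ.bilin_apply]

lemma boundedBelow (hQ : Q.IsPushforward T b) (hnonneg : ∀ p, 0 ≤ b p p + M * ‖T p‖ ^ 2) :
    Q.BoundedBelow M := by
  rintro ⟨u, hu⟩
  obtain ⟨p, rfl⟩ := (hQ.mem_domain_iff u).1 hu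
  rw [hQ.shifted_map]
  exact hnonneg p

lemma isClosed [CompleteSpace K] (hQ : Q.IsPushforward T b) (hT : DenseRange T) (hM : 0 < M)
    (hc : 0 < c) (hlower : ∀ p, c * ‖p‖ ^ 2 ≤ b p p + M * ‖T p‖ ^ 2)
    (hupper : ∀ p, b p p + M * ‖T p‖ ^ 2 ≤ C * ‖p‖ ^ 2) : Q.IsClosed := by
  refine ⟨hT.mono ?_, M, hM, ?_, fun u hu => ?_⟩
  · rintro _ ⟨p, rfl⟩
    exact hQ.map_mem_domain p
  · rintro ⟨u, hu⟩ hne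
    obtain ⟨p, rfl⟩ := (hQ.mem_domain_iff u).1 hu
    have hp : p ≠ 0 := by rintro rfl; exact hne (Subtype.ext (map_zero T))
    rw [hQ.shifted_map]
    exact (by positivity : 0 < c * ‖p‖ ^ 2).trans_le (hlower p)
  · choose p hp using fun n => (hQ.mem_domain_iff (u n)).1 (u n).2
    have hshift (n : ℕ) (p' : K) (hp' : T p' ∈ Q.domain) :
        Q.shifted M (u n - ⟨T p', hp'⟩) =
          b (p n - p') (p n - p') + M * ‖T (p n - p')‖ ^ 2 := by
      have hsub : u n - ⟨T p', hp'⟩ = ⟨T (p n - p'), hQ.map_mem_domain _⟩ :=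
        Subtype.ext (by simp [hp])
      rw [hsub, hQ.shifted_map]
    have hcauchy : CauchySeq p := by
      refine Metric.cauchySeq_iff.2 fun ε hε => ?_
      obtain ⟨N, hN⟩ := hu (c * ε ^ 2) (by positivity)
      refine ⟨N, fun m hm n hn => ?_⟩
      have hmn := hN m hm n hn
      rw [show u n = ⟨T (p n), hQ.map_mem_domain _⟩ from Subtype.ext (hp n).symm, hshift] at hmn
      rw [dist_eq_norm]
      exact lt_of_pow_lt_pow_left₀ 2 hε.le
        (lt_of_mul_lt_mul_left ((hlower _).trans_lt hmn) hc.le)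
    obtain ⟨p₀, hp₀⟩ := cauchySeq_tendsto_of_complete hcauchy
    refine ⟨⟨T p₀, hQ.map_mem_domain p₀⟩, ?_⟩
    simp only [hshift]
    have hlim : Tendsto (fun n => C * ‖p n - p₀‖ ^ 2) atTop (𝓝 0) := by
      simpa using ((tendsto_iff_norm_sub_tendsto_zero.1 hp₀).pow 2).const_mul C
    refine squeeze_zero (fun n => ?_) (fun n => hupper _) hlim
    exact (by positivity : 0 ≤ c * ‖p n - p₀‖ ^ 2).trans (hlower _)

end SymmForm.IsPushforward

variable {Qn : ℕ → SymmForm H} {Q : SymmForm H} {Tn : ℕ → K →L[ℝ] H} {T : K →L[ℝ] H}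
  {bn : ℕ → LinearMap.BilinForm ℝ K} {b : LinearMap.BilinForm ℝ K} {η : ℕ → ℝ} {c C M : ℝ}

lemma tendsto_apply_self (hη : Tendsto η atTop (𝓝 0))
    (hbn : ∀ n p, |bn n p p - b p p| ≤ η n * ‖p‖ ^ 2) (p : K) :
    Tendsto (fun n => bn n p p) atTop (𝓝 (b p p)) := by
  refine tendsto_iff_norm_sub_tendsto_zero.2 (squeeze_zero (fun _ => norm_nonneg _)
    (fun n => hbn n p) ?_)
  simpa using hη.mul_const (‖p‖ ^ 2)

lemma tendsto_sub_apply_of_norm_le {ι : Type*} {l : Filter ι} {Tn : ι → K →L[ℝ] H}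
    (hTn : Tendsto Tn l (𝓝 T)) {p : ι → K} {R : ℝ} (hp : ∀ᶠ i in l, ‖p i‖ ≤ R) :
    Tendsto (fun i => Tn i (p i) - T (p i)) l (𝓝 0) := by
  have hlim : Tendsto (fun i => ‖Tn i - T‖ * R) l (𝓝 0) := by
    simpa using (tendsto_iff_norm_sub_tendsto_zero.1 hTn).mul_const R
  refine squeeze_zero_norm' ?_ hlim
  filter_upwards [hp] with i hi
  exact ((Tn i - T).le_opNorm (p i)).trans (mul_le_mul_of_nonneg_left hi (norm_nonneg _))

lemma norm_le_of_mul_sq_le {K : Type*} [NormedAddCommGroup K] (hc : 0 < c) {p : K} {B : ℝ}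
    (h : c * ‖p‖ ^ 2 ≤ B) :
    ‖p‖ ≤ Real.sqrt (B / c) :=
  Real.le_sqrt_of_sq_le ((le_div_iff₀' hc).2 h)

lemma SymmForm.IsPushforward.apply_self_le_of_tendsto [CompleteSpace K]
    (hQ : Q.IsPushforward T b) (hTn : Tendsto Tn atTop (𝓝 T)) (hη : Tendsto η atTop (𝓝 0))
    (hbn : ∀ n p, |bn n p p - b p p| ≤ η n * ‖p‖ ^ 2)
    (hnonneg : ∀ p, 0 ≤ b p p + M * ‖T p‖ ^ 2)
    (hupper : ∀ p, b p p + M * ‖T p‖ ^ 2 ≤ C * ‖p‖ ^ 2)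
    {F : Ultrafilter ℕ} (hF : (F : Filter ℕ) ≤ atTop) {p : ℕ → K} {R : ℝ}
    (hp : ∀ᶠ n in F, ‖p n‖ ≤ R) {v : H} (hv : Tendsto (fun n => Tn n (p n)) F (𝓝 v)) {a : ℝ}
    (ha : ∀ᶠ n in F, bn n (p n) (p n) ≤ a) : Q.val v ≤ a := by
  obtain ⟨p₀, hweak⟩ := exists_tendsto_dual_of_norm_le F hp
  have hTp : Tendsto (fun n => T (p n)) F (𝓝 v) := by
    simpa using hv.sub (tendsto_sub_apply_of_norm_le (hTn.mono_left hF) hp)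
  obtain rfl : T p₀ = v := ext_inner_left ℝ fun h => tendsto_nhds_unique
    (hweak (innerSL ℝ h ∘L T)) (tendsto_const_nhds.inner hTp)
  have hlim : Tendsto (fun n => a + |η n| * R ^ 2 + M * ‖T (p n)‖ ^ 2) F
      (𝓝 (a + M * ‖T p₀‖ ^ 2)) := by
    simpa using (((hη.mono_left hF).abs.mul_const (R ^ 2)).const_add a).add
      ((hTp.norm.pow 2).const_mul M)
  have hle := apply_self_le_of_tendsto_dual
    (q := b + M • (innerₗ H).compl₁₂ (T : K →ₗ[ℝ] H) (T : K →ₗ[ℝ] H)) (C := C)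
    (fun x y => by simp [hQ.comm x y, real_inner_comm]) (fun x => by simpa using hnonneg x)
    (fun x => by simpa using hupper x) hweak hlim ?_
  · rw [hQ.val_map, EReal.coe_le_coe_iff]
    simpa using hle
  · filter_upwards [hp, ha] with n hpn han
    have hpn' : |η n| * ‖p n‖ ^ 2 ≤ |η n| * R ^ 2 := by gcongr
    have hη' : η n * ‖p n‖ ^ 2 ≤ |η n| * ‖p n‖ ^ 2 := by gcongr; exact le_abs_self _
    have hclose := (abs_le.1 (hbn n (p n))).1
    simp only [LinearMap.add_apply, LinearMap.smul_apply, LinearMap.compl₁₂_apply,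
      ContinuousLinearMap.coe_coe, innerₗ_apply_apply, real_inner_self_eq_norm_sq, smul_eq_mul]
    linarith

lemma val_le_liminf_of_isPushforward [CompleteSpace K]
    (hQn : ∀ n, (Qn n).IsPushforward (Tn n) (bn n)) (hQ : Q.IsPushforward T b)
    (hTn : Tendsto Tn atTop (𝓝 T)) (hη : Tendsto η atTop (𝓝 0))
    (hbn : ∀ n p, |bn n p p - b p p| ≤ η n * ‖p‖ ^ 2) (hM : 0 < M) (hc : 0 < c)
    (hcoer : ∀ n p, c * ‖p‖ ^ 2 ≤ bn n p p + M * ‖Tn n p‖ ^ 2)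
    (hnonneg : ∀ p, 0 ≤ b p p + M * ‖T p‖ ^ 2)
    (hupper : ∀ p, b p p + M * ‖T p‖ ^ 2 ≤ C * ‖p‖ ^ 2)
    {u : ℕ → H} {v : H} (hu : Tendsto u atTop (𝓝 v)) :
    Q.val v ≤ liminf (fun n => (Qn n).val (u n)) atTop := by
  by_contra! hlt
  obtain ⟨a, hliminf, hav⟩ := EReal.lt_iff_exists_real_btwn.1 hlt
  have hfreq : ∃ᶠ n in atTop, (Qn n).val (u n) < a :=
    frequently_lt_of_liminf_lt (by isBoundedDefault) hliminf
  have := frequently_iff_neBot.1 hfreq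
  obtain ⟨F, hF⟩ := Ultrafilter.exists_le (atTop ⊓ 𝓟 {n | (Qn n).val (u n) < a})
  obtain ⟨hFtop, hFa⟩ := le_inf_iff.1 hF
  replace hFa : ∀ᶠ n in F, (Qn n).val (u n) < a := le_principal_iff.1 hFa
  have hchoice (n : ℕ) : ∃ p, (Qn n).val (u n) < a → Tn n p = u n := by
    by_cases h : (Qn n).val (u n) < a
    · obtain ⟨p, hp⟩ := (hQn n).exists_of_val_lt_top (h.trans (EReal.coe_lt_top a))
      exact ⟨p, fun _ => hp⟩
    · exact ⟨0, fun h' => absurd h' h⟩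
  choose p hp using hchoice
  have hTp : ∀ᶠ n in F, u n = Tn n (p n) := hFa.mono fun n hn => (hp n hn).symm
  have hb : ∀ᶠ n in F, bn n (p n) (p n) ≤ a := by
    filter_upwards [hFa, hTp] with n hn hTn
    rw [hTn, (hQn n).val_map] at hn
    exact_mod_cast hn.le
  have huF : Tendsto u F (𝓝 v) := hu.mono_left hFtop
  have hbdd : ∀ᶠ n in F, ‖p n‖ ≤ Real.sqrt ((a + M * (‖v‖ + 1) ^ 2) / c) := by
    filter_upwards [hTp, hb, huF.norm.eventually (gt_mem_nhds (lt_add_one ‖v‖))] with n hTn hbn hun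
    refine norm_le_of_mul_sq_le hc ((hcoer n (p n)).trans ?_)
    rw [← hTn]
    gcongr
  exact hav.not_ge (hQ.apply_self_le_of_tendsto hTn hη hbn hnonneg hupper hFtop hbdd
    (huF.congr' hTp) hb)

lemma compactSequence_of_isPushforward (hQn : ∀ n, (Qn n).IsPushforward (Tn n) (bn n))
    (hTn : Tendsto Tn atTop (𝓝 T)) (hT : IsCompactOperator T) (hc : 0 < c)
    (hcoer : ∀ n p, c * ‖p‖ ^ 2 ≤ bn n p p + M * ‖Tn n p‖ ^ 2) : CompactSequence M Qn := by
  intro u hu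
  obtain ⟨B, hB, -⟩ := EReal.lt_iff_exists_real_btwn.1 hu
  have hle (n : ℕ) : (Qn n).val (u n) + (((M + 1) * ‖u n‖ ^ 2 : ℝ) : EReal) ≤ B :=
    (le_iSup _ n).trans hB.le
  have hrange (n : ℕ) : ∃ p, Tn n p = u n := by
    refine (hQn n).exists_of_val_lt_top (lt_top_iff_ne_top.2 fun htop => ?_)
    have h := hle n
    rw [htop, EReal.top_add_coe, top_le_iff] at h
    exact EReal.coe_ne_top B h
  choose p hp using hrange
  have hbdd (n : ℕ) : ‖p n‖ ≤ Real.sqrt (B / c) := by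
    refine norm_le_of_mul_sq_le hc ((hcoer n (p n)).trans ?_)
    have h := hle n
    rw [← hp n, (hQn n).val_map] at h
    have h' : bn n (p n) (p n) + (M + 1) * ‖Tn n (p n)‖ ^ 2 ≤ B := by exact_mod_cast h
    linarith [sq_nonneg ‖Tn n (p n)‖]
  have hdiff :=
    (tendsto_sub_apply_of_norm_le hTn (Eventually.of_forall hbdd)).isCompact_insert_range
  have himage := hT.isCompact_closure_image_closedBall (Real.sqrt (B / c))
  refine (himage.add hdiff).closure_of_subset ?_
  rintro _ ⟨n, rfl⟩
  exact ⟨T (p n), subset_closure ⟨p n, mem_closedBall_zero_iff.2 (hbdd n), rfl⟩,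
    Tn n (p n) - T (p n), Set.mem_insert_of_mem _ ⟨n, rfl⟩, by simp [hp]⟩

theorem convergesCompactly_of_isPushforward [CompleteSpace K]
    (hQn : ∀ n, (Qn n).IsPushforward (Tn n) (bn n)) (hQ : Q.IsPushforward T b)
    (hdense_n : ∀ n, DenseRange (Tn n)) (hdense : DenseRange T)
    (hTn : Tendsto Tn atTop (𝓝 T)) (hT : IsCompactOperator T) (hη : Tendsto η atTop (𝓝 0))
    (hbn : ∀ n p, |bn n p p - b p p| ≤ η n * ‖p‖ ^ 2) (hb : ∀ p, b p p ≤ C * ‖p‖ ^ 2)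
    (hM : 0 < M) (hc : 0 < c) (hcoer : ∀ n p, c * ‖p‖ ^ 2 ≤ bn n p p + M * ‖Tn n p‖ ^ 2) :
    ConvergesCompactly Qn Q := by
  have hTp (p : K) : Tendsto (fun n => Tn n p) atTop (𝓝 (T p)) :=
    ((ContinuousLinearMap.apply ℝ H p).continuous.tendsto T).comp hTn
  have hcoer' (p : K) : c * ‖p‖ ^ 2 ≤ b p p + M * ‖T p‖ ^ 2 :=
    ge_of_tendsto' ((tendsto_apply_self hη hbn p).add (((hTp p).norm.pow 2).const_mul M))
      fun n => hcoer n p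
  have hupper {b' : LinearMap.BilinForm ℝ K} {C' : ℝ} (hb' : ∀ p, b' p p ≤ C' * ‖p‖ ^ 2)
      (T' : K →L[ℝ] H) (p : K) :
      b' p p + M * ‖T' p‖ ^ 2 ≤ (C' + M * ‖T'‖ ^ 2) * ‖p‖ ^ 2 := by
    calc b' p p + M * ‖T' p‖ ^ 2 ≤ C' * ‖p‖ ^ 2 + M * (‖T'‖ * ‖p‖) ^ 2 := by
          gcongr
          exacts [hb' p, T'.le_opNorm p]
      _ = _ := by ring
  have hbn_le (n : ℕ) (p : K) : bn n p p ≤ (C + η n) * ‖p‖ ^ 2 := by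
    linarith [(abs_le.1 (hbn n p)).2, hb p]
  have hnonneg {t : ℝ} (p : K) (h : c * ‖p‖ ^ 2 ≤ t) : 0 ≤ t :=
    (by positivity : 0 ≤ c * ‖p‖ ^ 2).trans h
  refine ⟨M, hM, fun n => ⟨(hQn n).isClosed (hdense_n n) hM hc (hcoer n) (hupper (hbn_le n) _),
    (hQn n).boundedBelow fun p => hnonneg p (hcoer n p)⟩,
    hQ.isClosed hdense hM hc hcoer' (hupper hb T),
    hQ.boundedBelow fun p => hnonneg p (hcoer' p), ⟨fun u v huv => ?_, fun v hv => ?_⟩,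
    compactSequence_of_isPushforward hQn hTn hT hc hcoer⟩
  · exact val_le_liminf_of_isPushforward hQn hQ hTn hη hbn hM hc hcoer
      (fun p => hnonneg p (hcoer' p)) (hupper hb T) huv
  · obtain ⟨p, rfl⟩ := (hQ.mem_domain_iff v).1 hv
    refine ⟨fun n => Tn n p, hTp p, ?_⟩
    simp only [(hQn _).val_map, hQ.val_map]
    exact (continuous_coe_real_ereal.tendsto _).comp (tendsto_apply_self hη hbn p)

end Pushforward

section CompactOperator

variable {K H : Type*} [NormedAddCommGroup K] [NormedSpace ℝ K] [NormedAddCommGroup H]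
  [NormedSpace ℝ H]

lemma isCompactOperator_of_norm_sq_le [CompleteSpace H] {T : K →L[ℝ] H}
    (hT : ∀ ε : ℝ, 0 < ε → ∃ (ι : Type) (_ : Fintype ι) (f : ι → StrongDual ℝ K),
      ∀ p, ‖T p‖ ^ 2 ≤ ε * ‖p‖ ^ 2 + ∑ i, f i p ^ 2) :
    IsCompactOperator T := by
  suffices h : TotallyBounded (T '' Metric.closedBall 0 1) from
    (isCompactOperator_iff_isCompact_closure_image_closedBall T.toLinearMap one_pos).2
      (h.closure.isCompact_of_isClosed isClosed_closure)
  refine Metric.totallyBounded_iff.2 fun ε hε => ?_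
  obtain ⟨ι, _, f, hf⟩ := hT (ε ^ 2 / 8) (by positivity)
  let L : K →L[ℝ] EuclideanSpace ℝ ι :=
    (EuclideanSpace.equiv ι ℝ).symm.toContinuousLinearMap ∘L ContinuousLinearMap.pi f
  have hL (p : K) : ‖L p‖ ^ 2 = ∑ i, f i p ^ 2 := EuclideanSpace.real_norm_sq_eq _
  have hbounded : TotallyBounded (L '' Metric.closedBall 0 1) :=
    (L.lipschitz.isBounded_image Metric.isBounded_closedBall).isCompact_closure.totallyBounded
      |>.subset subset_closure
  obtain ⟨t, ht, htfin, hcover⟩ := Set.exists_subset_image_finite_and.1 <|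
    Metric.finite_approx_of_totallyBounded hbounded (ε / 2) (by positivity)
  refine ⟨T '' t, htfin.image T, ?_⟩
  rintro _ ⟨p, hp, rfl⟩
  obtain ⟨_, ⟨q, hq, rfl⟩, hpq⟩ := Set.mem_iUnion₂.1 (hcover ⟨p, hp, rfl⟩)
  refine Set.mem_biUnion ⟨q, hq, rfl⟩ (mem_ball_iff_norm.2 ?_)
  rw [mem_ball_iff_norm, ← map_sub] at hpq
  have hdist : ‖p - q‖ ≤ 2 := (norm_sub_le p q).trans <|
    (add_le_add (mem_closedBall_zero_iff.1 hp) (mem_closedBall_zero_iff.1 (ht hq))).trans_eq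
      one_add_one_eq_two
  refine lt_of_pow_lt_pow_left₀ 2 hε.le ?_
  change ‖T p - T q‖ ^ 2 < ε ^ 2
  rw [← map_sub]
  calc ‖T (p - q)‖ ^ 2 ≤ ε ^ 2 / 8 * ‖p - q‖ ^ 2 + ‖L (p - q)‖ ^ 2 := (hf _).trans_eq (by rw [hL])
    _ < ε ^ 2 / 8 * 2 ^ 2 + (ε / 2) ^ 2 := add_lt_add_of_le_of_lt (by gcongr) (by gcongr)
    _ ≤ ε ^ 2 := by linarith [sq_nonneg ε]

end CompactOperator

/-! ### The forms `E_{W,Z}` for a space between `H¹` and `L²` -/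

section ExpForms

variable {d : ℕ} {U : Opens (E d)}

section MulExp

variable {W W' : E d → ℝ} (hW : MemLp W ∞ (volume.restrict (U : Set (E d))))
  (hW' : MemLp W' ∞ (volume.restrict (U : Set (E d)))) {R η : ℝ}

lemma coeFn_mulExp (u : L2 U) :
    mulExp W hW u =ᵐ[volume.restrict (U : Set (E d))] fun x => Real.exp (W x) * u x :=
  (memLp_exp_mul hW u).coeFn_toLp

lemma mulExp_neg_mulExp (u : L2 U) : mulExp (-W) hW.neg (mulExp W hW u) = u := by
  apply Lp.ext
  filter_upwards [coeFn_mulExp hW u, coeFn_mulExp hW.neg (mulExp W hW u)] with x h1 h2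
  rw [h2, h1, ← mul_assoc, ← Real.exp_add, Pi.neg_apply, neg_add_cancel, Real.exp_zero, one_mul]

lemma mulExp_mulExp_neg (u : L2 U) : mulExp W hW (mulExp (-W) hW.neg u) = u := by
  apply Lp.ext
  filter_upwards [coeFn_mulExp hW.neg u, coeFn_mulExp hW (mulExp (-W) hW.neg u)] with x h1 h2
  rw [h2, h1, ← mul_assoc, ← Real.exp_add, Pi.neg_apply, add_neg_cancel, Real.exp_zero, one_mul]

lemma norm_mulExp_le (hR : ∀ x ∈ U, |W x| ≤ R) (u : L2 U) :
    ‖mulExp W hW u‖ ≤ Real.exp R * ‖u‖ := by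
  apply Lp.norm_le_mul_norm_of_ae_le_mul
  filter_upwards [coeFn_mulExp hW u, ae_restrict_mem U.isOpen.measurableSet] with x h1 h2
  rw [h1, norm_mul, Real.norm_eq_abs (Real.exp _), Real.abs_exp]
  gcongr
  exact (le_abs_self _).trans (hR x h2)

lemma norm_le_norm_mulExp (hR : ∀ x ∈ U, |W x| ≤ R) (u : L2 U) :
    ‖u‖ ≤ Real.exp R * ‖mulExp W hW u‖ := by
  conv_lhs => rw [← mulExp_neg_mulExp hW u]
  exact norm_mulExp_le _ (by simpa using hR) _

lemma norm_mulExp_sub_le (hη : ∀ x ∈ U, |Real.exp (W x) - Real.exp (W' x)| ≤ η) (u : L2 U) :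
    ‖mulExp W hW u - mulExp W' hW' u‖ ≤ η * ‖u‖ := by
  apply Lp.norm_le_mul_norm_of_ae_le_mul
  filter_upwards [coeFn_mulExp hW u, coeFn_mulExp hW' u, Lp.coeFn_sub (mulExp W hW u)
    (mulExp W' hW' u), ae_restrict_mem U.isOpen.measurableSet] with x h1 h2 h3 h4
  rw [h3, Pi.sub_apply, h1, h2, ← sub_mul, norm_mul, Real.norm_eq_abs]
  gcongr
  exact hη x h4

/-- `mulExp W hW` as a bounded operator. -/
def mulExpL (W : E d → ℝ) (hW : MemLp W ∞ (volume.restrict (U : Set (E d)))) : L2 U →L[ℝ] L2 U :=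
  (mulExp W hW).mkContinuousOfExistsBound <| by
    obtain ⟨-, C, hC⟩ := exp_bound hW
    refine ⟨C, fun u => Lp.norm_le_mul_norm_of_ae_le_mul ?_⟩
    filter_upwards [coeFn_mulExp hW u, hC] with x h1 h2
    rw [h1, norm_mul]
    gcongr

lemma surjective_mulExpL : Function.Surjective (mulExpL W hW) := fun v =>
  ⟨mulExp (-W) hW.neg v, mulExp_mulExp_neg hW v⟩

lemma norm_mulExpL_sub_le (hη₀ : 0 ≤ η)
    (hη : ∀ x ∈ U, |Real.exp (W x) - Real.exp (W' x)| ≤ η) :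
    ‖mulExpL W hW - mulExpL W' hW'‖ ≤ η :=
  ContinuousLinearMap.opNorm_le_bound _ hη₀ (norm_mulExp_sub_le hW hW' hη)

lemma energy_apply (g h : L2Vec U) : energy W hW g h =
    ∫ x in (U : Set (E d)), Real.exp (2 * W x) * inner ℝ (g x) (h x) := rfl

lemma integrable_norm_sq (g : L2Vec U) :
    Integrable (fun x => ‖g x‖ ^ 2) (volume.restrict (U : Set (E d))) :=
  (Lp.memLp g).integrable_norm_pow two_ne_zero

lemma norm_sq_eq_integral (g : L2Vec U) : ‖g‖ ^ 2 = ∫ x in (U : Set (E d)), ‖g x‖ ^ 2 := by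
  simp only [← real_inner_self_eq_norm_sq, L2.inner_def]

lemma energy_self_le (hR : ∀ x ∈ U, |W x| ≤ R) (g : L2Vec U) :
    energy W hW g g ≤ Real.exp (2 * R) * ‖g‖ ^ 2 := by
  rw [energy_apply, norm_sq_eq_integral, ← integral_const_mul]
  refine integral_mono_ae (integrable_energy hW g g) ((integrable_norm_sq g).const_mul _) ?_
  filter_upwards [ae_restrict_mem U.isOpen.measurableSet] with x hx
  simp only [real_inner_self_eq_norm_sq]
  gcongr
  exact (le_abs_self _).trans (hR x hx)

lemma le_energy_self (hR : ∀ x ∈ U, |W x| ≤ R) (g : L2Vec U) :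
    Real.exp (-(2 * R)) * ‖g‖ ^ 2 ≤ energy W hW g g := by
  rw [energy_apply, norm_sq_eq_integral, ← integral_const_mul]
  refine integral_mono_ae ((integrable_norm_sq g).const_mul _) (integrable_energy hW g g) ?_
  filter_upwards [ae_restrict_mem U.isOpen.measurableSet] with x hx
  simp only [real_inner_self_eq_norm_sq]
  gcongr
  linarith [(abs_le.1 (hR x hx)).1]

lemma abs_energy_sub_le (hη : ∀ x ∈ U, |Real.exp (2 * W x) - Real.exp (2 * W' x)| ≤ η)
    (g : L2Vec U) : |energy W hW g g - energy W' hW' g g| ≤ η * ‖g‖ ^ 2 := by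
  rw [energy_apply, energy_apply, norm_sq_eq_integral, ← integral_const_mul,
    ← integral_sub (integrable_energy hW g g) (integrable_energy hW' g g), ← Real.norm_eq_abs]
  refine norm_integral_le_of_norm_le ((integrable_norm_sq g).const_mul _) ?_
  filter_upwards [ae_restrict_mem U.isOpen.measurableSet] with x hx
  rw [← sub_mul, norm_mul, Real.norm_eq_abs, real_inner_self_eq_norm_sq, norm_pow, norm_norm]
  gcongr
  exact hη x hx

end MulExp

lemma abs_exp_sub_exp_le {R a b : ℝ} (ha : a ≤ R) (hb : b ≤ R) :
    |Real.exp a - Real.exp b| ≤ Real.exp R * |a - b| :=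
  (convex_Iic R).norm_image_sub_le_of_norm_deriv_le (f := Real.exp)
    (fun _ _ => Real.differentiableAt_exp)
    (fun x hx => by simpa using hx) hb ha

lemma exists_bounds_of_tendstoUniformlyOn {X : Type*} [TopologicalSpace X] {A : Set X}
    (hA : IsCompact A) {Wn : ℕ → X → ℝ} {W : X → ℝ} (hWn : ∀ n, ContinuousOn (Wn n) A)
    (hW : ContinuousOn W A) (h : TendstoUniformlyOn Wn W atTop A) :
    ∃ (R : ℝ) (w : ℕ → ℝ), Tendsto w atTop (𝓝 0) ∧ (∀ n, 0 ≤ w n) ∧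
      (∀ x ∈ A, |W x| ≤ R) ∧ (∀ n, ∀ x ∈ A, |Wn n x| ≤ R) ∧ ∀ n, ∀ x ∈ A, |Wn n x - W x| ≤ w n := by
  have := isCompact_iff_compactSpace.1 hA
  let f (n : ℕ) : C(A, ℝ) := ⟨A.domRestrict (Wn n), (hWn n).domRestrict⟩
  let f₀ : C(A, ℝ) := ⟨A.domRestrict W, hW.domRestrict⟩
  have hf : Tendsto f atTop (𝓝 f₀) :=
    ContinuousMap.tendsto_iff_tendstoUniformly.2 (tendstoUniformlyOn_iff_restrict.1 h)
  obtain ⟨R, hR⟩ := hf.norm.bddAbove_range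
  have hfR (n : ℕ) : ‖f n‖ ≤ R := hR ⟨n, rfl⟩
  exact ⟨R, fun n => ‖f n - f₀‖, tendsto_iff_norm_sub_tendsto_zero.1 hf,
    fun _ => norm_nonneg _,
    fun x hx => (f₀.norm_coe_le_norm ⟨x, hx⟩).trans (le_of_tendsto' hf.norm hfR),
    fun n x hx => ((f n).norm_coe_le_norm ⟨x, hx⟩).trans (hfR n),
    fun n x hx => (f n - f₀).norm_coe_le_norm ⟨x, hx⟩⟩

section FormNorm

variable {V : Submodule ℝ (L2 U)} {N : L2 U → ℝ≥0∞}

lemma abs_apply_self_le (hsmul : ∀ (c : ℝ) u, N (c • u) = ‖c‖ₑ * N u)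
    (hzero : ∀ u, N u = 0 → u = 0) {B : V →ₗ[ℝ] V →ₗ[ℝ] ℝ} (hB : formNorm N B < ⊤)
    {u : V} (hu : N u ≠ ⊤) : |B u u| ≤ (formNorm N B).toReal * (N u).toReal ^ 2 := by
  by_cases h0 : N u = 0
  · obtain rfl : u = 0 := Subtype.ext (hzero _ h0)
    rw [map_zero, abs_zero]
    positivity
  set r := (N u).toReal with hr
  have hr_pos : 0 < r := ENNReal.toReal_pos h0 hu
  have hunit : N ((r⁻¹ • u : V) : L2 U) = 1 := by
    rw [Submodule.coe_smul, hsmul, ← ENNReal.ofReal_toReal hu, ← hr,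
      Real.enorm_of_nonneg (by positivity), ← ENNReal.ofReal_mul (by positivity),
      inv_mul_cancel₀ hr_pos.ne', ENNReal.ofReal_one]
  have hle : ‖B (r⁻¹ • u) (r⁻¹ • u)‖ₑ ≤ formNorm N B := le_iSup₂_of_le (r⁻¹ • u) hunit le_rfl
  have hle' := ENNReal.toReal_mono hB.ne hle
  rw [toReal_enorm, map_smul, map_smul, LinearMap.smul_apply, smul_eq_mul, smul_eq_mul,
    Real.norm_eq_abs, ← mul_assoc, abs_mul, abs_of_pos (by positivity : 0 < r⁻¹ * r⁻¹)] at hle'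
  calc |B u u| = r ^ 2 * (r⁻¹ * r⁻¹ * |B u u|) := by field_simp
    _ ≤ r ^ 2 * (formNorm N B).toReal := by gcongr
    _ = _ := mul_comm _ _

lemma formNorm_sub_le (B B' : V →ₗ[ℝ] V →ₗ[ℝ] ℝ) :
    formNorm N (B - B') ≤ formNorm N B + formNorm N B' := by
  refine iSup₂_le fun u hu => (enorm_sub_le (a := B u u)).trans (add_le_add ?_ ?_)
  exacts [le_iSup₂_of_le (f := fun (u : V) (_ : N u = 1) => ‖B u u‖ₑ) u hu le_rfl,
    le_iSup₂_of_le (f := fun (u : V) (_ : N u = 1) => ‖B' u u‖ₑ) u hu le_rfl]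

lemma abs_sub_apply_self_le (hsmul : ∀ (c : ℝ) u, N (c • u) = ‖c‖ₑ * N u)
    (hzero : ∀ u, N u = 0 → u = 0) (Z Z' : BoundedSymmForm V N) {u : V} (hu : N u ≠ ⊤) :
    |(Z.bilin - Z'.bilin) u u| ≤
      (formNorm N (Z.bilin - Z'.bilin)).toReal * (N u).toReal ^ 2 :=
  abs_apply_self_le hsmul hzero
    ((formNorm_sub_le _ _).trans_lt (ENNReal.add_lt_top.2 ⟨Z.bounded, Z'.bounded⟩)) hu

lemma abs_apply_self_le_add (hsmul : ∀ (c : ℝ) u, N (c • u) = ‖c‖ₑ * N u)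
    (hzero : ∀ u, N u = 0 → u = 0) (Z Z' : BoundedSymmForm V N) {u : V} (hu : N u ≠ ⊤) :
    |Z.bilin u u| ≤ ((formNorm N Z'.bilin).toReal +
      (formNorm N (Z.bilin - Z'.bilin)).toReal) * (N u).toReal ^ 2 := by
  have hdiff := abs_sub_apply_self_le hsmul hzero Z Z' hu
  rw [LinearMap.sub_apply, LinearMap.sub_apply] at hdiff
  rw [add_mul, ← add_sub_cancel (Z'.bilin u u) (Z.bilin u u)]
  exact (abs_add_le _ _).trans (add_le_add (abs_apply_self_le hsmul hzero Z'.bounded hu) hdiff)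

lemma exists_bounds_of_tendsto_formNorm (hsmul : ∀ (c : ℝ) u, N (c • u) = ‖c‖ₑ * N u)
    (hzero : ∀ u, N u = 0 → u = 0) {Zn : ℕ → BoundedSymmForm V N} {Z : BoundedSymmForm V N}
    (hZ : Tendsto (fun n => formNorm N ((Zn n).bilin - Z.bilin)) atTop (𝓝 0)) :
    ∃ (ζ : ℝ) (z : ℕ → ℝ), 0 ≤ ζ ∧ Tendsto z atTop (𝓝 0) ∧ (∀ n, 0 ≤ z n) ∧
      (∀ u : V, N u ≠ ⊤ → |Z.bilin u u| ≤ ζ * (N u).toReal ^ 2) ∧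
      (∀ n, ∀ u : V, N u ≠ ⊤ → |(Zn n).bilin u u| ≤ ζ * (N u).toReal ^ 2) ∧
      ∀ n, ∀ u : V, N u ≠ ⊤ → |((Zn n).bilin - Z.bilin) u u| ≤ z n * (N u).toReal ^ 2 := by
  obtain ⟨z, hz_def⟩ : ∃ z : ℕ → ℝ, ∀ n, z n = (formNorm N ((Zn n).bilin - Z.bilin)).toReal :=
    ⟨_, fun _ => rfl⟩
  have hz₀ (n : ℕ) : 0 ≤ z n := (hz_def n).ge.trans' ENNReal.toReal_nonneg
  have hz : Tendsto z atTop (𝓝 0) :=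
    ((ENNReal.tendsto_toReal ENNReal.zero_ne_top).comp hZ).congr fun n => (hz_def n).symm
  obtain ⟨b, hb⟩ := hz.bddAbove_range
  have hzb (n : ℕ) : z n ≤ b := hb ⟨n, rfl⟩
  have hb₀ : 0 ≤ b := (hz₀ 0).trans (hzb 0)
  refine ⟨(formNorm N Z.bilin).toReal + b, z, add_nonneg ENNReal.toReal_nonneg hb₀, hz, hz₀,
    fun u hu => (abs_apply_self_le hsmul hzero Z.bounded hu).trans ?_, fun n u hu => ?_,
    fun n u hu => ?_⟩
  · exact mul_le_mul_of_nonneg_right (le_add_of_nonneg_right hb₀) (sq_nonneg _)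
  · refine (abs_apply_self_le_add hsmul hzero (Zn n) Z hu).trans ?_
    rw [← hz_def]
    exact mul_le_mul_of_nonneg_right (add_le_add_right (hzb n) _) (sq_nonneg _)
  · rw [hz_def]
    exact abs_sub_apply_self_le hsmul hzero (Zn n) Z hu

end FormNorm

/-- The domain of the gradient `gradOp T U` with its graph norm, as a Hilbert space: the space
`H1Graph T U` with the norm `(‖u‖² + ‖∇u‖²)^(1/2)` in place of the maximum norm of the product. -/
def H1Space (T : Set (E d → ℝ)) (U : Opens (E d)) : Type :=
  (H1Graph T U).comap (WithLp.prodContinuousLinearEquiv 2 ℝ (L2 U) (L2Vec U)).toLinearMap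

namespace H1Space

variable (T : Set (E d → ℝ)) (U : Opens (E d))

instance : NormedAddCommGroup (H1Space T U) := inferInstanceAs (NormedAddCommGroup
  ((H1Graph T U).comap (WithLp.prodContinuousLinearEquiv 2 ℝ (L2 U) (L2Vec U)).toLinearMap))

instance : InnerProductSpace ℝ (H1Space T U) := inferInstanceAs (InnerProductSpace ℝ
  ((H1Graph T U).comap (WithLp.prodContinuousLinearEquiv 2 ℝ (L2 U) (L2Vec U)).toLinearMap))

instance : CompleteSpace (H1Space T U) :=
  ((Submodule.isClosed_topologicalClosure _).preimage
    (WithLp.prodContinuousLinearEquiv 2 ℝ (L2 U) (L2Vec U)).continuous).completeSpace_coe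

/-- The inclusion of the domain of the gradient in `L²(U)`. -/
def inclL : H1Space T U →L[ℝ] L2 U :=
  WithLp.fstL 2 ℝ (L2 U) (L2Vec U) ∘L Submodule.subtypeL _

/-- The gradient as a bounded operator on its domain. -/
def gradL : H1Space T U →L[ℝ] L2Vec U :=
  WithLp.sndL 2 ℝ (L2 U) (L2Vec U) ∘L Submodule.subtypeL _

variable {T U}

lemma mk_mem_H1Graph (p : H1Space T U) : (inclL T U p, gradL T U p) ∈ H1Graph T U := p.2

lemma exists_of_mem_H1Graph {p : L2 U × L2Vec U} (hp : p ∈ H1Graph T U) :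
    ∃ q : H1Space T U, inclL T U q = p.1 ∧ gradL T U q = p.2 :=
  ⟨⟨WithLp.toLp 2 p, hp⟩, rfl, rfl⟩

lemma norm_sq_eq (p : H1Space T U) : ‖p‖ ^ 2 = ‖inclL T U p‖ ^ 2 + ‖gradL T U p‖ ^ 2 :=
  WithLp.prod_norm_sq_eq_of_L2 p.1

lemma range_inclL : Set.range (inclL T U) = (gradOp T U).domain := by
  ext u
  constructor
  · rintro ⟨p, rfl⟩
    exact Submodule.mem_map.2 ⟨_, mk_mem_H1Graph p, rfl⟩
  · intro hu
    obtain ⟨p, hp, rfl⟩ := Submodule.mem_map.1 hu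
    exact ⟨⟨WithLp.toLp 2 p, hp⟩, rfl⟩

end H1Space

open H1Space

variable {T : Set (E d → ℝ)}

lemma gradOp_mem_H1Graph (hT : T ⊆ smoothFns d) (u : (gradOp T U).domain) :
    ((u : L2 U), gradOp T U u) ∈ H1Graph T U :=
  Submodule.mem_graph_toLinearPMap (fun p hp h => H1Graph_snd_eq_zero T hT U p hp h) u

lemma gradOp_apply_eq (hT : T ⊆ smoothFns d) {p : L2 U × L2Vec U} (hp : p ∈ H1Graph T U)
    (u : (gradOp T U).domain) (hu : p.1 = u) : gradOp T U u = p.2 := by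
  have h := H1Graph_snd_eq_zero T hT U (p - (u.1, gradOp T U u))
    (sub_mem hp (gradOp_mem_H1Graph hT u)) (sub_eq_zero.2 hu)
  exact (sub_eq_zero.1 h).symm

/-- The map `p ↦ e^W p` from the domain of the gradient to `L²(U)`. -/
def weightedIncl (T : Set (E d → ℝ)) (W : E d → ℝ)
    (hW : MemLp W ∞ (volume.restrict (U : Set (E d)))) : H1Space T U →L[ℝ] L2 U :=
  mulExpL W hW ∘L inclL T U

section WeightedIncl

variable {W : E d → ℝ} (hW : MemLp W ∞ (volume.restrict (U : Set (E d))))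

lemma weightedIncl_apply (p : H1Space T U) :
    weightedIncl T W hW p = mulExp W hW (inclL T U p) := rfl

lemma flatGrad_eq (hT : T ⊆ smoothFns d) {V : Submodule ℝ (L2 U)} {u : expDomain T V W hW}
    {p : H1Space T U} (hp : weightedIncl T W hW p = u) : flatGrad T V W hW u = gradL T U p := by
  apply gradOp_apply_eq hT (mk_mem_H1Graph p)
  change _ = mulExp (-W) hW.neg (u : L2 U)
  rw [← hp, weightedIncl_apply, mulExp_neg_mulExp]

lemma denseRange_weightedIncl (hdense : DenseRange (inclL T U)) :
    DenseRange (weightedIncl T W hW) :=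
  (surjective_mulExpL hW).denseRange.comp hdense (mulExpL W hW).continuous

lemma isCompactOperator_weightedIncl (hcompact : IsCompactOperator (inclL T U)) :
    IsCompactOperator (weightedIncl T W hW) :=
  hcompact.clm_comp (mulExpL W hW)

lemma tendsto_weightedIncl {Wn : ℕ → E d → ℝ}
    (hWn : ∀ n, MemLp (Wn n) ∞ (volume.restrict (U : Set (E d)))) {η : ℕ → ℝ}
    (hη₀ : ∀ n, 0 ≤ η n) (hη : Tendsto η atTop (𝓝 0))
    (hdist : ∀ n, ∀ x ∈ U, |Real.exp (Wn n x) - Real.exp (W x)| ≤ η n) :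
    Tendsto (fun n => weightedIncl T (Wn n) (hWn n)) atTop (𝓝 (weightedIncl T W hW)) := by
  have hmul : Tendsto (fun n => mulExpL (Wn n) (hWn n)) atTop (𝓝 (mulExpL W hW)) :=
    tendsto_iff_norm_sub_tendsto_zero.2 <| squeeze_zero (fun _ => norm_nonneg _)
      (fun n => norm_mulExpL_sub_le (hWn n) hW (hη₀ n) (hdist n)) hη
  exact (((inclL T U).precomp (L2 U)).continuous.tendsto _).comp hmul

end WeightedIncl

/-- The space `V` with the norm `N` lies between the domain of `gradOp T U` and `L²(U)`, and on
that domain `N²` is bounded by an arbitrarily small multiple of `‖∇u‖²` plus a multiple of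
`‖u‖²`. -/
structure IsIntermediateSpace (T : Set (E d → ℝ)) (V : Submodule ℝ (L2 U)) (N : L2 U → ℝ≥0∞) :
    Prop where
  map_smul (c : ℝ) (u : L2 U) : N (c • u) = ‖c‖ₑ * N u
  eq_zero (u : L2 U) : N u = 0 → u = 0
  inclL_mem (p : H1Space T U) : inclL T U p ∈ V
  interpolation {ε : ℝ} (hε : 0 < ε) : ∃ C : ℝ, 0 ≤ C ∧ ∀ p : H1Space T U,
    N (inclL T U p) ^ 2 ≤ ENNReal.ofReal (ε * ‖gradL T U p‖ ^ 2 + C * ‖inclL T U p‖ ^ 2)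

namespace IsIntermediateSpace

variable {V : Submodule ℝ (L2 U)} {N : L2 U → ℝ≥0∞} (hV : IsIntermediateSpace T V N)
  {W : E d → ℝ} (hW : MemLp W ∞ (volume.restrict (U : Set (E d))))

/-- The form `(p, q) ↦ ∫_U e^{2W} ∇p · ∇q + B(p, q)` on the domain of the gradient, of which
`expForm` is the push-forward along `p ↦ e^W p`. -/
def graphForm (B : V →ₗ[ℝ] V →ₗ[ℝ] ℝ) : LinearMap.BilinForm ℝ (H1Space T U) :=
  (energy W hW).compl₁₂ (gradL T U : H1Space T U →ₗ[ℝ] L2Vec U) (gradL T U) +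
    B.compl₁₂ ((inclL T U : H1Space T U →ₗ[ℝ] L2 U).codRestrict V hV.inclL_mem)
      ((inclL T U : H1Space T U →ₗ[ℝ] L2 U).codRestrict V hV.inclL_mem)

lemma graphForm_apply (B : V →ₗ[ℝ] V →ₗ[ℝ] ℝ) (p q : H1Space T U) :
    hV.graphForm hW B p q = energy W hW (gradL T U p) (gradL T U q) +
      B ⟨inclL T U p, hV.inclL_mem p⟩ ⟨inclL T U q, hV.inclL_mem q⟩ := rfl

include hV in
lemma mem_expDomain_iff (u : L2 U) :
    u ∈ expDomain T V W hW ↔ ∃ p, weightedIncl T W hW p = u := by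
  constructor
  · intro hu
    obtain ⟨p, hp⟩ := range_inclL.ge hu.1
    exact ⟨p, by rw [weightedIncl_apply, hp]; exact mulExp_mulExp_neg hW u⟩
  · rintro ⟨p, rfl⟩
    rw [expDomain, Submodule.mem_comap, weightedIncl_apply, mulExp_neg_mulExp]
    exact ⟨range_inclL.le ⟨p, rfl⟩, hV.inclL_mem p⟩

lemma flat_eq {u : expDomain T V W hW} {p : H1Space T U} (hp : weightedIncl T W hW p = u) :
    flat T V W hW u = ⟨inclL T U p, hV.inclL_mem p⟩ := by
  apply Subtype.ext
  change mulExp (-W) hW.neg (u : L2 U) = _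
  rw [← hp, weightedIncl_apply, mulExp_neg_mulExp]

lemma isPushforward_expForm (hT : T ⊆ smoothFns d) (Z : BoundedSymmForm V N) :
    (expForm T W hW Z).IsPushforward (weightedIncl T W hW) (hV.graphForm hW Z.bilin) where
  mem_domain_iff := hV.mem_expDomain_iff hW
  bilin_apply {p q} hp hq := by
    refine (expBilin_apply T W hW Z.bilin ⟨_, hp⟩ ⟨_, hq⟩).trans ?_
    rw [flatGrad_eq hW hT (p := p) rfl, flatGrad_eq hW hT (p := q) rfl,
      hV.flat_eq hW (p := p) rfl, hV.flat_eq hW (p := q) rfl, graphForm_apply]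

include hV in
lemma norm_ne_top (p : H1Space T U) : N (inclL T U p) ≠ ⊤ := by
  obtain ⟨C, -, hC⟩ := hV.interpolation one_pos
  intro htop
  have h := hC p
  rw [htop, ENNReal.top_pow two_ne_zero] at h
  exact ENNReal.ofReal_ne_top (top_le_iff.1 h)

include hV in
lemma exists_toReal_sq_le {ε : ℝ} (hε : 0 < ε) : ∃ C : ℝ, 0 ≤ C ∧ ∀ p : H1Space T U,
    (N (inclL T U p)).toReal ^ 2 ≤ ε * ‖gradL T U p‖ ^ 2 + C * ‖inclL T U p‖ ^ 2 := by
  obtain ⟨C, hC₀, hC⟩ := hV.interpolation hε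
  refine ⟨C, hC₀, fun p => ?_⟩
  rw [← ENNReal.toReal_pow]
  exact ENNReal.toReal_le_of_le_ofReal (by positivity) (hC p)

lemma le_graphForm_self {R ζ ε C : ℝ} (hζ : 0 ≤ ζ)
    (hC : ∀ p : H1Space T U,
      (N (inclL T U p)).toReal ^ 2 ≤ ε * ‖gradL T U p‖ ^ 2 + C * ‖inclL T U p‖ ^ 2)
    (hR : ∀ x ∈ U, |W x| ≤ R) {B : V →ₗ[ℝ] V →ₗ[ℝ] ℝ}
    (hB : ∀ u : V, N u ≠ ⊤ → |B u u| ≤ ζ * (N u).toReal ^ 2) (p : H1Space T U) :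
    (Real.exp (-(2 * R)) - ζ * ε) * ‖gradL T U p‖ ^ 2 - ζ * C * ‖inclL T U p‖ ^ 2 ≤
      hV.graphForm hW B p p := by
  have henergy := le_energy_self hW hR (gradL T U p)
  have hform := (abs_le.1 (hB ⟨inclL T U p, hV.inclL_mem p⟩ (hV.norm_ne_top p))).1
  have hnorm := mul_le_mul_of_nonneg_left (hC p) hζ
  rw [graphForm_apply]
  linarith

lemma exists_coercive (R : ℝ) {ζ : ℝ} (hζ : 0 ≤ ζ) : ∃ M c : ℝ, 0 < M ∧ 0 < c ∧
    ∀ (W : E d → ℝ) (hW : MemLp W ∞ (volume.restrict (U : Set (E d)))), (∀ x ∈ U, |W x| ≤ R) →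
    ∀ B : V →ₗ[ℝ] V →ₗ[ℝ] ℝ, (∀ u : V, N u ≠ ⊤ → |B u u| ≤ ζ * (N u).toReal ^ 2) →
    ∀ p, c * ‖p‖ ^ 2 ≤ hV.graphForm hW B p p + M * ‖weightedIncl T W hW p‖ ^ 2 := by
  obtain ⟨κ, hκ, hκR⟩ : ∃ κ : ℝ, 0 < κ ∧ 2 * κ ≤ Real.exp (-(2 * R)) :=
    ⟨_, half_pos (Real.exp_pos _), (mul_div_cancel₀ _ two_ne_zero).le⟩
  obtain ⟨C, hC₀, hC⟩ := hV.exists_toReal_sq_le (ε := κ / (ζ + 1)) (by positivity)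
  have hζε : ζ * (κ / (ζ + 1)) ≤ κ := by
    rw [mul_div_assoc', div_le_iff₀ (by positivity)]
    linarith
  refine ⟨(ζ * C + 1) * Real.exp R ^ 2, min κ 1, by positivity, by positivity,
    fun W hW hR B hB p => ?_⟩
  have hmass : ‖inclL T U p‖ ^ 2 ≤ Real.exp R ^ 2 * ‖weightedIncl T W hW p‖ ^ 2 := by
    rw [← mul_pow, weightedIncl_apply]
    exact pow_le_pow_left₀ (norm_nonneg _) (norm_le_norm_mulExp hW hR _) 2
  calc min κ 1 * ‖p‖ ^ 2
      ≤ 1 * ‖inclL T U p‖ ^ 2 + κ * ‖gradL T U p‖ ^ 2 := by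
        rw [norm_sq_eq, mul_add]
        gcongr
        exacts [min_le_right _ _, min_le_left _ _]
    _ ≤ ((Real.exp (-(2 * R)) - ζ * (κ / (ζ + 1))) * ‖gradL T U p‖ ^ 2 -
          ζ * C * ‖inclL T U p‖ ^ 2) + (ζ * C + 1) * ‖inclL T U p‖ ^ 2 := by
        have := mul_le_mul_of_nonneg_right
          (show κ ≤ Real.exp (-(2 * R)) - ζ * (κ / (ζ + 1)) by linarith) (sq_nonneg ‖gradL T U p‖)
        linarith
    _ ≤ _ := by
        rw [mul_assoc _ (Real.exp R ^ 2)]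
        gcongr
        exact hV.le_graphForm_self hW hζ hC hR hB p

lemma abs_graphForm_sub_le {W' : E d → ℝ} (hW' : MemLp W' ∞ (volume.restrict (U : Set (E d))))
    {η ζ C : ℝ} (hη : ∀ x ∈ U, |Real.exp (2 * W x) - Real.exp (2 * W' x)| ≤ η) (hη₀ : 0 ≤ η)
    (hζ : 0 ≤ ζ) (hC : ∀ p : H1Space T U, (N (inclL T U p)).toReal ^ 2 ≤ C * ‖p‖ ^ 2)
    {B B' : V →ₗ[ℝ] V →ₗ[ℝ] ℝ}
    (hB : ∀ u : V, N u ≠ ⊤ → |(B - B') u u| ≤ ζ * (N u).toReal ^ 2) (p : H1Space T U) :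
    |hV.graphForm hW B p p - hV.graphForm hW' B' p p| ≤ (η + ζ * C) * ‖p‖ ^ 2 := by
  have henergy := abs_energy_sub_le hW hW' hη (gradL T U p)
  have hform := hB ⟨inclL T U p, hV.inclL_mem p⟩ (hV.norm_ne_top p)
  have hgrad : η * ‖gradL T U p‖ ^ 2 ≤ η * ‖p‖ ^ 2 := by
    rw [norm_sq_eq]
    exact mul_le_mul_of_nonneg_left (le_add_of_nonneg_left (sq_nonneg _)) hη₀
  have hnorm := mul_le_mul_of_nonneg_left (hC p) hζ
  rw [graphForm_apply, graphForm_apply, add_sub_add_comm]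
  rw [LinearMap.sub_apply, LinearMap.sub_apply] at hform
  refine (abs_add_le _ _).trans ?_
  linarith

lemma graphForm_self_le {R ζ C : ℝ} (hR : ∀ x ∈ U, |W x| ≤ R) (hζ : 0 ≤ ζ)
    (hC : ∀ p : H1Space T U, (N (inclL T U p)).toReal ^ 2 ≤ C * ‖p‖ ^ 2) {B : V →ₗ[ℝ] V →ₗ[ℝ] ℝ}
    (hB : ∀ u : V, N u ≠ ⊤ → |B u u| ≤ ζ * (N u).toReal ^ 2) (p : H1Space T U) :
    hV.graphForm hW B p p ≤ (Real.exp (2 * R) + ζ * C) * ‖p‖ ^ 2 := by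
  have henergy := energy_self_le hW hR (gradL T U p)
  have hform := (abs_le.1 (hB ⟨inclL T U p, hV.inclL_mem p⟩ (hV.norm_ne_top p))).2
  have hgrad : Real.exp (2 * R) * ‖gradL T U p‖ ^ 2 ≤ Real.exp (2 * R) * ‖p‖ ^ 2 := by
    rw [norm_sq_eq]
    exact mul_le_mul_of_nonneg_left (le_add_of_nonneg_left (sq_nonneg _)) (Real.exp_pos _).le
  have hnorm := mul_le_mul_of_nonneg_left (hC p) hζ
  rw [graphForm_apply]
  linarith

include hV in
lemma exists_toReal_sq_le_norm_sq :
    ∃ C : ℝ, ∀ p : H1Space T U, (N (inclL T U p)).toReal ^ 2 ≤ C * ‖p‖ ^ 2 := by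
  obtain ⟨C, hC₀, hC⟩ := hV.exists_toReal_sq_le one_pos
  refine ⟨1 + C, fun p => (hC p).trans ?_⟩
  rw [norm_sq_eq]
  nlinarith [sq_nonneg ‖inclL T U p‖, mul_nonneg hC₀ (sq_nonneg ‖gradL T U p‖)]

include hV in
theorem convergesCompactly_expForm (hT : T ⊆ smoothFns d) (hdense : DenseRange (inclL T U))
    (hcompact : IsCompactOperator (inclL T U)) {Wn : ℕ → E d → ℝ}
    (hWn : ∀ n, MemLp (Wn n) ∞ (volume.restrict (U : Set (E d)))) {R : ℝ} {w : ℕ → ℝ}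
    (hw : Tendsto w atTop (𝓝 0)) (hw₀ : ∀ n, 0 ≤ w n) (hR : ∀ x ∈ U, |W x| ≤ R)
    (hRn : ∀ n, ∀ x ∈ U, |Wn n x| ≤ R) (hdist : ∀ n, ∀ x ∈ U, |Wn n x - W x| ≤ w n)
    (Zn : ℕ → BoundedSymmForm V N) (Z : BoundedSymmForm V N)
    (hZ : Tendsto (fun n => formNorm N ((Zn n).bilin - Z.bilin)) atTop (𝓝 0)) :
    ConvergesCompactly (fun n => expForm T (Wn n) (hWn n) (Zn n)) (expForm T W hW Z) := by
  obtain ⟨ζ, z, hζ, hz, hz₀, hζZ, hζn, hzn⟩ :=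
    exists_bounds_of_tendsto_formNorm hV.map_smul hV.eq_zero hZ
  obtain ⟨C, hC⟩ := hV.exists_toReal_sq_le_norm_sq
  obtain ⟨M, c, hM, hc, hcoer⟩ := hV.exists_coercive R hζ
  have hexp (n : ℕ) (x) (hx : x ∈ U) :
      |Real.exp (Wn n x) - Real.exp (W x)| ≤ Real.exp R * w n :=
    (abs_exp_sub_exp_le (abs_le.1 (hRn n x hx)).2 (abs_le.1 (hR x hx)).2).trans <|
      mul_le_mul_of_nonneg_left (hdist n x hx) (Real.exp_pos _).le
  have hexp_two (n : ℕ) (x) (hx : x ∈ U) :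
      |Real.exp (2 * Wn n x) - Real.exp (2 * W x)| ≤ Real.exp (2 * R) * (2 * w n) := by
    refine (abs_exp_sub_exp_le (R := 2 * R) (by linarith [(abs_le.1 (hRn n x hx)).2])
      (by linarith [(abs_le.1 (hR x hx)).2])).trans ?_
    rw [← mul_sub, abs_mul, abs_two]
    gcongr
    exact hdist n x hx
  refine convergesCompactly_of_isPushforward
    (η := fun n => Real.exp (2 * R) * (2 * w n) + z n * C)
    (fun n => hV.isPushforward_expForm (hWn n) hT (Zn n)) (hV.isPushforward_expForm hW hT Z)
    (fun n => denseRange_weightedIncl (hWn n) hdense) (denseRange_weightedIncl hW hdense)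
    (tendsto_weightedIncl hW hWn (fun n => mul_nonneg (Real.exp_pos R).le (hw₀ n))
      (by simpa only [mul_zero] using hw.const_mul (Real.exp R)) hexp)
    (isCompactOperator_weightedIncl hW hcompact) ?_
    (fun n => hV.abs_graphForm_sub_le (hWn n) hW (hexp_two n)
      (mul_nonneg (Real.exp_pos _).le (mul_nonneg zero_le_two (hw₀ n))) (hz₀ n) hC (hzn n))
    (hV.graphForm_self_le hW hR hζ hC hζZ) hM hc
    fun n => hcoer (Wn n) (hWn n) (hRn n) _ (hζn n)
  simpa only [mul_zero, zero_mul, add_zero] using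
    ((hw.const_mul 2).const_mul (Real.exp (2 * R))).add (hz.mul_const C)

end IsIntermediateSpace

end ExpForms

/-! ### Translation estimates and the cone condition -/

section LowerIntegrals

lemma ennreal_add_sq_le (a b : ℝ≥0∞) : (a + b) ^ 2 ≤ 2 * (a ^ 2 + b ^ 2) := by
  induction a with
  | top => simp
  | coe a =>
    induction b with
    | top => simp
    | coe b => exact_mod_cast add_sq_le (a := a) (b := b)

lemma enorm_add_sq_le {F : Type*} [SeminormedAddGroup F] (a b : F) :
    ‖a + b‖ₑ ^ 2 ≤ 2 * (‖a‖ₑ ^ 2 + ‖b‖ₑ ^ 2) := by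
  simp only [enorm]
  exact_mod_cast (pow_le_pow_left' (nnnorm_add_le a b) 2).trans add_sq_le

lemma enorm_sub_sq_le {F : Type*} [SeminormedAddGroup F] (a b : F) :
    ‖a - b‖ₑ ^ 2 ≤ 2 * (‖a‖ₑ ^ 2 + ‖b‖ₑ ^ 2) := by
  simpa only [sub_eq_add_neg, enorm_neg] using enorm_add_sq_le a (-b)

lemma lintegral_sq_le {α : Type*} [MeasurableSpace α] {μ : Measure α} {f : α → ℝ≥0∞}
    (hf : AEMeasurable f μ) : (∫⁻ x, f x ∂μ) ^ 2 ≤ μ Set.univ * ∫⁻ x, f x ^ 2 ∂μ := by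
  have h := ENNReal.lintegral_mul_le_Lp_mul_Lq μ Real.HolderConjugate.two_two hf
    (aemeasurable_const (b := (1 : ℝ≥0∞)))
  simp only [Pi.mul_apply, mul_one, one_pow, lintegral_const, one_mul, ENNReal.rpow_ofNat] at h
  calc (∫⁻ x, f x ∂μ) ^ 2
      ≤ ((∫⁻ x, f x ^ 2 ∂μ) ^ (1 / 2 : ℝ) * μ Set.univ ^ (1 / 2 : ℝ)) ^ 2 := by gcongr
    _ = μ Set.univ * ∫⁻ x, f x ^ 2 ∂μ := by
      simp only [mul_pow, ← ENNReal.rpow_mul_natCast, Nat.cast_ofNat, one_div,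
        inv_mul_cancel₀ (two_ne_zero' ℝ), ENNReal.rpow_one, mul_comm]

lemma eLpNorm_two_sq {α F : Type*} [MeasurableSpace α] [NormedAddCommGroup F] (μ : Measure α)
    (f : α → F) : eLpNorm f 2 μ ^ 2 = ∫⁻ x, ‖f x‖ₑ ^ 2 ∂μ := by
  simpa using eLpNorm_nnreal_pow_eq_lintegral (f := f) (μ := μ) (p := 2) two_ne_zero

lemma setLIntegral_comp_add_right_le {V : Type*} [AddGroup V] [MeasurableSpace V]
    [MeasurableAdd V] {μ : Measure V} [μ.IsAddRightInvariant] {A S : Set V} (hA : MeasurableSet A)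
    (hS : MeasurableSet S) {v : V} (h : ∀ x ∈ S, x + v ∈ A) (g : V → ℝ≥0∞) :
    ∫⁻ x in S, g (x + v) ∂μ ≤ ∫⁻ x in A, g x ∂μ := by
  rw [← lintegral_indicator hA, ← lintegral_indicator hS,
    ← lintegral_add_right_eq_self (A.indicator g) v]
  refine lintegral_mono fun x => ?_
  by_cases hx : x ∈ S
  · rw [Set.indicator_of_mem hx, Set.indicator_of_mem (h x hx)]
  · rw [Set.indicator_of_notMem hx]
    exact zero_le

end LowerIntegrals

section Increments

variable {V F : Type*} [NormedAddCommGroup V] [NormedSpace ℝ V] [NormedAddCommGroup F]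
  [NormedSpace ℝ F] [CompleteSpace F] {φ : V → F}

lemma enorm_sub_sq_le_lintegral_fderiv (hφ : ContDiff ℝ 1 φ) (x v : V) :
    ‖φ (x + v) - φ x‖ₑ ^ 2 ≤
      ‖v‖ₑ ^ 2 * ∫⁻ t in Set.Ioc (0 : ℝ) 1, ‖fderiv ℝ φ (x + t • v)‖ₑ ^ 2 := by
  have : Continuous (fderiv ℝ φ) := hφ.continuous_fderiv one_ne_zero
  have hderiv (t : ℝ) : HasDerivAt (fun t : ℝ => φ (x + t • v)) (fderiv ℝ φ (x + t • v) v) t := by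
    have hline : HasDerivAt (fun t : ℝ => x + t • v) v t := by
      simpa using ((hasDerivAt_id t).smul_const v).const_add x
    exact (hφ.differentiable one_ne_zero _).hasFDerivAt.comp_hasDerivAt t hline
  have hint := intervalIntegral.integral_eq_sub_of_hasDerivAt (fun t _ => hderiv t)
    (Continuous.intervalIntegrable (by fun_prop) 0 1)
  simp only [one_smul, zero_smul, add_zero, intervalIntegral.integral_of_le zero_le_one] at hint
  calc ‖φ (x + v) - φ x‖ₑ ^ 2
      ≤ (∫⁻ t in Set.Ioc (0 : ℝ) 1, ‖fderiv ℝ φ (x + t • v)‖ₑ * ‖v‖ₑ) ^ 2 := by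
        rw [← hint]
        gcongr
        exact (enorm_integral_le_lintegral_enorm _).trans
          (lintegral_mono fun t => ContinuousLinearMap.le_opENorm _ _)
    _ = ‖v‖ₑ ^ 2 * (∫⁻ t in Set.Ioc (0 : ℝ) 1, ‖fderiv ℝ φ (x + t • v)‖ₑ) ^ 2 := by
        rw [lintegral_mul_const' _ _ enorm_ne_top, mul_pow, mul_comm]
    _ ≤ _ := by
        gcongr
        refine (lintegral_sq_le (Continuous.aemeasurable (by fun_prop))).trans_eq ?_
        simp only [Measure.restrict_apply_univ, Real.volume_Ioc, sub_zero, ENNReal.ofReal_one,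
          one_mul]

variable [MeasurableSpace V] [BorelSpace V]

lemma setLIntegral_sub_sq_le_fderiv {μ : Measure V} [μ.IsAddRightInvariant] [SFinite μ]
    (hφ : ContDiff ℝ 1 φ) {A S : Set V} (hA : MeasurableSet A) (hS : MeasurableSet S) (a v : V)
    (h : ∀ x ∈ S, ∀ t ∈ Set.Icc (0 : ℝ) 1, x + a + t • v ∈ A) :
    ∫⁻ x in S, ‖φ (x + a + v) - φ (x + a)‖ₑ ^ 2 ∂μ ≤
      ‖v‖ₑ ^ 2 * ∫⁻ x in A, ‖fderiv ℝ φ x‖ₑ ^ 2 ∂μ := by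
  have : Continuous (fderiv ℝ φ) := hφ.continuous_fderiv one_ne_zero
  calc ∫⁻ x in S, ‖φ (x + a + v) - φ (x + a)‖ₑ ^ 2 ∂μ
      ≤ ∫⁻ x in S, (‖v‖ₑ ^ 2 * ∫⁻ t in Set.Ioc (0 : ℝ) 1,
          ‖fderiv ℝ φ (x + a + t • v)‖ₑ ^ 2) ∂μ :=
        lintegral_mono fun x => enorm_sub_sq_le_lintegral_fderiv hφ (x + a) v
    _ = ‖v‖ₑ ^ 2 * ∫⁻ t in Set.Ioc (0 : ℝ) 1,
          ∫⁻ x in S, ‖fderiv ℝ φ (x + (a + t • v))‖ₑ ^ 2 ∂μ := by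
        rw [lintegral_const_mul' _ _ (by finiteness), lintegral_lintegral_swap]
        · simp only [add_assoc]
        · exact (Continuous.measurable (by fun_prop)).aemeasurable
    _ ≤ ‖v‖ₑ ^ 2 * ∫⁻ _t in Set.Ioc (0 : ℝ) 1, ∫⁻ x in A, ‖fderiv ℝ φ x‖ₑ ^ 2 ∂μ := by
        gcongr ‖v‖ₑ ^ 2 * ?_
        refine setLIntegral_mono' measurableSet_Ioc fun t ht =>
          setLIntegral_comp_add_right_le hA hS (fun x hx => ?_) fun x => ‖fderiv ℝ φ x‖ₑ ^ 2
        exact add_assoc x a (t • v) ▸ h x hx t (Set.Ioc_subset_Icc_self ht)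
    _ = _ := by simp only [lintegral_const, Measure.restrict_apply_univ, Real.volume_Ioc,
          sub_zero, ENNReal.ofReal_one, mul_one]

end Increments

section Gradient

variable {V : Type*} [NormedAddCommGroup V] [InnerProductSpace ℝ V] [CompleteSpace V]

lemma enorm_gradient (φ : V → ℝ) (x : V) : ‖gradient φ x‖ₑ = ‖fderiv ℝ φ x‖ₑ :=
  (InnerProductSpace.toDual ℝ V).symm.enorm_map _

end Gradient

section ConeCondition

variable {V : Type*} [NormedAddCommGroup V] [NormedSpace ℝ V]

/-- The cone condition for `U` in the ball `B(y, r)`: with each of its points, `U` contains the part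
in `B(y, r)` of the cone `{x + t e + w : L |w| ≤ t}` with vertex `x`. Since `e` need not be a unit
vector, the ball `B(y, r) ⊆ U` satisfies it with `e = 0`. -/
structure ConeConditionOn (U : Set V) (y : V) (r : ℝ) (e : V) (L : NNReal) : Prop where
  norm_axis_le : ‖e‖ ≤ 1
  one_le : 1 ≤ L
  cone_mem : ∀ x ∈ U ∩ Metric.ball y r, ∀ (t : ℝ) (w : V), L * ‖w‖ ≤ t →
    x + t • e + w ∈ Metric.ball y r → x + t • e + w ∈ U

/-- The cone condition near each point of the closure of `U`. -/
def LocalConeCondition (U : Set V) : Prop :=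
  ∀ y ∈ closure U, ∃ r > 0, ∃ e L, ConeConditionOn U y r e L

lemma coneConditionOn_of_ball_subset {U : Set V} {y : V} {r : ℝ} (h : Metric.ball y r ⊆ U) :
    ConeConditionOn U y r 0 1 where
  norm_axis_le := by simp
  one_le := le_rfl
  cone_mem _ _ _ _ _ hz := h hz

namespace ConeConditionOn

variable {U : Set V} {y e : V} {r : ℝ} {L : NNReal}

lemma norm_smul_axis_le (H : ConeConditionOn U y r e L) {t : ℝ} (ht : 0 ≤ t) : ‖t • e‖ ≤ t := by
  rw [norm_smul_of_nonneg ht]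
  exact mul_le_of_le_one_right ht H.norm_axis_le

lemma add_smul_smul_axis_mem (H : ConeConditionOn U y r e L) {x : V}
    (hx : x ∈ U ∩ Metric.ball y r) {s t : ℝ} (hs : 0 ≤ s) (ht : 0 ≤ t)
    (hxt : x + s • t • e ∈ Metric.ball y r) : x + s • t • e ∈ U := by
  simpa only [smul_smul, add_zero] using H.cone_mem x hx (s * t) 0
    (by rw [norm_zero, mul_zero]; positivity) (by rwa [add_zero, ← smul_smul])

end ConeConditionOn

end ConeCondition

section LipschitzGraph

variable {V : Type*} [NormedAddCommGroup V] [InnerProductSpace ℝ V]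

lemma norm_sub_inner_smul_le {e : V} (he : ‖e‖ = 1) (w : V) : ‖w - inner ℝ e w • e‖ ≤ ‖w‖ := by
  rw [← sq_le_sq₀ (norm_nonneg _) (norm_nonneg _), norm_sub_sq_real, norm_smul, he, mul_one,
    real_inner_smul_right, real_inner_comm, Real.norm_eq_abs, sq_abs]
  linarith [sq_nonneg (inner ℝ w e)]

lemma lipschitzGraph_lt_of_cone {e : V} (he : ‖e‖ = 1) {K : NNReal} {γ : V → ℝ}
    (hγ : LipschitzWith K γ) {x w : V} {t : ℝ} (hx : γ (x - inner ℝ e x • e) < inner ℝ e x)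
    (ht : (K + 1) * ‖w‖ ≤ t) :
    γ (x + t • e + w - inner ℝ e (x + t • e + w) • e) < inner ℝ e (x + t • e + w) := by
  have hee : inner ℝ e e = (1 : ℝ) := by rw [real_inner_self_eq_norm_sq, he, one_pow]
  have hheight : inner ℝ e (x + t • e + w) = inner ℝ e x + t + inner ℝ e w := by
    rw [inner_add_right, inner_add_right, inner_smul_right, hee, mul_one]
  have hbase : x + t • e + w - inner ℝ e (x + t • e + w) • e - (x - inner ℝ e x • e) =
      w - inner ℝ e w • e := by
    rw [hheight]
    module
  have hinner : -‖w‖ ≤ inner ℝ e w := by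
    simpa only [he, one_mul] using neg_le_of_abs_le (abs_real_inner_le_norm e w)
  have hlip := (le_abs_self _).trans (hγ.norm_sub_le (x + t • e + w -
    inner ℝ e (x + t • e + w) • e) (x - inner ℝ e x • e))
  rw [hbase] at hlip
  have hK : (K : ℝ) * ‖w - inner ℝ e w • e‖ ≤ K * ‖w‖ := by
    gcongr
    exact norm_sub_inner_smul_le he w
  linarith

lemma coneConditionOn_of_lipschitzGraph {U : Set V} {y e : V} {r : ℝ} {K : NNReal} {γ : V → ℝ}
    (he : ‖e‖ = 1) (hγ : LipschitzWith K γ)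
    (hU : U ∩ Metric.ball y r =
      {x | x ∈ Metric.ball y r ∧ γ (x - inner ℝ e x • e) < inner ℝ e x}) :
    ConeConditionOn U y r e (K + 1) where
  norm_axis_le := he.le
  one_le := le_add_self
  cone_mem x hx t w ht hz := by
    have hgraph : x + t • e + w ∈
        {x | x ∈ Metric.ball y r ∧ γ (x - inner ℝ e x • e) < inner ℝ e x} :=
      ⟨hz, lipschitzGraph_lt_of_cone he hγ (hU ▸ hx).2 (by exact_mod_cast ht)⟩
    exact (hU ▸ hgraph).1

lemma IsLipschitzDomain.localConeCondition {d : ℕ} {U : Set (E d)} (hU : IsLipschitzDomain U)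
    (hUo : IsOpen U) : LocalConeCondition U := by
  intro y hy
  by_cases hyU : y ∈ U
  · obtain ⟨r, hr, hball⟩ := Metric.isOpen_iff.1 hUo y hyU
    exact ⟨r, hr, 0, 1, coneConditionOn_of_ball_subset hball⟩
  · obtain ⟨r, hr, e, he, K, γ, hγ, hgraph⟩ := hU y ⟨hy, by rwa [hUo.interior_eq]⟩
    exact ⟨r, hr, e, K + 1, coneConditionOn_of_lipschitzGraph he hγ hgraph⟩

end LipschitzGraph

section InteriorBall

variable {V : Type*} [NormedAddCommGroup V]

/-- The interior ball condition: for small `ρ`, each ball of radius `ρ` with centre in `U` contains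
a ball of radius `κ ρ` that lies in `A`. -/
def InteriorBallCondition (U A : Set V) : Prop :=
  ∃ κ > (0 : ℝ), ∃ δ > (0 : ℝ), ∀ x ∈ U, ∀ ρ, 0 < ρ → ρ < δ →
    ∃ z, Metric.ball z (κ * ρ) ⊆ Metric.ball x ρ ∩ A

lemma interiorBallCondition_univ (U : Set V) : InteriorBallCondition U Set.univ :=
  ⟨1, one_pos, 1, one_pos, fun x _ ρ _ _ => ⟨x, by simp only [one_mul, Set.inter_univ, le_refl]⟩⟩

lemma InteriorBallCondition.mono {U U' A : Set V} (h : InteriorBallCondition U A) (hU : U' ⊆ U) :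
    InteriorBallCondition U' A := by
  obtain ⟨κ, hκ, δ, hδ, H⟩ := h
  exact ⟨κ, hκ, δ, hδ, fun x hx => H x (hU hx)⟩

lemma InteriorBallCondition.union {U U' A : Set V} (h : InteriorBallCondition U A)
    (h' : InteriorBallCondition U' A) : InteriorBallCondition (U ∪ U') A := by
  obtain ⟨κ, hκ, δ, hδ, H⟩ := h
  obtain ⟨κ', hκ', δ', hδ', H'⟩ := h'
  refine ⟨min κ κ', lt_min hκ hκ', min δ δ', lt_min hδ hδ', fun x hx ρ hρ hlt => ?_⟩
  obtain ⟨hltδ, hltδ'⟩ := lt_min_iff.1 hlt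
  rcases hx with hx | hx
  · refine (H x hx ρ hρ hltδ).imp fun z hz => (Metric.ball_subset_ball ?_).trans hz
    gcongr
    exact min_le_left _ _
  · refine (H' x hx ρ hρ hltδ').imp fun z hz => (Metric.ball_subset_ball ?_).trans hz
    gcongr
    exact min_le_right _ _

variable [NormedSpace ℝ V]

lemma ConeConditionOn.interiorBallCondition {U : Set V} {y e : V} {r : ℝ} {L : NNReal}
    (h : ConeConditionOn U y r e L) (hr : 0 < r) :
    InteriorBallCondition (U ∩ Metric.ball y (r / 2)) U := by
  have hL : (1 : ℝ) ≤ L := h.one_le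
  refine ⟨1 / (2 * L), by positivity, r / 2, by positivity, fun x hx ρ hρ hρr =>
    ⟨x + (ρ / 2) • e, fun z hz => ?_⟩⟩
  obtain ⟨w, rfl⟩ : ∃ w, z = x + (ρ / 2) • e + w := ⟨_, (add_sub_cancel _ _).symm⟩
  have hw : L * ‖w‖ < ρ / 2 := by
    rw [mem_ball_iff_norm, add_sub_cancel_left, one_div_mul_eq_div, lt_div_iff₀ (by positivity)]
      at hz
    linarith
  have hdist : ‖(ρ / 2) • e + w‖ < ρ := calc
    _ ≤ ρ / 2 * 1 + L * ‖w‖ := by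
      refine (norm_add_le _ _).trans (add_le_add ?_ (le_mul_of_one_le_left (norm_nonneg w) hL))
      rw [norm_smul_of_nonneg (by positivity)]
      gcongr
      exact h.norm_axis_le
    _ < ρ := by linarith
  have hball : x + (ρ / 2) • e + w ∈ Metric.ball x ρ := by
    rwa [mem_ball_iff_norm, add_assoc, add_sub_cancel_left]
  refine ⟨hball, h.cone_mem x ⟨hx.1, ?_⟩ _ _ hw.le ?_⟩
  · exact Metric.ball_subset_ball (by linarith) hx.2
  · exact Metric.ball_subset_ball' (by linarith [Metric.mem_ball.1 hx.2]) hball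

lemma LocalConeCondition.interiorBallCondition {U : Set V} (hU : LocalConeCondition U)
    (hUc : IsCompact (closure U)) : InteriorBallCondition U U := by
  suffices h : InteriorBallCondition (U ∩ closure U) U from
    h.mono (Set.subset_inter subset_rfl subset_closure)
  refine hUc.induction_on (p := fun S => InteriorBallCondition (U ∩ S) U)
    ⟨1, one_pos, 1, one_pos, by simp⟩ (fun S S' hS h => h.mono (by gcongr))
    (fun S S' h h' => by rw [Set.inter_union_distrib_left]; exact h.union h') fun y hy => ?_
  obtain ⟨r, hr, e, L, h⟩ := hU y hy
  exact ⟨Metric.ball y (r / 2), mem_nhdsWithin_of_mem_nhds (Metric.ball_mem_nhds y (by positivity)),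
    h.interiorBallCondition hr⟩

end InteriorBall

section TranslationEstimate

variable {V F : Type*} [NormedAddCommGroup V] [NormedSpace ℝ V] [NormedAddCommGroup F]
  [NormedSpace ℝ F] [MeasurableSpace V] {μ : Measure V} {T : Set (V → F)} {S S' U A : Set V}

/-- The translation estimate for the functions in `T`: the increments over small `h` that start in
`S` and end in `A` are `O(|h|)` in `L²`, relative to the `L²(U)` norm of the derivative. -/
def TranslationEstimate (μ : Measure V) (T : Set (V → F)) (S A U : Set V) : Prop :=
  ∃ C : NNReal, ∃ δ > (0 : ℝ), ∀ φ ∈ T, ∀ h : V, ‖h‖ < δ →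
    ∫⁻ x in {x | x ∈ S ∧ x + h ∈ A}, ‖φ (x + h) - φ x‖ₑ ^ 2 ∂μ ≤
      C * ‖h‖ₑ ^ 2 * ∫⁻ x in U, ‖fderiv ℝ φ x‖ₑ ^ 2 ∂μ

lemma TranslationEstimate.mono (H : TranslationEstimate μ T S A U) (hS : S' ⊆ S) :
    TranslationEstimate μ T S' A U := by
  obtain ⟨C, δ, hδ, H⟩ := H
  refine ⟨C, δ, hδ, fun φ hφ h hh => le_trans (lintegral_mono_set ?_) (H φ hφ h hh)⟩
  exact fun x hx => ⟨hS hx.1, hx.2⟩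

lemma TranslationEstimate.union (H : TranslationEstimate μ T S A U)
    (H' : TranslationEstimate μ T S' A U) : TranslationEstimate μ T (S ∪ S') A U := by
  obtain ⟨C, δ, hδ, H⟩ := H
  obtain ⟨C', δ', hδ', H'⟩ := H'
  refine ⟨C + C', min δ δ', lt_min hδ hδ', fun φ hφ h hh => ?_⟩
  obtain ⟨hhδ, hhδ'⟩ := lt_min_iff.1 hh
  have hsub : {x | x ∈ S ∪ S' ∧ x + h ∈ A} ⊆
      {x | x ∈ S ∧ x + h ∈ A} ∪ {x | x ∈ S' ∧ x + h ∈ A} := by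
    rintro x ⟨hx | hx, hxh⟩
    exacts [Or.inl ⟨hx, hxh⟩, Or.inr ⟨hx, hxh⟩]
  refine (lintegral_mono_set hsub).trans ((lintegral_union_le _ _ _).trans
    ((add_le_add (H φ hφ h hhδ) (H' φ hφ h hhδ')).trans_eq ?_))
  rw [ENNReal.coe_add, add_mul, add_mul]

variable [CompleteSpace F] [BorelSpace V] [SFinite μ] [μ.IsAddRightInvariant]

lemma setLIntegral_sub_sq_le_of_three_segments {φ : V → F} (hφ : ContDiff ℝ 1 φ)
    (hU : MeasurableSet U) (hS : MeasurableSet S) (a h : V)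
    (hstart : ∀ x ∈ S, ∀ t ∈ Set.Icc (0 : ℝ) 1, x + t • a ∈ U)
    (hmid : ∀ x ∈ S, ∀ t ∈ Set.Icc (0 : ℝ) 1, x + a + t • h ∈ U)
    (hend : ∀ x ∈ S, ∀ t ∈ Set.Icc (0 : ℝ) 1, x + h + t • a ∈ U) :
    ∫⁻ x in S, ‖φ (x + h) - φ x‖ₑ ^ 2 ∂μ ≤
      (6 * ‖a‖ₑ ^ 2 + 4 * ‖h‖ₑ ^ 2) * ∫⁻ x in U, ‖fderiv ℝ φ x‖ₑ ^ 2 ∂μ := by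
  have hsplit (x : V) : ‖φ (x + h) - φ x‖ₑ ^ 2 ≤ 4 * ‖φ (x + 0 + a) - φ (x + 0)‖ₑ ^ 2 +
      4 * ‖φ (x + a + h) - φ (x + a)‖ₑ ^ 2 + 2 * ‖φ (x + h + a) - φ (x + h)‖ₑ ^ 2 := by
    have hsum : φ (x + h) - φ x = (φ (x + 0 + a) - φ (x + 0)) +
        (φ (x + a + h) - φ (x + a)) - (φ (x + h + a) - φ (x + h)) := by
      rw [add_right_comm x a h, add_zero]
      abel
    rw [hsum]
    refine (enorm_sub_sq_le _ _).trans ?_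
    grw [enorm_add_sq_le]
    exact le_of_eq (by ring)
  have hmeas (b c : V) : Measurable fun x => ‖φ (x + b + c) - φ (x + b)‖ₑ ^ 2 := by
    have := hφ.continuous
    exact Continuous.measurable (by fun_prop)
  calc ∫⁻ x in S, ‖φ (x + h) - φ x‖ₑ ^ 2 ∂μ
      ≤ 4 * (∫⁻ x in S, ‖φ (x + 0 + a) - φ (x + 0)‖ₑ ^ 2 ∂μ) +
        4 * (∫⁻ x in S, ‖φ (x + a + h) - φ (x + a)‖ₑ ^ 2 ∂μ) +
        2 * ∫⁻ x in S, ‖φ (x + h + a) - φ (x + h)‖ₑ ^ 2 ∂μ := by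
        refine (lintegral_mono hsplit).trans_eq ?_
        rw [lintegral_add_right _ ((hmeas _ _).const_mul _),
          lintegral_add_right _ ((hmeas _ _).const_mul _), lintegral_const_mul _ (hmeas _ _),
          lintegral_const_mul _ (hmeas _ _), lintegral_const_mul _ (hmeas _ _)]
    _ ≤ 4 * (‖a‖ₑ ^ 2 * ∫⁻ x in U, ‖fderiv ℝ φ x‖ₑ ^ 2 ∂μ) +
        4 * (‖h‖ₑ ^ 2 * ∫⁻ x in U, ‖fderiv ℝ φ x‖ₑ ^ 2 ∂μ) +
        2 * (‖a‖ₑ ^ 2 * ∫⁻ x in U, ‖fderiv ℝ φ x‖ₑ ^ 2 ∂μ) := by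
        gcongr
        · exact setLIntegral_sub_sq_le_fderiv hφ hU hS 0 a (by simpa only [add_zero] using hstart)
        · exact setLIntegral_sub_sq_le_fderiv hφ hU hS a h hmid
        · exact setLIntegral_sub_sq_le_fderiv hφ hU hS h a hend
    _ = _ := by ring

lemma ConeConditionOn.setLIntegral_sub_sq_le {y e : V} {r : ℝ} {L : NNReal}
    (H : ConeConditionOn U y r e L) (hU : IsOpen U) {φ : V → F} (hφ : ContDiff ℝ 1 φ) {h : V}
    (hh : (L + 1) * ‖h‖ < r / 2) :
    ∫⁻ x in {x | x ∈ U ∩ Metric.ball y (r / 2) ∧ x + h ∈ U}, ‖φ (x + h) - φ x‖ₑ ^ 2 ∂μ ≤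
      (6 * ‖(L * ‖h‖) • e‖ₑ ^ 2 + 4 * ‖h‖ₑ ^ 2) * ∫⁻ x in U, ‖fderiv ℝ φ x‖ₑ ^ 2 ∂μ := by
  have hr : 0 < r / 2 := hh.trans_le' (by positivity)
  have hball {x w : V} (hx : x ∈ Metric.ball y (r / 2)) (hw : ‖w‖ ≤ (L + 1) * ‖h‖) :
      x + w ∈ Metric.ball y r := by
    rw [mem_ball_iff_norm] at hx ⊢
    rw [add_sub_right_comm]
    linarith [norm_add_le (x - y) w]
  have hbase {x : V} (hx : x ∈ Metric.ball y (r / 2)) : x ∈ Metric.ball y r :=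
    Metric.ball_subset_ball (by linarith) hx
  have hscale {τ : ℝ} (w : V) (hτ : τ ∈ Set.Icc (0 : ℝ) 1) : ‖τ • w‖ ≤ ‖w‖ := by
    rw [norm_smul_of_nonneg hτ.1]
    exact mul_le_of_le_one_left (norm_nonneg w) hτ.2
  have haxis : ‖(L * ‖h‖) • e‖ ≤ L * ‖h‖ := H.norm_smul_axis_le (by positivity)
  have hmeas : MeasurableSet {x | x ∈ U ∩ Metric.ball y (r / 2) ∧ x + h ∈ U} :=
    ((hU.inter Metric.isOpen_ball).inter (hU.preimage (continuous_add_const h))).measurableSet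
  refine setLIntegral_sub_sq_le_of_three_segments hφ hU.measurableSet hmeas _ _ ?_ ?_ ?_
  · rintro x ⟨⟨hxU, hx⟩, -⟩ τ hτ
    refine H.add_smul_smul_axis_mem ⟨hxU, hbase hx⟩ hτ.1 (by positivity) (hball hx ?_)
    linarith [hscale ((L * ‖h‖) • e) hτ, norm_nonneg h]
  · rintro x ⟨⟨hxU, hx⟩, -⟩ τ hτ
    refine H.cone_mem x ⟨hxU, hbase hx⟩ _ _ (by gcongr; exact hscale h hτ) ?_
    rw [add_assoc]
    refine hball hx ((norm_add_le _ _).trans ?_)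
    linarith [hscale h hτ]
  · rintro x ⟨⟨-, hx⟩, hxU⟩ τ hτ
    have hxh : ‖h‖ ≤ (L + 1) * ‖h‖ := le_mul_of_one_le_left (norm_nonneg h) (by simp)
    refine H.add_smul_smul_axis_mem ⟨hxU, hball hx hxh⟩ hτ.1 (by positivity) ?_
    rw [add_assoc]
    refine hball hx ((norm_add_le _ _).trans ?_)
    linarith [hscale ((L * ‖h‖) • e) hτ]

lemma ConeConditionOn.translationEstimate {y e : V} {r : ℝ} {L : NNReal}
    (H : ConeConditionOn U y r e L) (hr : 0 < r) (hU : IsOpen U)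
    (hT : ∀ φ ∈ T, ContDiff ℝ 1 φ) :
    TranslationEstimate μ T (U ∩ Metric.ball y (r / 2)) U U := by
  refine ⟨6 * L ^ 2 + 4, r / 2 / (L + 1), by positivity, fun φ hφ h hh => ?_⟩
  have hnorm : ‖(L * ‖h‖) • e‖ₑ ≤ L * ‖h‖ₑ := by
    rw [← ofReal_norm, ← ofReal_norm h, ← ENNReal.ofReal_coe_nnreal,
      ← ENNReal.ofReal_mul L.coe_nonneg]
    exact ENNReal.ofReal_le_ofReal (H.norm_smul_axis_le (by positivity))
  calc _ ≤ (6 * ‖(L * ‖h‖) • e‖ₑ ^ 2 + 4 * ‖h‖ₑ ^ 2) * ∫⁻ x in U, ‖fderiv ℝ φ x‖ₑ ^ 2 ∂μ :=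
        H.setLIntegral_sub_sq_le hU (hT φ hφ) (by rwa [lt_div_iff₀' (by positivity)] at hh)
    _ ≤ (6 * (L * ‖h‖ₑ) ^ 2 + 4 * ‖h‖ₑ ^ 2) * ∫⁻ x in U, ‖fderiv ℝ φ x‖ₑ ^ 2 ∂μ := by gcongr
    _ = _ := by
        push_cast
        ring

lemma LocalConeCondition.translationEstimate (hU : LocalConeCondition U) (hUo : IsOpen U)
    (hUc : IsCompact (closure U)) (hT : ∀ φ ∈ T, ContDiff ℝ 1 φ) :
    TranslationEstimate μ T U U U := by
  suffices h : TranslationEstimate μ T (U ∩ closure U) U U from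
    h.mono (Set.subset_inter subset_rfl subset_closure)
  refine hUc.induction_on (p := fun S => TranslationEstimate μ T (U ∩ S) U U)
    ⟨0, 1, one_pos, by simp⟩ (fun S S' hS h => h.mono (by gcongr))
    (fun S S' h h' => by rw [Set.inter_union_distrib_left]; exact h.union h') fun y hy => ?_
  obtain ⟨r, hr, e, L, h⟩ := hU y hy
  exact ⟨Metric.ball y (r / 2), mem_nhdsWithin_of_mem_nhds (Metric.ball_mem_nhds y (by positivity)),
    h.translationEstimate hr hUo hT⟩

lemma translationEstimate_univ (hT : ∀ φ ∈ T, ContDiff ℝ 1 φ) (hU : MeasurableSet U)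
    (hsupp : ∀ φ ∈ T, ∀ x ∉ U, fderiv ℝ φ x = 0) :
    TranslationEstimate μ T Set.univ Set.univ U := by
  refine ⟨1, 1, one_pos, fun φ hφ h _ => ?_⟩
  have hvanish : ∫⁻ x in Uᶜ, ‖fderiv ℝ φ x‖ₑ ^ 2 ∂μ = 0 :=
    setLIntegral_eq_zero hU.compl fun x hx => by
      simp only [hsupp φ hφ x hx, ← ofReal_norm, norm_zero, ENNReal.ofReal_zero,
        zero_pow two_ne_zero, Pi.zero_apply]
  have hle := setLIntegral_sub_sq_le_fderiv (μ := μ) (hT φ hφ) MeasurableSet.univ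
    MeasurableSet.univ 0 h fun _ _ _ _ => Set.mem_univ _
  rw [Measure.restrict_univ, ← lintegral_add_compl (fun x => ‖fderiv ℝ φ x‖ₑ ^ 2) hU, hvanish,
    add_zero] at hle
  simpa only [add_zero, Set.mem_univ, and_self, Set.ofPred_true, ENNReal.coe_one, one_mul,
    Measure.restrict_univ] using hle

end TranslationEstimate

/-! ### Slobodeckij seminorms -/

section SingularKernels

variable {V F : Type*} [NormedAddCommGroup V] [NormedAddCommGroup F] [MeasurableSpace V]
  [BorelSpace V] {μ : Measure V} {T : Set (V → F)} {U A : Set V}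

lemma lintegral_lintegral_sub [SecondCountableTopology V] [SFinite μ] [μ.IsAddLeftInvariant]
    (hA : MeasurableSet A) {k : V → ℝ≥0∞} (hk : Measurable k) {G : V × V → ℝ≥0∞}
    (hG : Measurable G) :
    ∫⁻ x in A, ∫⁻ y in A, k (y - x) * G (x, y) ∂μ ∂μ =
      ∫⁻ h, k h * ∫⁻ x in {x | x ∈ A ∧ x + h ∈ A}, G (x, x + h) ∂μ ∂μ := by
  have htranslate (x : V) : ∫⁻ y in A, k (y - x) * G (x, y) ∂μ =
      ∫⁻ h, A.indicator (fun y => k (y - x) * G (x, y)) (x + h) ∂μ := by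
    rw [lintegral_add_left_eq_self (A.indicator fun y => k (y - x) * G (x, y)) x,
      lintegral_indicator hA]
  have hmeas : Measurable
      (Function.uncurry fun x h => A.indicator (fun y => k (y - x) * G (x, y)) (x + h)) := by
    change Measurable (Set.indicator ((fun q : V × V => q.1 + q.2) ⁻¹' A)
      fun q => k (q.1 + q.2 - q.1) * G (q.1, q.1 + q.2))
    exact Measurable.indicator (by fun_prop) ((measurable_fst.add measurable_snd) hA)
  simp_rw [htranslate]
  rw [lintegral_lintegral_swap hmeas.aemeasurable]
  refine lintegral_congr fun h => ?_
  have hset : MeasurableSet {x | x ∈ A ∧ x + h ∈ A} := hA.inter (measurable_add_const h hA)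
  rw [← lintegral_const_mul _ (by fun_prop), ← lintegral_indicator hA, ← lintegral_indicator hset]
  refine lintegral_congr fun x => ?_
  by_cases hx : x ∈ A <;> by_cases hxh : x + h ∈ A <;> simp [Set.indicator, hx, hxh]

lemma tendsto_setLIntegral_ball_zero {f : V → ℝ≥0∞} (hf : Measurable f) (hf₀ : f 0 = 0) {δ : ℝ}
    (hδ : 0 < δ) (hfin : ∫⁻ h in Metric.ball 0 δ, f h ∂μ ≠ ⊤) :
    Tendsto (fun r => ∫⁻ h in Metric.ball 0 r, f h ∂μ) (𝓝[>] 0) (𝓝 0) := by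
  have hdominated : Tendsto (fun r => ∫⁻ h, (Metric.ball 0 r).indicator f h ∂μ) (𝓝[>] 0)
      (𝓝 (∫⁻ _, 0 ∂μ)) := by
    refine tendsto_lintegral_filter_of_dominated_convergence ((Metric.ball 0 δ).indicator f)
      (.of_forall fun r => hf.indicator Metric.isOpen_ball.measurableSet) ?_
      (by rwa [lintegral_indicator Metric.isOpen_ball.measurableSet]) (.of_forall fun h => ?_)
    · filter_upwards [nhdsWithin_le_nhds (eventually_lt_nhds hδ)] with r hr
      exact .of_forall fun h => Set.indicator_le_indicator_of_subset
        (Metric.ball_subset_ball hr.le) (fun _ => zero_le) h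
    · rcases eq_or_ne h 0 with rfl | hh
      · refine tendsto_const_nhds.congr fun r => ?_
        by_cases h0 : 0 ∈ Metric.ball (0 : V) r <;>
          simp only [Set.indicator, h0, hf₀, if_true, if_false]
      · refine tendsto_const_nhds.congr' ?_
        filter_upwards [nhdsWithin_le_nhds (eventually_lt_nhds (norm_pos_iff.2 hh))] with r hr
        rw [Set.indicator_of_notMem]
        rw [mem_ball_zero_iff]
        exact hr.le.not_gt
  rw [lintegral_zero] at hdominated
  exact hdominated.congr fun r => lintegral_indicator Metric.isOpen_ball.measurableSet f

lemma setLIntegral_sub_sq_le_four_mul [μ.IsAddRightInvariant] (hA : MeasurableSet A) {φ : V → F}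
    (hφ : Measurable fun x => ‖φ x‖ₑ ^ 2) (h : V) :
    ∫⁻ x in {x | x ∈ A ∧ x + h ∈ A}, ‖φ (x + h) - φ x‖ₑ ^ 2 ∂μ ≤
      4 * ∫⁻ x in A, ‖φ x‖ₑ ^ 2 ∂μ := by
  have hset : MeasurableSet {x | x ∈ A ∧ x + h ∈ A} := hA.inter (measurable_add_const h hA)
  calc ∫⁻ x in {x | x ∈ A ∧ x + h ∈ A}, ‖φ (x + h) - φ x‖ₑ ^ 2 ∂μ
      ≤ ∫⁻ x in {x | x ∈ A ∧ x + h ∈ A}, 2 * (‖φ (x + h)‖ₑ ^ 2 + ‖φ x‖ₑ ^ 2) ∂μ :=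
        lintegral_mono fun x => enorm_sub_sq_le _ _
    _ = 2 * ((∫⁻ x in {x | x ∈ A ∧ x + h ∈ A}, ‖φ (x + h)‖ₑ ^ 2 ∂μ) +
          ∫⁻ x in {x | x ∈ A ∧ x + h ∈ A}, ‖φ x‖ₑ ^ 2 ∂μ) := by
        rw [lintegral_const_mul' _ _ ENNReal.ofNat_ne_top, lintegral_add_right _ hφ]
    _ ≤ 2 * ((∫⁻ x in A, ‖φ x‖ₑ ^ 2 ∂μ) + ∫⁻ x in A, ‖φ x‖ₑ ^ 2 ∂μ) := by
        refine mul_le_mul_right (add_le_add ?_ (lintegral_mono_set fun x hx => hx.1)) 2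
        exact setLIntegral_comp_add_right_le hA hset (fun _ hx => hx.2) fun x => ‖φ x‖ₑ ^ 2
    _ = 4 * ∫⁻ x in A, ‖φ x‖ₑ ^ 2 ∂μ := by ring

variable [NormedSpace ℝ V] [NormedSpace ℝ F]

/-- Small translations are absorbed by the gradient and large ones by the function itself. -/
lemma TranslationEstimate.lintegral_mul_le [μ.IsAddRightInvariant]
    (H : TranslationEstimate μ T A A U) (hA : MeasurableSet A)
    (hT : ∀ φ ∈ T, Measurable fun x => ‖φ x‖ₑ ^ 2) {k : V → ℝ≥0∞} (hk : Measurable k)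
    (hsmall : ∀ r, ∫⁻ h in Metric.ball 0 r, k h * ‖h‖ₑ ^ 2 ∂μ ≠ ⊤)
    (hlarge : ∀ r > 0, ∫⁻ h in (Metric.ball 0 r)ᶜ, k h ∂μ ≠ ⊤) {ε : ℝ≥0∞} (hε : ε ≠ 0) :
    ∃ C : ℝ≥0∞, C ≠ ⊤ ∧ ∀ φ ∈ T,
      ∫⁻ h, k h * ∫⁻ x in {x | x ∈ A ∧ x + h ∈ A}, ‖φ (x + h) - φ x‖ₑ ^ 2 ∂μ ∂μ ≤
        ε * ∫⁻ x in U, ‖fderiv ℝ φ x‖ₑ ^ 2 ∂μ + C * ∫⁻ x in A, ‖φ x‖ₑ ^ 2 ∂μ := by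
  obtain ⟨K, δ, hδ, hK⟩ := H
  have hlim : Tendsto (fun r => K * ∫⁻ h in Metric.ball 0 r, k h * ‖h‖ₑ ^ 2 ∂μ) (𝓝[>] 0) (𝓝 0) := by
    simpa only [mul_zero] using ENNReal.Tendsto.const_mul (tendsto_setLIntegral_ball_zero
      (by fun_prop) (by rw [enorm_zero, zero_pow two_ne_zero, mul_zero]) hδ (hsmall δ))
      (.inr ENNReal.coe_ne_top)
  have hltδ : ∀ᶠ r : ℝ in 𝓝[>] 0, r < δ := nhdsWithin_le_nhds (eventually_lt_nhds hδ)
  obtain ⟨r, hrε, hrδ, hr⟩ := ((hlim.eventually_le_const (pos_iff_ne_zero.2 hε)).and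
    (hltδ.and self_mem_nhdsWithin)).exists
  refine ⟨(∫⁻ h in (Metric.ball 0 r)ᶜ, k h ∂μ) * 4,
    ENNReal.mul_ne_top (hlarge r hr) ENNReal.ofNat_ne_top, fun φ hφ => ?_⟩
  rw [← lintegral_add_compl _ (Metric.isOpen_ball (x := (0 : V)) (ε := r)).measurableSet]
  refine add_le_add ?_ ?_
  · calc _ ≤ ∫⁻ h in Metric.ball 0 r,
            k h * ‖h‖ₑ ^ 2 * (K * ∫⁻ x in U, ‖fderiv ℝ φ x‖ₑ ^ 2 ∂μ) ∂μ := by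
          refine setLIntegral_mono' Metric.isOpen_ball.measurableSet fun h hh => ?_
          rw [mul_assoc]
          gcongr
          refine (hK φ hφ h ((mem_ball_zero_iff.1 hh).trans hrδ)).trans_eq ?_
          ring
      _ = (K * ∫⁻ h in Metric.ball 0 r, k h * ‖h‖ₑ ^ 2 ∂μ) *
            ∫⁻ x in U, ‖fderiv ℝ φ x‖ₑ ^ 2 ∂μ := by
          rw [lintegral_mul_const _ (by fun_prop)]
          ring
      _ ≤ _ := by gcongr
  · calc _ ≤ ∫⁻ h in (Metric.ball 0 r)ᶜ, k h * (4 * ∫⁻ x in A, ‖φ x‖ₑ ^ 2 ∂μ) ∂μ := by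
          gcongr with h
          exact setLIntegral_sub_sq_le_four_mul hA (hT φ hφ) h
      _ = _ := by rw [lintegral_mul_const _ hk, mul_assoc]

end SingularKernels

section Slobodeckij

variable {d : ℕ} {s : ℝ}

/-- The kernel `|h|^{-(d + 2 s)}` of the Slobodeckij seminorm, equal to `0` at `h = 0`. -/
def sloboKernel (d : ℕ) (s : ℝ) (h : E d) : ℝ≥0∞ :=
  ENNReal.ofReal (‖h‖ ^ (-((d : ℝ) + 2 * s)))

lemma measurable_sloboKernel (s : ℝ) : Measurable (sloboKernel d s) := by
  unfold sloboKernel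
  fun_prop

lemma enorm_sloboQuot_sq (hs : s ≠ 0) (f : E d → ℝ) (x y : E d) :
    ‖sloboQuot s f (x, y)‖ₑ ^ 2 = sloboKernel d s (y - x) * ‖f y - f x‖ₑ ^ 2 := by
  rw [← ofReal_norm, ← ofReal_norm, ← ENNReal.ofReal_pow (norm_nonneg _),
    ← ENNReal.ofReal_pow (norm_nonneg _), sloboKernel, ← ENNReal.ofReal_mul (by positivity),
    Real.norm_eq_abs, Real.norm_eq_abs, sq_abs, sq_abs, sloboQuot, if_neg hs, norm_sub_rev y x,
    div_pow, Real.rpow_neg (norm_nonneg _), div_eq_inv_mul, ← Real.rpow_mul_natCast (norm_nonneg _),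
    sub_sq_comm (f x)]
  congr 4
  push_cast
  ring

lemma eLpNorm_sloboQuot_sq (hs : s ≠ 0) {f : E d → ℝ} (hf : Measurable f) {A : Set (E d)}
    (hA : MeasurableSet A) : eLpNorm (sloboQuot s f) 2 (sqMeasure A) ^ 2 =
      ∫⁻ h, sloboKernel d s h * ∫⁻ x in {x | x ∈ A ∧ x + h ∈ A}, ‖f (x + h) - f x‖ₑ ^ 2 := by
  have hk := measurable_sloboKernel (d := d) s
  have hquot : (fun q : E d × E d => ‖sloboQuot s f q‖ₑ ^ 2) =
      fun q => sloboKernel d s (q.2 - q.1) * ‖f q.2 - f q.1‖ₑ ^ 2 :=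
    funext fun q => enorm_sloboQuot_sq hs f q.1 q.2
  rw [← lintegral_lintegral_sub hA hk (G := fun q => ‖f q.2 - f q.1‖ₑ ^ 2) (by fun_prop),
    eLpNorm_two_sq, hquot, lintegral_prod _ (by fun_prop)]

lemma lintegral_sloboKernel_mul_sq_lt_top (hd : 1 ≤ d) (hs1 : s < 1) (r : ℝ) :
    ∫⁻ h in Metric.ball (0 : E d) r, sloboKernel d s h * ‖h‖ₑ ^ 2 < ⊤ := by
  have hint : IntegrableOn (fun h : E d => ‖h‖ ^ (-((d : ℝ) + 2 * s - 2)))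
      (Metric.ball 0 r) volume := by
    refine integrableOn_ball_of_norm_le_rpow (by rwa [finrank_euclideanSpace_fin]) (C := 1)
      (α := (d : ℝ) + 2 * s - 2) (by rw [finrank_euclideanSpace_fin]; linarith)
      (.of_forall fun h => ?_) (Measurable.aestronglyMeasurable (by fun_prop))
    rw [Real.norm_of_nonneg (by positivity), one_mul]
  refine lt_of_le_of_lt (lintegral_mono fun h => ?_) hint.2
  rcases eq_or_ne h 0 with rfl | h0
  · rw [enorm_zero, zero_pow two_ne_zero, mul_zero]
    exact zero_le
  rw [sloboKernel, ← ofReal_norm, ← ENNReal.ofReal_pow (norm_nonneg _),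
    ← ENNReal.ofReal_mul (by positivity), Real.enorm_of_nonneg (by positivity),
    ← Real.rpow_natCast, ← Real.rpow_add (norm_pos_iff.2 h0)]
  refine ENNReal.ofReal_le_ofReal (le_of_eq ?_)
  congr 1
  push_cast
  ring

lemma lintegral_sloboKernel_compl_lt_top (hs : 0 < s) {r : ℝ} (hr : 0 < r) :
    ∫⁻ h in (Metric.ball (0 : E d) r)ᶜ, sloboKernel d s h < ⊤ := by
  set α : ℝ := (d : ℝ) + 2 * s
  have hα₀ : 0 < α := by positivity
  have hfin := finite_integral_one_add_norm (E := E d) (μ := volume) (r := α)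
    (by rw [finrank_euclideanSpace_fin]; linarith)
  calc ∫⁻ h in (Metric.ball (0 : E d) r)ᶜ, sloboKernel d s h
      ≤ ∫⁻ h in (Metric.ball (0 : E d) r)ᶜ,
          ENNReal.ofReal ((r / (1 + r)) ^ (-α)) * ENNReal.ofReal ((1 + ‖h‖) ^ (-α)) := by
        refine setLIntegral_mono' Metric.isOpen_ball.measurableSet.compl fun h hh => ?_
        rw [Set.mem_compl_iff, mem_ball_zero_iff, not_lt] at hh
        rw [sloboKernel, ← ENNReal.ofReal_mul (by positivity),
          ← Real.mul_rpow (by positivity) (by positivity)]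
        refine ENNReal.ofReal_le_ofReal
          (Real.rpow_le_rpow_of_nonpos (by positivity) ?_ (neg_nonpos.2 hα₀.le))
        rw [div_mul_eq_mul_div, div_le_iff₀ (by positivity)]
        linarith
    _ ≤ ∫⁻ h : E d, ENNReal.ofReal ((r / (1 + r)) ^ (-α)) * ENNReal.ofReal ((1 + ‖h‖) ^ (-α)) :=
        setLIntegral_le_lintegral _ _
    _ < ⊤ := by
        rw [lintegral_const_mul' _ _ ENNReal.ofReal_ne_top]
        exact ENNReal.mul_lt_top ENNReal.ofReal_lt_top hfin

lemma TranslationEstimate.eLpNorm_sloboQuot_sq_le {T : Set (E d → ℝ)} {U A : Set (E d)}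
    (H : TranslationEstimate volume T A A U) (hA : MeasurableSet A) (hT : ∀ φ ∈ T, Measurable φ)
    (hd : 1 ≤ d) (hs0 : 0 ≤ s) (hs1 : s < 1) {ε : ℝ≥0∞} (hε : ε ≠ 0) :
    ∃ C : ℝ≥0∞, C ≠ ⊤ ∧ ∀ φ ∈ T, eLpNorm (sloboQuot s φ) 2 (sqMeasure A) ^ 2 ≤
      ε * (∫⁻ x in U, ‖fderiv ℝ φ x‖ₑ ^ 2) + C * ∫⁻ x in A, ‖φ x‖ₑ ^ 2 := by
  rcases hs0.eq_or_lt with rfl | hs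
  · refine ⟨0, ENNReal.zero_ne_top, fun φ _ => ?_⟩
    have hzero : sloboQuot 0 φ = fun _ : E d × E d => (0 : ℝ) := funext fun _ => if_pos rfl
    rw [hzero, eLpNorm_zero', zero_pow two_ne_zero]
    exact zero_le
  obtain ⟨C, hC, h⟩ := H.lintegral_mul_le hA (fun φ hφ => (hT φ hφ).enorm.pow_const 2)
    (measurable_sloboKernel s) (fun r => (lintegral_sloboKernel_mul_sq_lt_top hd hs1 r).ne)
    (fun r hr => (lintegral_sloboKernel_compl_lt_top hs hr).ne) hε
  exact ⟨C, hC, fun φ hφ => (eLpNorm_sloboQuot_sq hs.ne' (hT φ hφ) hA).trans_le (h φ hφ)⟩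

end Slobodeckij

section ExtensionByZero

lemma eLpNorm_sq_le_of_tendsto_ae {α F : Type*} [MeasurableSpace α] {μ : Measure α}
    [NormedAddCommGroup F] {f : ℕ → α → F} {g : α → F} {b : ℕ → ℝ≥0∞} {B : ℝ≥0∞}
    (hf : ∀ k, AEStronglyMeasurable (f k) μ)
    (hfg : ∀ᵐ x ∂μ, Tendsto (fun k => f k x) atTop (𝓝 (g x)))
    (hb : ∀ k, eLpNorm (f k) 2 μ ^ 2 ≤ b k) (hB : Tendsto b atTop (𝓝 B)) :
    eLpNorm g 2 μ ^ 2 ≤ B := by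
  simp only [eLpNorm_two_sq] at hb ⊢
  calc ∫⁻ x, ‖g x‖ₑ ^ 2 ∂μ = ∫⁻ x, liminf (fun k => ‖f k x‖ₑ ^ 2) atTop ∂μ := by
        refine lintegral_congr_ae ?_
        filter_upwards [hfg] with x hx
        exact (((ENNReal.continuous_pow 2).tendsto _).comp hx.enorm).liminf_eq.symm
    _ ≤ liminf (fun k => ∫⁻ x, ‖f k x‖ₑ ^ 2 ∂μ) atTop :=
        lintegral_liminf_le' fun k => (hf k).enorm.pow_const 2
    _ ≤ liminf b atTop := liminf_le_liminf (Eventually.of_forall hb)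
    _ = B := hB.liminf_eq

variable {d : ℕ} {s : ℝ} {A : Set (E d)} {U : Opens (E d)}

lemma ae_sqMeasure {P : E d → Prop} (h : ∀ᵐ x ∂(volume.restrict A), P x) :
    ∀ᵐ q ∂(sqMeasure A), P q.1 ∧ P q.2 :=
  (Measure.quasiMeasurePreserving_fst.ae h).and (Measure.quasiMeasurePreserving_snd.ae h)

lemma sloboQuot_congr {f g : E d → ℝ} (h : f =ᵐ[volume.restrict A] g) :
    sloboQuot s f =ᵐ[sqMeasure A] sloboQuot s g := by
  filter_upwards [ae_sqMeasure h] with q hq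
  simp only [sloboQuot, hq.1, hq.2]

lemma aestronglyMeasurable_sloboQuot {f : E d → ℝ}
    (hf : AEStronglyMeasurable f (volume.restrict A)) :
    AEStronglyMeasurable (sloboQuot s f) (sqMeasure A) := by
  unfold sloboQuot
  split_ifs
  · exact aestronglyMeasurable_const
  · have hnum : AEStronglyMeasurable (fun q : E d × E d => f q.1 - f q.2) (sqMeasure A) :=
      hf.comp_fst.sub hf.comp_snd
    have hden : Measurable fun q : E d × E d => ‖q.1 - q.2‖ ^ ((d : ℝ) / 2 + s) := by fun_prop
    exact (hnum.aemeasurable.div hden.aemeasurable).aestronglyMeasurable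

lemma tendsto_sloboQuot {f : ℕ → E d → ℝ} {g : E d → ℝ}
    (h : ∀ᵐ x ∂(volume.restrict A), Tendsto (fun k => f k x) atTop (𝓝 (g x))) :
    ∀ᵐ q ∂(sqMeasure A), Tendsto (fun k => sloboQuot s (f k) q) atTop (𝓝 (sloboQuot s g q)) := by
  filter_upwards [ae_sqMeasure h] with q hq
  unfold sloboQuot
  split_ifs
  · exact tendsto_const_nhds
  · exact (hq.1.sub hq.2).div_const _

lemma sloboQuot_sub (f g : E d → ℝ) : sloboQuot s (f - g) = sloboQuot s f - sloboQuot s g := by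
  ext q
  simp only [sloboQuot, Pi.sub_apply]
  split_ifs <;> ring

lemma sloboQuot_smul (c : ℝ) (f : E d → ℝ) : sloboQuot s (c • f) = c • sloboQuot s f := by
  ext q
  simp only [sloboQuot, Pi.smul_apply, smul_eq_mul]
  split_ifs <;> ring

lemma sobNorm_congr {f g : E d → ℝ} (h : f =ᵐ[volume.restrict A] g) :
    sobNorm s A f = sobNorm s A g := by
  rw [sobNorm, sobNorm, eLpNorm_congr_ae h, eLpNorm_congr_ae (sloboQuot_congr h)]

lemma indicator_ae_eq_indicator {f g : E d → ℝ} (h : f =ᵐ[volume.restrict (U : Set (E d))] g) :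
    (U : Set (E d)).indicator f =ᵐ[volume.restrict A] (U : Set (E d)).indicator g := by
  refine ae_restrict_of_ae ?_
  filter_upwards [(ae_restrict_iff' U.isOpen.measurableSet).1 h] with x hx
  by_cases hxU : x ∈ (U : Set (E d)) <;> simp [hxU, hx]

lemma tendsto_indicator_ae {f : ℕ → E d → ℝ} {g : E d → ℝ}
    (h : ∀ᵐ x ∂(volume.restrict (U : Set (E d))), Tendsto (fun k => f k x) atTop (𝓝 (g x))) :
    ∀ᵐ x ∂(volume.restrict A), Tendsto (fun k => (U : Set (E d)).indicator (f k) x) atTop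
      (𝓝 ((U : Set (E d)).indicator g x)) := by
  refine ae_restrict_of_ae ?_
  filter_upwards [(ae_restrict_iff' U.isOpen.measurableSet).1 h] with x hx
  by_cases hxU : x ∈ (U : Set (E d)) <;> simp [hxU, hx]

lemma aestronglyMeasurable_indicator_coeFn (u : L2 U) :
    AEStronglyMeasurable ((U : Set (E d)).indicator u) (volume.restrict A) :=
  ((aestronglyMeasurable_indicator_iff U.isOpen.measurableSet).2
    (Lp.aestronglyMeasurable u)).restrict

lemma eLpNorm_indicator_coeFn (hUA : (U : Set (E d)) ⊆ A) (u : L2 U) :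
    eLpNorm ((U : Set (E d)).indicator u) 2 (volume.restrict A) = ‖u‖ₑ := by
  rw [eLpNorm_indicator_eq_eLpNorm_restrict U.isOpen.measurableSet,
    Measure.restrict_restrict U.isOpen.measurableSet, Set.inter_eq_left.2 hUA, Lp.enorm_def]

/-- The norm in `H^s(A)` of the extension by zero of an element of `L²(U)`. It is the norm of
`H^s₀(U)` for `A = ℝ^d` and that of `H^s(U)` for `A = U`. -/
def extNorm (s : ℝ) (U : Opens (E d)) (A : Set (E d)) (u : L2 U) : ℝ≥0∞ :=
  sobNorm s A ((U : Set (E d)).indicator u)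

lemma hsNorm_eq_extNorm (s : ℝ) (U : Opens (E d)) :
    HsNorm s U = extNorm s U (U : Set (E d)) :=
  funext fun _ => sobNorm_congr (indicator_ae_eq_restrict U.isOpen.measurableSet).symm

lemma extNorm_smul (c : ℝ) (u : L2 U) : extNorm s U A (c • u) = ‖c‖ₑ * extNorm s U A u := by
  have hsmul : (U : Set (E d)).indicator (c • u : L2 U) =ᵐ[volume.restrict A]
      c • (U : Set (E d)).indicator u :=
    (indicator_ae_eq_indicator (Lp.coeFn_smul c u)).trans
      (Eventually.of_forall fun x => Set.indicator_const_smul_apply _ c _ x)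
  rw [extNorm, sobNorm_congr hsmul, sobNorm, sloboQuot_smul, eLpNorm_const_smul,
    eLpNorm_const_smul, ← mul_add, extNorm, sobNorm]

lemma extNorm_eq_zero (hUA : (U : Set (E d)) ⊆ A) (u : L2 U) (h : extNorm s U A u = 0) :
    u = 0 := by
  rw [← enorm_eq_zero, ← eLpNorm_indicator_coeFn hUA]
  exact (add_eq_zero.1 h).1

end ExtensionByZero

section H1Approximation

variable {d : ℕ} {T : Set (E d → ℝ)} {U : Opens (E d)}

/-- The pairs `(φ, ∇φ)` with `φ ∈ T` that lie in `L²(U) × L²(U; ℝ^d)`; `H1Graph T U` is the closed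
linear span of this set. -/
def gradPairs (T : Set (E d → ℝ)) (U : Opens (E d)) : Set (L2 U × L2Vec U) :=
  {p | ∃ φ ∈ T, p.1 =ᵐ[volume.restrict (U : Set (E d))] φ ∧
    p.2 =ᵐ[volume.restrict (U : Set (E d))] gradient φ}

lemma gradPairs_subset_H1Graph : gradPairs T U ⊆ H1Graph T U :=
  Submodule.subset_span.trans (Submodule.le_topologicalClosure _)

lemma exists_seq_tendsto_ae_of_mem_closure {S : Set (L2 U × L2Vec U)} {p : L2 U × L2Vec U}
    (hp : p ∈ closure S) : ∃ q : ℕ → L2 U × L2Vec U, (∀ k, q k ∈ S) ∧ Tendsto q atTop (𝓝 p) ∧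
      ∀ᵐ x ∂(volume.restrict (U : Set (E d))), Tendsto (fun k => (q k).1 x) atTop (𝓝 (p.1 x)) := by
  obtain ⟨q, hqS, hqp⟩ := mem_closure_iff_seq_limit.1 hp
  have hq₁ : Tendsto (fun k => (q k).1) atTop (𝓝 p.1) := hqp.fst_nhds
  obtain ⟨ns, hns, hae⟩ := (tendstoInMeasure_of_tendsto_Lp hq₁).exists_seq_tendsto_ae
  exact ⟨fun k => q (ns k), fun k => hqS _, hqp.comp hns.tendsto_atTop, hae⟩

/-- A linear space `T` of smooth functions which contains the test functions of `U` and whose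
elements vanish on `A \ U`, for a set `A ⊇ U` on which the two geometric estimates used for
interpolation and compactness hold. The examples are `C_c^∞(U)` with `A = ℝ^d` and `C^∞(ℝ^d)` with
`A = U` for a bounded Lipschitz domain `U`. -/
structure IsTestSpace (T : Set (E d → ℝ)) (U : Opens (E d)) (A : Set (E d)) : Prop where
  subset_smoothFns : T ⊆ smoothFns d
  testFns_subset : testFns U ⊆ T
  add_mem {φ ψ : E d → ℝ} : φ ∈ T → ψ ∈ T → φ + ψ ∈ T
  smul_mem (c : ℝ) {φ : E d → ℝ} : φ ∈ T → c • φ ∈ T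
  measurableSet : MeasurableSet A
  subset : (U : Set (E d)) ⊆ A
  eq_zero {φ : E d → ℝ} : φ ∈ T → ∀ x ∈ A, x ∉ U → φ x = 0
  translationEstimate : TranslationEstimate volume T A A (U : Set (E d))
  interiorBallCondition : InteriorBallCondition (U : Set (E d)) A

lemma isTestSpace_testFns (U : Opens (E d)) : IsTestSpace (testFns U) U Set.univ where
  subset_smoothFns _ h := h.1
  testFns_subset := subset_rfl
  add_mem {φ ψ} hφ hψ := ⟨hφ.1.add hψ.1, hφ.2.1.add hψ.2.1,
    (tsupport_add φ ψ).trans (Set.union_subset hφ.2.2 hψ.2.2)⟩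
  smul_mem c φ hφ := ⟨contDiff_const.smul hφ.1, hφ.2.1.smul_left (f := fun _ => c),
    (tsupport_smul_subset_right (fun _ => c) φ).trans hφ.2.2⟩
  measurableSet := MeasurableSet.univ
  subset := Set.subset_univ _
  eq_zero hφ _ _ hx := image_eq_zero_of_notMem_tsupport fun h => hx (hφ.2.2 h)
  translationEstimate := translationEstimate_univ (fun _ hφ => hφ.1.of_le (by simp))
    U.isOpen.measurableSet fun _ hφ x hx => by
      by_contra hne
      exact hx (hφ.2.2 (support_fderiv_subset ℝ hne))
  interiorBallCondition := interiorBallCondition_univ _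

lemma isTestSpace_smoothFns (hU : Bornology.IsBounded (U : Set (E d)))
    (hL : IsLipschitzDomain (U : Set (E d))) : IsTestSpace (smoothFns d) U (U : Set (E d)) where
  subset_smoothFns := subset_rfl
  testFns_subset _ h := h.1
  add_mem {φ ψ} (hφ : ContDiff ℝ ∞ φ) (hψ : ContDiff ℝ ∞ ψ) := hφ.add hψ
  smul_mem _ φ (hφ : ContDiff ℝ ∞ φ) := contDiff_const.smul hφ
  measurableSet := U.isOpen.measurableSet
  subset := subset_rfl
  eq_zero _ _ hx hx' := absurd hx hx'
  translationEstimate := (hL.localConeCondition U.isOpen).translationEstimate U.isOpen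
    hU.isCompact_closure fun φ (hφ : ContDiff ℝ ∞ φ) => hφ.of_le (by simp)
  interiorBallCondition := (hL.localConeCondition U.isOpen).interiorBallCondition
    hU.isCompact_closure

end H1Approximation

namespace IsTestSpace

variable {d : ℕ} {T : Set (E d → ℝ)} {U : Opens (E d)} {A : Set (E d)} {s : ℝ}
  (hT : IsTestSpace T U A)
include hT

lemma differentiable {φ : E d → ℝ} (hφ : φ ∈ T) : Differentiable ℝ φ :=
  (show ContDiff ℝ ∞ φ from hT.subset_smoothFns hφ).differentiable (by simp)

lemma continuous {φ : E d → ℝ} (hφ : φ ∈ T) : Continuous φ := (hT.differentiable hφ).continuous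

lemma zero_mem : 0 ∈ T := by
  refine hT.testFns_subset ⟨contDiff_const, HasCompactSupport.zero, ?_⟩
  simp [tsupport, show Function.support (0 : E d → ℝ) = ∅ from Function.support_zero]

lemma span_gradPairs_subset : (Submodule.span ℝ (gradPairs T U) : Set _) ⊆ gradPairs T U := by
  intro p hp
  induction hp using Submodule.span_induction with
  | mem _ hp => exact hp
  | zero =>
    refine ⟨0, hT.zero_mem, Lp.coeFn_zero _ _ _, (Lp.coeFn_zero _ _ _).trans ?_⟩
    exact Eventually.of_forall fun x => (gradient_fun_const x (0 : ℝ)).symm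
  | add p q _ _ hp hq =>
    obtain ⟨φ, hφ, hpφ, hpφ'⟩ := hp
    obtain ⟨ψ, hψ, hqψ, hqψ'⟩ := hq
    refine ⟨φ + ψ, hT.add_mem hφ hψ, (Lp.coeFn_add _ _).trans (hpφ.add hqψ),
      (Lp.coeFn_add _ _).trans ((hpφ'.add hqψ').trans (Eventually.of_forall fun x => ?_))⟩
    simp only [gradient, Pi.add_apply,
      fderiv_add (hT.differentiable hφ x) (hT.differentiable hψ x), map_add]
  | smul c p _ hp =>
    obtain ⟨φ, hφ, hpφ, hpφ'⟩ := hp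
    refine ⟨c • φ, hT.smul_mem c hφ, (Lp.coeFn_smul _ _).trans (hpφ.const_smul c),
      (Lp.coeFn_smul _ _).trans ((hpφ'.const_smul c).trans (Eventually.of_forall fun x => ?_))⟩
    simp [gradient, fderiv_const_smul (hT.differentiable hφ x)]

lemma mem_closure_gradPairs {p : L2 U × L2Vec U} (hp : p ∈ H1Graph T U) :
    p ∈ closure (gradPairs T U) :=
  closure_mono hT.span_gradPairs_subset hp

lemma indicator_ae_eq {φ f : E d → ℝ} (hφ : φ ∈ T) (h : f =ᵐ[volume.restrict (U : Set (E d))] φ) :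
    (U : Set (E d)).indicator f =ᵐ[volume.restrict A] φ := by
  refine (indicator_ae_eq_indicator h).trans ?_
  filter_upwards [ae_restrict_mem hT.measurableSet] with x hxA
  by_cases hx : x ∈ (U : Set (E d))
  · rw [Set.indicator_of_mem hx]
  · rw [Set.indicator_of_notMem hx, hT.eq_zero hφ x hxA hx]

lemma enorm_fst_sq_eq {φ : E d → ℝ} (hφ : φ ∈ T) {u : L2 U}
    (h : u =ᵐ[volume.restrict (U : Set (E d))] φ) : ‖u‖ₑ ^ 2 = ∫⁻ x in A, ‖φ x‖ₑ ^ 2 := by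
  rw [← eLpNorm_indicator_coeFn hT.subset, eLpNorm_congr_ae (hT.indicator_ae_eq hφ h),
    eLpNorm_two_sq]

lemma exists_eLpNorm_sloboQuot_sq_le (hd : 1 ≤ d) (hs0 : 0 ≤ s) (hs1 : s < 1) {ε : NNReal}
    (hε : ε ≠ 0) : ∃ C : NNReal, ∀ p ∈ H1Graph T U,
      eLpNorm (sloboQuot s ((U : Set (E d)).indicator p.1)) 2 (sqMeasure A) ^ 2 ≤
        ε * ‖p.2‖ₑ ^ 2 + C * ‖p.1‖ₑ ^ 2 := by
  obtain ⟨C, hC, hbound⟩ := hT.translationEstimate.eLpNorm_sloboQuot_sq_le hT.measurableSet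
    (fun φ hφ => (hT.continuous hφ).measurable) hd hs0 hs1 (ENNReal.coe_ne_zero.2 hε)
  lift C to NNReal using hC
  refine ⟨C, fun p hp => ?_⟩
  obtain ⟨q, hq, hqp, hae⟩ := exists_seq_tendsto_ae_of_mem_closure (hT.mem_closure_gradPairs hp)
  have hq_le (k : ℕ) : eLpNorm (sloboQuot s ((U : Set (E d)).indicator (q k).1)) 2
      (sqMeasure A) ^ 2 ≤ ε * ‖(q k).2‖ₑ ^ 2 + C * ‖(q k).1‖ₑ ^ 2 := by
    obtain ⟨φ, hφ, hqφ, hqφ'⟩ := hq k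
    rw [eLpNorm_congr_ae (sloboQuot_congr (hT.indicator_ae_eq hφ hqφ)),
      hT.enorm_fst_sq_eq hφ hqφ, Lp.enorm_def, eLpNorm_congr_ae hqφ',
      eLpNorm_two_sq _ (gradient φ)]
    simpa only [enorm_gradient] using hbound φ hφ
  have hlim : Tendsto (fun k => (ε : ℝ≥0∞) * ‖(q k).2‖ₑ ^ 2 + C * ‖(q k).1‖ₑ ^ 2) atTop
      (𝓝 (ε * ‖p.2‖ₑ ^ 2 + C * ‖p.1‖ₑ ^ 2)) := by
    have hcont : Continuous fun p : L2 U × L2Vec U =>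
        (ε : ℝ≥0∞) * ‖p.2‖ₑ ^ 2 + C * ‖p.1‖ₑ ^ 2 := by
      fun_prop (disch := simp)
    exact (hcont.tendsto p).comp hqp
  refine eLpNorm_sq_le_of_tendsto_ae
    (fun k => aestronglyMeasurable_sloboQuot (aestronglyMeasurable_indicator_coeFn _))
    (tendsto_sloboQuot (tendsto_indicator_ae hae)) hq_le hlim

lemma memLp_sloboQuot (hd : 1 ≤ d) (hs0 : 0 ≤ s) (hs1 : s < 1) {p : L2 U × L2Vec U}
    (hp : p ∈ H1Graph T U) :
    MemLp (sloboQuot s ((U : Set (E d)).indicator p.1)) 2 (sqMeasure A) := by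
  obtain ⟨C, hC⟩ := hT.exists_eLpNorm_sloboQuot_sq_le hd hs0 hs1 one_ne_zero
  refine ⟨aestronglyMeasurable_sloboQuot (aestronglyMeasurable_indicator_coeFn _), ?_⟩
  refine (ENNReal.pow_lt_top_iff.1 ?_).resolve_right two_ne_zero
  refine (hC p hp).trans_lt (ENNReal.add_lt_top.2 ⟨?_, ?_⟩) <;>
    exact ENNReal.mul_lt_top ENNReal.coe_lt_top (ENNReal.pow_lt_top enorm_lt_top)

lemma tendsto_eLpNorm_sloboQuot_sub (hd : 1 ≤ d) (hs0 : 0 ≤ s) (hs1 : s < 1)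
    {q : ℕ → L2 U × L2Vec U} {p : L2 U × L2Vec U} (hq : ∀ k, q k ∈ H1Graph T U)
    (hp : p ∈ H1Graph T U) (hqp : Tendsto q atTop (𝓝 p)) :
    Tendsto (fun k => eLpNorm (sloboQuot s ((U : Set (E d)).indicator (q k).1) -
      sloboQuot s ((U : Set (E d)).indicator p.1)) 2 (sqMeasure A)) atTop (𝓝 0) := by
  obtain ⟨C, hC⟩ := hT.exists_eLpNorm_sloboQuot_sq_le hd hs0 hs1 one_ne_zero
  have hbound (k : ℕ) : eLpNorm (sloboQuot s ((U : Set (E d)).indicator (q k).1) -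
      sloboQuot s ((U : Set (E d)).indicator p.1)) 2 (sqMeasure A) ^ 2 ≤
        (1 : NNReal) * ‖(q k - p).2‖ₑ ^ 2 + C * ‖(q k - p).1‖ₑ ^ 2 := by
    refine le_of_eq_of_le ?_ (hC _ (sub_mem (hq k) hp))
    rw [← sloboQuot_sub, ← Set.indicator_sub']
    exact congrArg (· ^ 2) (eLpNorm_congr_ae (sloboQuot_congr
      (indicator_ae_eq_indicator (Lp.coeFn_sub (q k).1 p.1).symm)))
  have hlim : Tendsto (fun k => ((1 : NNReal) : ℝ≥0∞) * ‖(q k - p).2‖ₑ ^ 2 +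
      C * ‖(q k - p).1‖ₑ ^ 2) atTop (𝓝 0) := by
    have hcont : Continuous fun r : L2 U × L2Vec U =>
        ((1 : NNReal) : ℝ≥0∞) * ‖(r - p).2‖ₑ ^ 2 + C * ‖(r - p).1‖ₑ ^ 2 := by
      fun_prop (disch := simp)
    simpa [Function.comp_def] using (hcont.tendsto p).comp hqp
  have hsq := tendsto_of_tendsto_of_tendsto_of_le_of_le tendsto_const_nhds hlim
    (fun _ => zero_le) hbound
  simpa only [Function.comp_def, Pi.zero_apply, ENNReal.pow_rpow_inv_natCast two_ne_zero,
    ENNReal.zero_rpow_of_pos, inv_pos, Nat.cast_pos, two_pos] using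
    ((ENNReal.continuous_rpow_const (y := ((2 : ℕ) : ℝ)⁻¹)).tendsto 0).comp hsq

lemma fst_mem_map_HsGraph (hd : 1 ≤ d) (hs0 : 0 ≤ s) (hs1 : s < 1) {p : L2 U × L2Vec U}
    (hp : p ∈ H1Graph T U) : p.1 ∈ (HsGraph s T U A).map (LinearMap.fst ℝ _ _) := by
  obtain ⟨q, hq, hqp⟩ := mem_closure_iff_seq_limit.1 (hT.mem_closure_gradPairs hp)
  have hqmem (k : ℕ) : q k ∈ H1Graph T U := gradPairs_subset_H1Graph (hq k)
  have hmem {r : L2 U × L2Vec U} (hr : r ∈ H1Graph T U) := hT.memLp_sloboQuot hd hs0 hs1 hr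
  refine Submodule.mem_map.2 ⟨(p.1, (hmem hp).toLp _), ?_, rfl⟩
  refine mem_closure_of_tendsto (b := atTop) (f := fun k => ((q k).1, (hmem (hqmem k)).toLp _))
    (hqp.fst_nhds.prodMk_nhds ?_) (Eventually.of_forall fun k => ?_)
  · rw [Lp.tendsto_Lp_iff_tendsto_eLpNorm'']
    exact hT.tendsto_eLpNorm_sloboQuot_sub hd hs0 hs1 hqmem hp hqp
  · obtain ⟨φ, hφ, hqφ, -⟩ := hq k
    exact Submodule.subset_span ⟨φ, hφ, hqφ,
      (hmem (hqmem k)).coeFn_toLp.trans (sloboQuot_congr (hT.indicator_ae_eq hφ hqφ))⟩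

lemma isIntermediateSpace (hd : 1 ≤ d) (hs0 : 0 ≤ s) (hs1 : s < 1) :
    IsIntermediateSpace T ((HsGraph s T U A).map (LinearMap.fst ℝ _ _)) (extNorm s U A) where
  map_smul := extNorm_smul
  eq_zero := extNorm_eq_zero hT.subset
  inclL_mem p := hT.fst_mem_map_HsGraph hd hs0 hs1 (H1Space.mk_mem_H1Graph p)
  interpolation {ε} hε := by
    lift ε to NNReal using hε.le
    obtain ⟨C, hC⟩ := hT.exists_eLpNorm_sloboQuot_sq_le hd hs0 hs1 (ε := ε / 2)
      (half_pos (NNReal.coe_pos.1 hε)).ne'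
    refine ⟨2 + 2 * C, by positivity, fun p => ?_⟩
    have hp := hC _ (H1Space.mk_mem_H1Graph p)
    rw [extNorm, sobNorm, eLpNorm_indicator_coeFn hT.subset]
    calc (‖H1Space.inclL T U p‖ₑ + eLpNorm (sloboQuot s _) 2 (sqMeasure A)) ^ 2
        ≤ 2 * (‖H1Space.inclL T U p‖ₑ ^ 2 + eLpNorm (sloboQuot s _) 2 (sqMeasure A) ^ 2) :=
          ennreal_add_sq_le _ _
      _ ≤ 2 * (‖H1Space.inclL T U p‖ₑ ^ 2 +
          ((ε / 2 : NNReal) * ‖H1Space.gradL T U p‖ₑ ^ 2 +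
            C * ‖H1Space.inclL T U p‖ₑ ^ 2)) := by gcongr
      _ = ENNReal.ofReal _ := by
        simp only [enorm]
        norm_cast
        rw [← ENNReal.ofReal_coe_nnreal]
        congr 1
        push_cast
        ring

end IsTestSpace

/-! ### Rellich compactness -/

section MeanOscillation

lemma enorm_sq_le_laverage_add_enorm_average_sq {α F : Type*} [MeasurableSpace α] {μ : Measure α}
    [IsFiniteMeasure μ] [NeZero μ] [NormedAddCommGroup F] [NormedSpace ℝ F] [CompleteSpace F]
    {f : α → F} (hf : Integrable f μ) (c : F) :
    ‖c‖ₑ ^ 2 ≤ 2 * (⨍⁻ x, ‖f x - c‖ₑ ^ 2 ∂μ + ‖⨍ x, f x ∂μ‖ₑ ^ 2) := by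
  have hμ : IsProbabilityMeasure ((μ Set.univ)⁻¹ • μ) := isProbabilityMeasureSMul
  have hf' : Integrable f ((μ Set.univ)⁻¹ • μ) := hf.to_average
  have hmean : ‖∫ x, (f x - c) ∂((μ Set.univ)⁻¹ • μ)‖ₑ ^ 2 ≤
      ∫⁻ x, ‖f x - c‖ₑ ^ 2 ∂((μ Set.univ)⁻¹ • μ) := by
    refine (pow_le_pow_left' (enorm_integral_le_lintegral_enorm _) 2).trans ?_
    simpa only [measure_univ, one_mul, Pi.sub_apply] using
      lintegral_sq_le (hf'.sub (integrable_const c)).aestronglyMeasurable.enorm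
  rw [laverage_eq', average_eq']
  calc ‖c‖ₑ ^ 2
      = ‖(∫ x, f x ∂((μ Set.univ)⁻¹ • μ)) - ∫ x, (f x - c) ∂((μ Set.univ)⁻¹ • μ)‖ₑ ^ 2 := by
        rw [integral_sub hf' (integrable_const c), integral_const, probReal_univ, one_smul,
          sub_sub_cancel]
    _ ≤ _ := (enorm_sub_sq_le _ _).trans (by rw [add_comm]; gcongr)

lemma enorm_sq_le_setLIntegral_sub_add {α F : Type*} [MeasurableSpace α] {μ : Measure α}
    [NormedAddCommGroup F] [NormedSpace ℝ F] [CompleteSpace F] {f : α → F} {B B' : Set α}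
    (hf : IntegrableOn f B μ) (hB : μ B ≠ ⊤) (hBB' : B ⊆ B') {v : ℝ≥0∞} (hv : v ≠ 0)
    (hvB : v ≤ μ B) (c : F) :
    ‖c‖ₑ ^ 2 ≤ 2 * (v⁻¹ * ∫⁻ x in B', ‖f x - c‖ₑ ^ 2 ∂μ +
      v⁻¹ ^ 2 * ‖∫ x in B, f x ∂μ‖ₑ ^ 2) := by
  have hB₀ : μ B ≠ 0 := fun h => hv (le_zero_iff.1 (h ▸ hvB))
  have : Fact (μ B < ⊤) := ⟨hB.lt_top⟩
  have : NeZero (μ.restrict B) := ⟨fun h => hB₀ (Measure.restrict_eq_zero.1 h)⟩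
  refine (enorm_sq_le_laverage_add_enorm_average_sq hf c).trans ?_
  rw [setLAverage_eq, setAverage_eq, enorm_smul, mul_pow, ENNReal.div_eq_inv_mul,
    enorm_inv ((measureReal_ne_zero_iff hB).2 hB₀), Real.enorm_of_nonneg measureReal_nonneg,
    ofReal_measureReal]
  gcongr

end MeanOscillation

section Rellich

variable {V F : Type*} [NormedAddCommGroup V] [MeasurableSpace V] [BorelSpace V] {μ : Measure V}
  [NormedAddCommGroup F] {U A : Set V} {φ : V → F}

lemma setLIntegral_ball_inter_sub_sq_le [SecondCountableTopology V] [SFinite μ]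
    [μ.IsAddLeftInvariant] (hA : MeasurableSet A) (hφ : Continuous φ) {r : ℝ} {D : ℝ≥0∞}
    (hD : ∀ h, ‖h‖ < r → ∫⁻ x in {x | x ∈ A ∧ x + h ∈ A}, ‖φ (x + h) - φ x‖ₑ ^ 2 ∂μ ≤ D) :
    ∫⁻ x in A, ∫⁻ y in Metric.ball x r ∩ A, ‖φ y - φ x‖ₑ ^ 2 ∂μ ∂μ ≤
      D * μ (Metric.ball 0 r) := by
  have hball (x : V) : MeasurableSet (Metric.ball x r) := Metric.isOpen_ball.measurableSet
  let k : V → ℝ≥0∞ := (Metric.ball 0 r).indicator 1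
  have hk (x y : V) : (Metric.ball x r).indicator (fun y => ‖φ y - φ x‖ₑ ^ 2) y =
      k (y - x) * ‖φ y - φ x‖ₑ ^ 2 := by
    by_cases h : dist y x < r
    · simp [k, Set.indicator, h, ← dist_eq_norm]
    · simp [k, Set.indicator, h, ← dist_eq_norm]
  calc ∫⁻ x in A, ∫⁻ y in Metric.ball x r ∩ A, ‖φ y - φ x‖ₑ ^ 2 ∂μ ∂μ
      = ∫⁻ x in A, ∫⁻ y in A, k (y - x) * ‖φ y - φ x‖ₑ ^ 2 ∂μ ∂μ := by
        simp only [← hk, lintegral_indicator (hball _), Measure.restrict_restrict (hball _)]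
    _ = ∫⁻ h, k h * ∫⁻ x in {x | x ∈ A ∧ x + h ∈ A}, ‖φ (x + h) - φ x‖ₑ ^ 2 ∂μ ∂μ :=
        lintegral_lintegral_sub hA (measurable_one.indicator (hball 0))
          (G := fun q => ‖φ q.2 - φ q.1‖ₑ ^ 2) (Continuous.measurable (by fun_prop))
    _ ≤ ∫⁻ h, (Metric.ball 0 r).indicator (fun _ => D) h ∂μ := by
        refine lintegral_mono fun h => ?_
        by_cases hh : ‖h‖ < r
        · simpa [k, Set.indicator, hh] using hD h hh
        · simp [k, Set.indicator, hh]
    _ = D * μ (Metric.ball 0 r) := by rw [lintegral_indicator (hball 0), setLIntegral_const]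

variable [NormedSpace ℝ V] [FiniteDimensional ℝ V] [μ.IsAddHaarMeasure] [NormedSpace ℝ F]
  [CompleteSpace F]

lemma setLIntegral_sq_le_sum_of_cover (hA : MeasurableSet A) (hU : MeasurableSet U) (hUA : U ⊆ A)
    (hφ : Continuous φ) {ρ σ : ℝ} (hσ : 0 < σ) {t : Finset V} (ht : ∀ x ∈ U, ∃ c ∈ t, dist x c < ρ)
    (hball : ∀ x ∈ U, ∃ z, Metric.ball z σ ⊆ Metric.ball x ρ ∩ A) {D : ℝ≥0∞}
    (hD : ∀ h, ‖h‖ < 3 * ρ → ∫⁻ x in {x | x ∈ A ∧ x + h ∈ A}, ‖φ (x + h) - φ x‖ₑ ^ 2 ∂μ ≤ D) :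
    ∫⁻ x in U, ‖φ x‖ₑ ^ 2 ∂μ ≤
      2 * ((μ (Metric.ball 0 σ))⁻¹ * μ (Metric.ball 0 (3 * ρ))) * D +
        2 * ((μ (Metric.ball 0 σ))⁻¹ ^ 2 * μ U) *
          ∑ c ∈ t, ‖∫ y in Metric.ball c (2 * ρ) ∩ A, φ y ∂μ‖ₑ ^ 2 := by
  set v := μ (Metric.ball (0 : V) σ)
  have hv : v ≠ 0 := (Metric.measure_ball_pos μ 0 hσ).ne'
  have hpointwise (x : V) (hx : x ∈ U) : ‖φ x‖ₑ ^ 2 ≤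
      2 * (v⁻¹ * ∫⁻ y in Metric.ball x (3 * ρ) ∩ A, ‖φ y - φ x‖ₑ ^ 2 ∂μ +
        v⁻¹ ^ 2 * ∑ c ∈ t, ‖∫ y in Metric.ball c (2 * ρ) ∩ A, φ y ∂μ‖ₑ ^ 2) := by
    obtain ⟨c, hct, hc⟩ := ht x hx
    obtain ⟨z, hz⟩ := hball x hx
    have hsub : Metric.ball c (2 * ρ) ⊆ Metric.ball x (3 * ρ) :=
      Metric.ball_subset_ball' (by rw [dist_comm]; linarith)
    have hvB : v ≤ μ (Metric.ball c (2 * ρ) ∩ A) :=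
      (Measure.addHaar_ball_center μ z σ).symm.trans_le <| measure_mono <|
        hz.trans (Set.inter_subset_inter_left _ (Metric.ball_subset_ball' (by linarith)))
    have hint : IntegrableOn φ (Metric.ball c (2 * ρ) ∩ A) μ :=
      (hφ.locallyIntegrable.integrableOn_isCompact (isCompact_closedBall c (2 * ρ))).mono_set
        (Set.inter_subset_left.trans Metric.ball_subset_closedBall)
    refine (enorm_sq_le_setLIntegral_sub_add hint
      (measure_ne_top_of_subset Set.inter_subset_left measure_ball_lt_top.ne)
      (Set.inter_subset_inter_left A hsub) hv hvB (φ x)).trans ?_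
    gcongr
    exact Finset.single_le_sum (f := fun c => ‖∫ y in Metric.ball c (2 * ρ) ∩ A, φ y ∂μ‖ₑ ^ 2)
      (fun _ _ => zero_le) hct
  refine (setLIntegral_mono' hU hpointwise).trans ?_
  rw [lintegral_const_mul' _ _ (by simp), lintegral_add_right _ measurable_const,
    lintegral_const_mul' _ _ (ENNReal.inv_ne_top.2 hv), setLIntegral_const, mul_add]
  refine add_le_add ?_ (le_of_eq (by ring))
  rw [mul_assoc, mul_assoc, mul_comm (μ _)]
  gcongr
  exact (lintegral_mono_set hUA).trans (setLIntegral_ball_inter_sub_sq_le hA hφ hD)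

lemma inv_measure_ball_mul_measure_ball_mul {r ρ : ℝ} (hr : 0 < r) (hρ : 0 < ρ) :
    (μ (Metric.ball 0 ρ))⁻¹ * μ (Metric.ball 0 (r * ρ)) =
      ENNReal.ofReal (r ^ Module.finrank ℝ V) := by
  rw [Measure.addHaar_ball_mul_of_pos μ _ hr, mul_left_comm, ENNReal.inv_mul_cancel
    (Metric.measure_ball_pos μ 0 hρ).ne' measure_ball_lt_top.ne, mul_one]

lemma exists_inv_measure_ball_mul_le (μ : Measure V) [μ.IsAddHaarMeasure] {κ δ : ℝ} (hκ : 0 < κ)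
    (hδ : 0 < δ) (K : NNReal) {ε : ℝ≥0∞} (hε : ε ≠ 0) :
    ∃ ρ, 0 < ρ ∧ 3 * ρ < δ ∧ 2 * ((μ (Metric.ball 0 (κ * ρ)))⁻¹ * μ (Metric.ball 0 (3 * ρ))) *
      (K * ENNReal.ofReal (3 * ρ) ^ 2) ≤ ε := by
  have hcont : Continuous fun ρ : ℝ => 2 * ENNReal.ofReal ((3 / κ) ^ Module.finrank ℝ V) *
      (K * ENNReal.ofReal (3 * ρ) ^ 2) :=
    (ENNReal.continuous_const_mul (by finiteness)).comp <|
      (ENNReal.continuous_const_mul ENNReal.coe_ne_top).comp <|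
        (ENNReal.continuous_pow 2).comp (ENNReal.continuous_ofReal.comp (continuous_const_mul 3))
  have hlim := hcont.tendsto 0
  simp only [mul_zero, ENNReal.ofReal_zero, ne_eq, OfNat.ofNat_ne_zero, not_false_eq_true,
    zero_pow] at hlim
  have hsmall := hlim.eventually_le_const (pos_iff_ne_zero.2 hε)
  have hδ' : ∀ᶠ ρ : ℝ in 𝓝 0, ρ < δ / 3 := eventually_lt_nhds (by positivity)
  obtain ⟨ρ, ⟨hρε, hρδ⟩, hρ⟩ := ((hsmall.and hδ').filter_mono nhdsWithin_le_nhds |>.and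
    (self_mem_nhdsWithin (s := Set.Ioi 0))).exists
  have hscale : 3 * ρ = 3 / κ * (κ * ρ) := by field_simp
  refine ⟨ρ, hρ, by linarith, ?_⟩
  rwa [congrArg (fun r => μ (Metric.ball 0 r)) hscale,
    inv_measure_ball_mul_measure_ball_mul (div_pos three_pos hκ) (mul_pos hκ hρ)]

lemma TranslationEstimate.exists_setLIntegral_sq_le {T : Set (V → F)}
    (hT : TranslationEstimate μ T A A U) (hcont : ∀ φ ∈ T, Continuous φ)
    (hB : InteriorBallCondition U A) (hA : MeasurableSet A) (hU : MeasurableSet U) (hUA : U ⊆ A)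
    (hbdd : Bornology.IsBounded U) {ε : ℝ≥0∞} (hε : ε ≠ 0) :
    ∃ (t : Finset V) (r : ℝ) (C : NNReal), ∀ φ ∈ T, ∫⁻ x in U, ‖φ x‖ₑ ^ 2 ∂μ ≤
      ε * ∫⁻ x in U, ‖fderiv ℝ φ x‖ₑ ^ 2 ∂μ +
        C * ∑ c ∈ t, ‖∫ y in Metric.ball c r ∩ A, φ y ∂μ‖ₑ ^ 2 := by
  obtain ⟨K, δ, hδ, hK⟩ := hT
  obtain ⟨κ, hκ, δ', hδ', hball⟩ := hB
  obtain ⟨ρ, hρ, hρδ, hρε⟩ := exists_inv_measure_ball_mul_le μ hκ (lt_min hδ hδ') K hε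
  obtain ⟨t, -, htfin, ht⟩ := Metric.finite_approx_of_totallyBounded
    (hbdd.isCompact_closure.totallyBounded.subset subset_closure) ρ hρ
  have hC : 2 * ((μ (Metric.ball 0 (κ * ρ)))⁻¹ ^ 2 * μ U) ≠ ⊤ := by
    have hv := (Metric.measure_ball_pos μ (0 : V) (mul_pos hκ hρ)).ne'
    finiteness [hbdd.measure_lt_top (μ := μ)]
  refine ⟨htfin.toFinset, 2 * ρ, (2 * ((μ (Metric.ball 0 (κ * ρ)))⁻¹ ^ 2 * μ U)).toNNReal,
    fun φ hφ => ?_⟩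
  rw [ENNReal.coe_toNNReal hC]
  have hD (h : V) (hh : ‖h‖ < 3 * ρ) :
      ∫⁻ x in {x | x ∈ A ∧ x + h ∈ A}, ‖φ (x + h) - φ x‖ₑ ^ 2 ∂μ ≤
        K * ENNReal.ofReal (3 * ρ) ^ 2 * ∫⁻ x in U, ‖fderiv ℝ φ x‖ₑ ^ 2 ∂μ := by
    refine (hK φ hφ h (hh.trans (hρδ.trans_le (min_le_left _ _)))).trans ?_
    gcongr
    exact (ofReal_norm h).symm.trans_le (ENNReal.ofReal_le_ofReal hh.le)
  have hcover (x : V) (hx : x ∈ U) : ∃ c ∈ htfin.toFinset, dist x c < ρ := by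
    simpa only [Set.Finite.mem_toFinset, Set.mem_iUnion₂, Metric.mem_ball, exists_prop] using ht hx
  refine (setLIntegral_sq_le_sum_of_cover hA hU hUA (hcont φ hφ) (mul_pos hκ hρ) hcover
    (fun x hx => hball x hx ρ hρ (by linarith [min_le_right δ δ'])) hD).trans ?_
  rw [← mul_assoc]
  gcongr

end Rellich

namespace IsTestSpace

variable {d : ℕ} {T : Set (E d → ℝ)} {U : Opens (E d)} {A : Set (E d)}
  (hT : IsTestSpace T U A)
include hT

lemma setIntegral_coeFn_eq {φ : E d → ℝ} (hφ : φ ∈ T) {u : L2 U}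
    (h : u =ᵐ[volume.restrict (U : Set (E d))] φ) {B : Set (E d)} (hB : MeasurableSet B)
    (hBA : B ⊆ A) : ∫ x in B, u x ∂(volume.restrict (U : Set (E d))) = ∫ x in B, φ x := by
  rw [Measure.restrict_restrict hB, ← setIntegral_indicator U.isOpen.measurableSet]
  exact integral_congr_ae
    (ae_restrict_of_ae_restrict_of_subset hBA (hT.indicator_ae_eq hφ h))

lemma exists_enorm_fst_sq_le_of_mem_gradPairs (hU : Bornology.IsBounded (U : Set (E d)))
    {ε : ℝ≥0∞} (hε : ε ≠ 0) :
    ∃ (t : Finset (E d)) (ψ : E d → L2 U) (C : NNReal), ∀ p ∈ gradPairs T U,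
      ‖p.1‖ₑ ^ 2 ≤ ε * ‖p.2‖ₑ ^ 2 + C * ∑ c ∈ t, ‖inner ℝ (ψ c) p.1‖ₑ ^ 2 := by
  obtain ⟨t, r, C, hC⟩ := hT.translationEstimate.exists_setLIntegral_sq_le
    (fun φ hφ => hT.continuous hφ) hT.interiorBallCondition hT.measurableSet
    U.isOpen.measurableSet hT.subset hU hε
  have hmeas (c : E d) : MeasurableSet (Metric.ball c r ∩ A) :=
    Metric.isOpen_ball.measurableSet.inter hT.measurableSet
  have hfin (c : E d) : volume.restrict (U : Set (E d)) (Metric.ball c r ∩ A) ≠ ⊤ :=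
    ((Measure.restrict_apply_le _ _).trans_lt
      (Metric.isBounded_ball.subset Set.inter_subset_left).measure_lt_top).ne
  refine ⟨t, fun c => indicatorConstLp 2 (hmeas c) (hfin c) 1, C, ?_⟩
  rintro p ⟨φ, hφ, hpφ, hpφ'⟩
  simp only [L2.inner_indicatorConstLp_one,
    hT.setIntegral_coeFn_eq hφ hpφ (hmeas _) Set.inter_subset_right]
  rw [Lp.enorm_def, Lp.enorm_def, eLpNorm_congr_ae hpφ, eLpNorm_congr_ae hpφ',
    eLpNorm_two_sq _ φ, eLpNorm_two_sq _ (gradient φ)]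
  simpa only [enorm_gradient] using hC φ hφ

lemma exists_norm_fst_sq_le (hU : Bornology.IsBounded (U : Set (E d))) {ε : ℝ} (hε : 0 < ε) :
    ∃ (ι : Type) (_ : Fintype ι) (f : ι → StrongDual ℝ (L2 U)), ∀ p ∈ H1Graph T U,
      ‖p.1‖ ^ 2 ≤ ε * ‖p.2‖ ^ 2 + ∑ i, f i p.1 ^ 2 := by
  lift ε to NNReal using hε.le
  obtain ⟨t, ψ, C, hC⟩ := hT.exists_enorm_fst_sq_le_of_mem_gradPairs hU
    (ENNReal.coe_ne_zero.2 (NNReal.coe_pos.1 hε).ne')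
  refine ⟨t, inferInstance, fun c => √C • innerSL ℝ (ψ c), fun p hp => ?_⟩
  have hclosed : IsClosed {p : L2 U × L2Vec U |
      ‖p.1‖ ^ 2 ≤ ε * ‖p.2‖ ^ 2 + ∑ c : t, (√C • innerSL ℝ (ψ c)) p.1 ^ 2} :=
    isClosed_le (by fun_prop) (by fun_prop)
  refine hclosed.closure_subset_iff.2 (fun q hq => ?_) (hT.mem_closure_gradPairs hp)
  have hq' := hC q hq
  simp only [enorm] at hq'
  norm_cast at hq'
  have hq'' := NNReal.coe_le_coe.2 hq'
  push_cast at hq''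
  simpa [mul_pow, Real.sq_sqrt, ← Finset.mul_sum,
    Finset.sum_attach t fun c => inner ℝ (ψ c) q.1 ^ 2] using hq''

theorem isCompactOperator_inclL (hU : Bornology.IsBounded (U : Set (E d))) :
    IsCompactOperator (H1Space.inclL T U) := by
  refine isCompactOperator_of_norm_sq_le fun ε hε => ?_
  obtain ⟨ι, _, f, hf⟩ := hT.exists_norm_fst_sq_le hU hε
  refine ⟨ι, inferInstance, fun i => f i ∘L H1Space.inclL T U, fun p => ?_⟩
  refine (hf _ (H1Space.mk_mem_H1Graph p)).trans (add_le_add ?_ le_rfl)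
  rw [H1Space.norm_sq_eq]
  gcongr
  exact le_add_of_nonneg_left (sq_nonneg _)

lemma exists_inclL_ae_eq {ψ : E d → ℝ} (hψ : ψ ∈ testFns U) :
    ∃ p, H1Space.inclL T U p =ᵐ[volume.restrict (U : Set (E d))] ψ := by
  obtain ⟨hsmooth, hcompact, -⟩ := id hψ
  have hgrad_cont : Continuous (gradient ψ) :=
    (InnerProductSpace.toDual ℝ (E d)).symm.continuous.comp (hsmooth.continuous_fderiv (by simp))
  have hgrad_compact : HasCompactSupport (gradient ψ) :=
    (hcompact.fderiv (𝕜 := ℝ)).comp_left (map_zero (InnerProductSpace.toDual ℝ (E d)).symm)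
  have hψL : MemLp ψ 2 (volume.restrict (U : Set (E d))) :=
    hsmooth.continuous.memLp_of_hasCompactSupport hcompact
  have hgradL : MemLp (gradient ψ) 2 (volume.restrict (U : Set (E d))) :=
    hgrad_cont.memLp_of_hasCompactSupport hgrad_compact
  obtain ⟨p, hp, -⟩ := H1Space.exists_of_mem_H1Graph (T := T) (p := (hψL.toLp, hgradL.toLp))
    (gradPairs_subset_H1Graph ⟨ψ, hT.testFns_subset hψ, hψL.coeFn_toLp, hgradL.coeFn_toLp⟩)
  exact ⟨p, hp ▸ hψL.coeFn_toLp⟩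

lemma denseRange_inclL : DenseRange (H1Space.inclL T U) := by
  change Dense ((H1Space.inclL T U).range : Set (L2 U))
  rw [Submodule.dense_iff_topologicalClosure_eq_top, Submodule.topologicalClosure_eq_top_iff,
    Submodule.eq_bot_iff]
  intro u hu
  have hloc : LocallyIntegrableOn u (U : Set (E d)) volume :=
    (locallyIntegrableOn_iff U.isOpen.isLocallyClosed).2 fun k hk hkc => by
      have : IsFiniteMeasure (volume.restrict k) := ⟨by simpa using hkc.measure_lt_top⟩
      exact ((Lp.memLp u).mono_measure (Measure.restrict_mono hk le_rfl)).integrable one_le_two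
  rw [Lp.eq_zero_iff_ae_eq_zero]
  refine (ae_restrict_iff' U.isOpen.measurableSet).2
    (U.isOpen.ae_eq_zero_of_integral_contDiff_smul_eq_zero hloc fun ψ hψ hψc hψU => ?_)
  obtain ⟨p, hp⟩ := hT.exists_inclL_ae_eq ⟨hψ, hψc, hψU⟩
  have hψ₀ (x : E d) (hx : x ∉ (U : Set (E d))) : ψ x • u x = 0 := by
    rw [image_eq_zero_of_notMem_tsupport fun h => hx (hψU h), zero_smul]
  rw [← setIntegral_eq_integral_of_forall_compl_eq_zero hψ₀,
    ← (Submodule.mem_orthogonal _ _).1 hu _ ⟨p, rfl⟩, L2.inner_def]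
  refine integral_congr_ae ?_
  filter_upwards [hp] with x hx
  change ψ x * u x = u x * H1Space.inclL T U p x
  rw [hx, mul_comm]

end IsTestSpace

namespace IsTestSpace

variable {d : ℕ} {T : Set (E d → ℝ)} {U : Opens (E d)} {A : Set (E d)}
  {V : Submodule ℝ (L2 U)} {N : L2 U → ℝ≥0∞}

theorem convergesCompactly_expForm (hT : IsTestSpace T U A)
    (hU : Bornology.IsBounded (U : Set (E d))) (hV : IsIntermediateSpace T V N)
    {Wn : ℕ → E d → ℝ} {W : E d → ℝ} (hWn : ∀ n, ContinuousOn (Wn n) (closure U))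
    (hW : ContinuousOn W (closure U)) (hWconv : TendstoUniformlyOn Wn W atTop (closure U))
    (Zn : ℕ → BoundedSymmForm V N) (Z : BoundedSymmForm V N)
    (hZ : Tendsto (fun n => formNorm N ((Zn n).bilin - Z.bilin)) atTop (𝓝 0)) :
    ConvergesCompactly (fun n => expForm T (Wn n) (memLp_top_of_continuousOn hU (hWn n)) (Zn n))
      (expForm T W (memLp_top_of_continuousOn hU hW) Z) := by
  obtain ⟨R, w, hw, hw₀, hR, hRn, hdist⟩ :=
    exists_bounds_of_tendstoUniformlyOn hU.isCompact_closure hWn hW hWconv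
  exact hV.convergesCompactly_expForm _ hT.subset_smoothFns hT.denseRange_inclL
    (hT.isCompactOperator_inclL hU) _ hw hw₀ (fun x hx => hR x (subset_closure hx))
    (fun n x hx => hRn n x (subset_closure hx)) (fun n x hx => hdist n x (subset_closure hx))
    Zn Z hZ

end IsTestSpace

lemma IsIntermediateSpace.gradOp_domain_le {d : ℕ} {T : Set (E d → ℝ)} {U : Opens (E d)}
    {V : Submodule ℝ (L2 U)} {N : L2 U → ℝ≥0∞} (hV : IsIntermediateSpace T V N) :
    (gradOp T U).domain ≤ V := fun u hu => by
  rw [← SetLike.mem_coe, ← H1Space.range_inclL] at hu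
  obtain ⟨p, rfl⟩ := hu
  exact hV.inclL_mem p

lemma isIntermediateSpace_Hs0 {d : ℕ} (hd : 1 ≤ d) (U : Opens (E d)) {s : ℝ} (hs0 : 0 ≤ s)
    (hs1 : s < 1) : IsIntermediateSpace (testFns U) (Hs0 s U) (Hs0Norm s U) :=
  (isTestSpace_testFns U).isIntermediateSpace hd hs0 hs1

lemma isIntermediateSpace_Hs {d : ℕ} (hd : 1 ≤ d) {U : Opens (E d)}
    (hU : Bornology.IsBounded (U : Set (E d))) (hL : IsLipschitzDomain (U : Set (E d))) {s : ℝ}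
    (hs0 : 0 ≤ s) (hs1 : s < 1) : IsIntermediateSpace (smoothFns d) (Hs s U) (HsNorm s U) := by
  rw [hsNorm_eq_extNorm]
  exact (isTestSpace_smoothFns hU hL).isIntermediateSpace hd hs0 hs1

end SymFormConv

end

open SymFormConv in
theorem mainTheorem10_general {d : ℕ} (hd : 1 ≤ d)
    (U : Opens (E d))
    (hU : Bornology.IsBounded (U : Set (E d)))
    (s : ℝ) (hs0 : 0 ≤ s) (hs1 : s < 1)
    (Wn : ℕ → E d → ℝ) (W : E d → ℝ)
    (hWn : ∀ n, ContinuousOn (Wn n) (closure (U : Set (E d))))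
    (hW : ContinuousOn W (closure (U : Set (E d))))
    (hWconv : TendstoUniformlyOn Wn W atTop (closure (U : Set (E d)))) :
    (H10 U ≤ Hs0 s U ∧
      ∀ (Zn : ℕ → BoundedSymmForm (Hs0 s U) (Hs0Norm s U))
        (Z : BoundedSymmForm (Hs0 s U) (Hs0Norm s U)),
        Tendsto (fun n => formNorm (Hs0Norm s U)
          ((Zn n).bilin - Z.bilin)) atTop (𝓝 0) →
        ConvergesCompactly
          (fun n => dirichletForm (Wn n)
            (memLp_top_of_continuousOn hU (hWn n)) (Zn n))
          (dirichletForm W (memLp_top_of_continuousOn hU hW) Z)) ∧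
    (IsLipschitzDomain (U : Set (E d)) →
      H1 U ≤ Hs s U ∧
      ∀ (Zn : ℕ → BoundedSymmForm (Hs s U) (HsNorm s U))
        (Z : BoundedSymmForm (Hs s U) (HsNorm s U)),
        Tendsto (fun n => formNorm (HsNorm s U)
          ((Zn n).bilin - Z.bilin)) atTop (𝓝 0) →
        ConvergesCompactly
          (fun n => neumannForm (Wn n)
            (memLp_top_of_continuousOn hU (hWn n)) (Zn n))
          (neumannForm W (memLp_top_of_continuousOn hU hW) Z)) := by
  refine ⟨?_, fun hL => ?_⟩
  · have hV := isIntermediateSpace_Hs0 hd U hs0 hs1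
    exact ⟨hV.gradOp_domain_le,
      (isTestSpace_testFns U).convergesCompactly_expForm hU hV hWn hW hWconv⟩
  · have hV := isIntermediateSpace_Hs hd hU hL hs0 hs1
    exact ⟨hV.gradOp_domain_le,
      (isTestSpace_smoothFns hU hL).convergesCompactly_expForm hU hV hWn hW hWconv⟩

theorem mainTheorem10 {d : ℕ} (hd : 2 ≤ d)
    (U : TopologicalSpace.Opens (SymFormConv.E d))
    (hU : Bornology.IsBounded (U : Set (SymFormConv.E d)))
    (s : ℝ) (hs0 : 0 ≤ s) (hs1 : s < 1)
    (Wn : ℕ → SymFormConv.E d → ℝ) (W : SymFormConv.E d → ℝ)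
    (hWn : ∀ n, ContinuousOn (Wn n) (closure (U : Set (SymFormConv.E d))))
    (hW : ContinuousOn W (closure (U : Set (SymFormConv.E d))))
    (hWconv : TendstoUniformlyOn Wn W atTop (closure (U : Set (SymFormConv.E d)))) :
    (SymFormConv.H10 U ≤ SymFormConv.Hs0 s U ∧
      ∀ (Zn : ℕ → SymFormConv.BoundedSymmForm (SymFormConv.Hs0 s U) (SymFormConv.Hs0Norm s U))
        (Z : SymFormConv.BoundedSymmForm (SymFormConv.Hs0 s U) (SymFormConv.Hs0Norm s U)),
        Tendsto (fun n => SymFormConv.formNorm (SymFormConv.Hs0Norm s U)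
          ((Zn n).bilin - Z.bilin)) atTop (𝓝 0) →
        SymFormConv.ConvergesCompactly
          (fun n => SymFormConv.dirichletForm (Wn n)
            (SymFormConv.memLp_top_of_continuousOn hU (hWn n)) (Zn n))
          (SymFormConv.dirichletForm W (SymFormConv.memLp_top_of_continuousOn hU hW) Z)) ∧
    (SymFormConv.IsLipschitzDomain (U : Set (SymFormConv.E d)) →
      SymFormConv.H1 U ≤ SymFormConv.Hs s U ∧
      ∀ (Zn : ℕ → SymFormConv.BoundedSymmForm (SymFormConv.Hs s U) (SymFormConv.HsNorm s U))
        (Z : SymFormConv.BoundedSymmForm (SymFormConv.Hs s U) (SymFormConv.HsNorm s U)),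
        Tendsto (fun n => SymFormConv.formNorm (SymFormConv.HsNorm s U)
          ((Zn n).bilin - Z.bilin)) atTop (𝓝 0) →
        SymFormConv.ConvergesCompactly
          (fun n => SymFormConv.neumannForm (Wn n)
            (SymFormConv.memLp_top_of_continuousOn hU (hWn n)) (Zn n))
          (SymFormConv.neumannForm W (SymFormConv.memLp_top_of_continuousOn hU hW) Z)) :=
  mainTheorem10_general (one_le_two.trans hd) U hU s hs0 hs1 Wn W hWn hW hWconv
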